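/- **Setting.** Let $d\ge 1$, $k\ge 2$, $n\ge 2$ be integers and $R,M>0$. Let $\mathcal M(R,M)$ be the set of Borel measures on $\mathbb R^d$ carried by the closed ball $\mathcal B(0,R)$ and of total mass at most $M$. Let $X$ be a random measure with $X\in\mathcal M(R,M)$ almost surely, let $X_1,\dots,X_n$ be an i.i.d. sample drawn from $X$, and let $\mathbb E(X)$ be the mean measure, $\mathbb E(X)(A)=\mathbb E(X(A))$. Assume that $\mathbb E(X)$ is not carried by a set of at most $k$ points. For a finite nonempty $S\subset\{1,\dots,n\}$ put $\bar X_S=\frac1{|S|}\sum_{i\in S}X_i$. For $\mathbf c=(c_1,\dots,c_k)\in(\mathbb R^d)^k$ (with the Euclidean norm on $(\mathbb R^d)^k$) let $W_j(\mathbf c)=\{x:\ \|x-c_j\|<\|x-c_i\|\ \forall i<j,\ \|x-c_j\|\le\|x-c_i\|\ \forall i>j\}$, $N(\mathbf c)=\{x:\ \exists i<j,\ x\in W_i(\mathbf c),\ \|x-c_i\|=\|x-c_j\|\}$, and $F(\mathbf c)=\int\min_{j}\|u-c_j\|^2\,\mathbb E(X)(du)$. Let $F^*$ be the infimum of $F$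 over $\mathcal B(0,R)^k$ and $\mathcal C_{opt}$ the set of minimizers of $F$ over $\mathcal B(0,R)^k$. Put $$B=\inf_{\mathbf c^*\in\mathcal C_{opt},\,i\ne j}\|c_i^*-c_j^*\|,\qquad p_{min}=\inf_{\mathbf c^*\in\mathcal C_{opt},\,j}\mathbb E(X)(W_j(\mathbf c^*)).$$ For a set $A$ and $t\ge0$ let $\mathcal B(A,t)=\bigcup_{u\in A}\mathcal B(u,t)$ (closed balls). Assume the margin condition with radius $r_0>0$: for all $0\le t\le r_0$, $$\sup_{\mathbf c^*\in\mathcal C_{opt}}\mathbb E(X)\big(\mathcal B(N(\mathbf c^*),t)\big)\le\frac{B\,p_{min}}{128R^2}\,t .$$ Let $R_0=\frac{Br_0}{16\sqrt2R}$ and $\kappa_0=R_0/R$. **Algorithm.** Let $B_1,\dots,B_T\subset\{1,\dots,n\}$ be disjoint mini-batches of the same length $L$, with $T=\lfloor n/L\rfloor$, each split into two disjoint halves $B_t^{(1)},B_t^{(2)}$ of equal size. Starting from a fixed $\mathbf c^{(0)}\in\mathcal B(\mathcal C_{opt},R_0)$, for $t=0,\dots,T-1$ and $j=1,\dots,k$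 set $$c_j^{(t+1)}=\pi_{\mathcal B(0,R)}\!\left(c_j^{(t)}-\frac{\int(c_j^{(t)}-u)\mathbf 1_{W_j(\mathbf c^{(t)})}(u)\,\bar X_{B_{t+1}^{(2)}}(du)}{(t+1)\,\bar X_{B_{t+1}^{(1)}}(W_j(\mathbf c^{(t)}))}\right),$$ where $\pi_{\mathcal B(0,R)}$ is the projection onto $\mathcal B(0,R)$, and the fraction is read as $0$ if its denominator is $0$. **Theorem.** There is an absolute constant $c_0>0$ such that for every $c_1\ge c_0$ there is a constant $C>0$, depending only on $c_1$ (in particular not on the dimension $d$), such that, for all data as above with $$c_0\,\frac{kM^2\log n}{(\kappa_0p_{min})^2}\le L\le c_1\,\frac{kM^2\log n}{(\kappa_0p_{min})^2},$$ the variable $F(\mathbf c^{(T)})-F^*$ is integrable and $$\mathbb E\big(F(\mathbf c^{(T)})-F^*\big)\le\mathbb E(X)(\mathbb R^d)\; C\,k^2M^3R^2\,\frac{\log n}{n\,\kappa_0^2\,p_{min}^3}.$$ In the point-sample case, that is when $X=\delta_Y$ and $X_i=\delta_{Y_i}$ with $Y_1,\dots,Y_n$ i.i.d. copies of a random point $Y$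 of $\mathbb R^d$, the same result holds, with the same $c_0$, $c_1$, $C$, for the algorithm that does not split the batches (so that no halves $B_t^{(1)},B_t^{(2)}$ are needed) and uses the update $$c_j^{(t+1)}=c_j^{(t)}-\frac{\int(c_j^{(t)}-u)\mathbf 1_{W_j(\mathbf c^{(t)})}(u)\,\bar X_{B_{t+1}}(du)}{(t+1)\,\bar X_{B_{t+1}}(W_j(\mathbf c^{(t)}))}.$$ -/

import Mathlib

open MeasureTheory ProbabilityTheory

universe u

noncomputable section

namespace MeanMeasure

/-- The Euclidean space `ℝ^d`. -/
abbrev Pt (d : ℕ) : Type := EuclideanSpace ℝ (Fin d)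

/-- Codebooks `c = (c_1, …, c_k)` of points of `ℝ^d`; the norm on `(ℝ^d)^k` is Euclidean,
`‖c‖² = ∑ j, ‖c j‖²`. -/
abbrev Codebook (d k : ℕ) : Type := PiLp 2 (fun _ : Fin k => Pt d)

/-- `M(R, M)`: Borel measures carried by the closed ball `B(0, R)`, of total mass at most `M`. -/
def boundedMeasures (d : ℕ) (R M : ℝ) : Set (Measure (Pt d)) :=
  {ν | ν (Metric.closedBall 0 R)ᶜ = 0 ∧ ν Set.univ ≤ ENNReal.ofReal M}

/-- `X_1, …, X_n` is an i.i.d. sample drawn from the random variable `X`. -/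
structure IsIIDSample {Ω S : Type*} [MeasurableSpace Ω] [MeasurableSpace S] {n : ℕ}
    (P : Measure Ω) (X : Ω → S) (Xs : Fin n → Ω → S) : Prop where
  measurable_pop : Measurable X
  measurable : ∀ i, Measurable (Xs i)
  indep : iIndepFun Xs P
  ident : ∀ i, IdentDistrib (Xs i) X P P

/-- The mean measure `E(X)`, given on measurable sets by `E(X)(A) = E (X(A))`. -/
def meanMeasure {Ω : Type*} [MeasurableSpace Ω] {d : ℕ} (P : Measure Ω)
    (X : Ω → Measure (Pt d)) : Measure (Pt d) :=
  P.bind X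

theorem meanMeasure_apply {Ω : Type*} [MeasurableSpace Ω] {d : ℕ} (P : Measure Ω)
    (X : Ω → Measure (Pt d)) (hX : Measurable X) {A : Set (Pt d)} (hA : MeasurableSet A) :
    meanMeasure P X A = ∫⁻ ω, X ω A ∂P :=
  Measure.bind_apply hA hX.aemeasurable

/-- The empirical mean measure over the batch `B`: `(1 / |B|) ∑_{i ∈ B} X_i`. -/
def batchMean {d n : ℕ} (ν : Fin n → Measure (Pt d)) (B : Finset (Fin n)) : Measure (Pt d) :=
  (B.card : ENNReal)⁻¹ • ∑ i ∈ B, ν i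

/-- The Voronoi cell `W_j(c)`, ties being given to the smallest index. -/
def cell {d k : ℕ} (c : Codebook d k) (j : Fin k) : Set (Pt d) :=
  {x | (∀ i, i < j → ‖x - c j‖ < ‖x - c i‖) ∧ (∀ i, j < i → ‖x - c j‖ ≤ ‖x - c i‖)}

/-- The skeleton `N(c)` of the Voronoi diagram of `c`. -/
def skeleton {d k : ℕ} (c : Codebook d k) : Set (Pt d) :=
  {x | ∃ i j, i < j ∧ x ∈ cell c i ∧ ‖x - c i‖ = ‖x - c j‖}

/-- `B(A, r) = ⋃_{u ∈ A} B(u, r)`, with closed balls. -/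
def neighborhood {E : Type*} [PseudoMetricSpace E] (A : Set E) (r : ℝ) : Set E :=
  ⋃ u ∈ A, Metric.closedBall u r

/-- `B(0, R)^k`. -/
def codebooksIn (d k : ℕ) (R : ℝ) : Set (Codebook d k) :=
  {c | ∀ j, c j ∈ Metric.closedBall (0 : Pt d) R}

/-- The distortion `F(c) = ∫ min_j ‖u - c_j‖² μ(du)`. -/
def distortion {d k : ℕ} (μ : Measure (Pt d)) (c : Codebook d k) : ℝ :=
  ∫ u, ⨅ j, ‖u - c j‖ ^ 2 ∂μ

/-- The optimal distortion `F*` with `k` points. -/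
def optDistortion {d : ℕ} (k : ℕ) (R : ℝ) (μ : Measure (Pt d)) : ℝ :=
  sInf (distortion μ '' codebooksIn d k R)

/-- The set `C_opt` of optimal `k`-points codebooks. -/
def optimalCodebooks {d : ℕ} (k : ℕ) (R : ℝ) (μ : Measure (Pt d)) : Set (Codebook d k) :=
  {c | c ∈ codebooksIn d k R ∧ ∀ c' ∈ codebooksIn d k R, distortion μ c ≤ distortion μ c'}

/-- `B`, the infimum of `‖c*_i - c*_j‖` over optimal codebooks `c*` and `i ≠ j`. -/
def minSeparation {d : ℕ} (k : ℕ) (R : ℝ) (μ : Measure (Pt d)) : ℝ :=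
  sInf {b | ∃ c ∈ optimalCodebooks k R μ, ∃ i j, i ≠ j ∧ b = ‖c i - c j‖}

/-- `p_min`, the infimum of `μ(W_j(c*))` over optimal codebooks `c*` and `j`. -/
def minMass {d : ℕ} (k : ℕ) (R : ℝ) (μ : Measure (Pt d)) : ℝ :=
  sInf {p | ∃ c ∈ optimalCodebooks k R μ, ∃ j, p = μ.real (cell c j)}

/-- `μ` is supported by more than `k` points: no set of at most `k` points carries `μ`. -/
def SupportedByMoreThan {d : ℕ} (k : ℕ) (μ : Measure (Pt d)) : Prop :=
  ∀ S : Finset (Pt d), S.card ≤ k → μ (S : Set (Pt d))ᶜ ≠ 0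

/-- The margin condition with radius `r₀` (for `k`-points quantization on `B(0, R)`). -/
def MarginCondition {d : ℕ} (k : ℕ) (R r₀ : ℝ) (μ : Measure (Pt d)) : Prop :=
  0 < r₀ ∧ ∀ t : ℝ, 0 ≤ t → t ≤ r₀ →
    ⨆ c ∈ optimalCodebooks k R μ, μ (neighborhood (skeleton c) t) ≤
      ENNReal.ofReal (minSeparation k R μ * minMass k R μ / (128 * R ^ 2) * t)

/-- `R₀ = B r₀ / (16 √2 R)`. -/
def initRadius {d : ℕ} (k : ℕ) (R r₀ : ℝ) (μ : Measure (Pt d)) : ℝ :=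
  minSeparation k R μ * r₀ / (16 * √2 * R)

/-- `κ₀ = R₀ / R`. -/
def kappa {d : ℕ} (k : ℕ) (R r₀ : ℝ) (μ : Measure (Pt d)) : ℝ :=
  initRadius k R r₀ μ / R

/-- The metric projection of `ℝ^d` onto the closed ball `B(0, R)`. -/
def ballProj {d : ℕ} (R : ℝ) (x : Pt d) : Pt d :=
  if ‖x‖ ≤ R then x else (R / ‖x‖) • x

/-- The unprojected centroid update, with step `1 / (t + 1)`:
`c_j ↦ c_j - (∫ (c_j - u) 1_{W_j(c)}(u) ν₂(du)) / ((t + 1) ν₁(W_j(c)))`.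
A codepoint whose cell has `ν₁`-mass zero is left where it is (the inverse of `0` is `0`). -/
def centroidUpdate {d k : ℕ} (t : ℕ) (ν₁ ν₂ : Measure (Pt d)) (c : Codebook d k) :
    Codebook d k :=
  WithLp.toLp 2 fun j =>
    c j - (((t : ℝ) + 1) * ν₁.real (cell c j))⁻¹ • ∫ u in cell c j, (c j - u) ∂ν₂

/-- The mini-batch algorithm with split batches: `c^(t+1)` is the projection onto `B(0, R)^k` of
the centroid update of `c^(t)`. Here `ν₁ t`, `ν₂ t` are the empirical mean measures over the
first and the second half of the mini-batch number `t + 1`, used for the populations of the cells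
and for the gradients respectively. -/
def macQueen {d k : ℕ} (R : ℝ) (ν₁ ν₂ : ℕ → Measure (Pt d)) (c₀ : Codebook d k) :
    ℕ → Codebook d k
  | 0 => c₀
  | t + 1 => WithLp.toLp 2 fun j =>
      ballProj R (centroidUpdate t (ν₁ t) (ν₂ t) (macQueen R ν₁ ν₂ c₀ t) j)

/-- The variant for point samples: batches are not split, and there is no projection. Here `ν t` is
the empirical mean measure over the mini-batch number `t + 1`. -/
def macQueenUnsplit {d k : ℕ} (ν : ℕ → Measure (Pt d)) (c₀ : Codebook d k) : ℕ → Codebook d k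
  | 0 => c₀
  | t + 1 => centroidUpdate t (ν t) (ν t) (macQueenUnsplit ν c₀ t)

/-- `B 0, …, B (T - 1)` are disjoint mini-batches of length `L` of the sample `{1, …, n}`. -/
structure IsMiniBatches {n : ℕ} (T L : ℕ) (B : ℕ → Finset (Fin n)) : Prop where
  card_eq : ∀ t < T, (B t).card = L
  disjoint : ∀ s < T, ∀ t < T, s ≠ t → Disjoint (B s) (B t)

/-- For `t < T` the batch `B t` is split in the two halves `B₁ t`, `B₂ t`, of equal sizes. -/
structure IsHalving {n : ℕ} (T : ℕ) (B B₁ B₂ : ℕ → Finset (Fin n)) : Prop where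
  disjoint : ∀ t < T, Disjoint (B₁ t) (B₂ t)
  union_eq : ∀ t < T, B₁ t ∪ B₂ t = B t
  card_eq : ∀ t < T, (B₁ t).card = (B₂ t).card

/-- The order of magnitude of the length of the mini-batches, `k M² log n / (κ₀ p_min)²`. -/
def batchScale {d : ℕ} (k n : ℕ) (R M r₀ : ℝ) (μ : Measure (Pt d)) : ℝ :=
  k * M ^ 2 * Real.log n / (kappa k R r₀ μ * minMass k R μ) ^ 2

end MeanMeasure

end

noncomputable section

namespace MeanMeasure

section

/-! ### Voronoi cells -/

variable {d k : ℕ}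

/-! Fix an optimal codebook c* within R₀ of the starting point, and write μ for the mean measure.
Each point of c* is the centroid of its cell (`centroid_condition`), so the first-order term of the
distortion vanishes there and F(c) − F* ≤ μ(ℝ^d)‖c − c*‖² (`distortion_sub_le`). It remains to bound
E‖c^(T) − c*‖² by a multiple of kR²M/(p_min T), where T is of order n/L.

If ‖c − c*‖ ≤ R₀, a point whose cells for c and c* have different indices lies within O(R‖c − c*‖/B)
of the skeleton of c*. The margin condition then bounds the mass of such points by O(p_min‖c −
c*‖/R). Hence the gradient over W_j(c) equals μ(W_j(c))(c_j − c*_j + e_j) with ∑‖e_j‖ ≤ ‖c − c*‖/10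
(`gradient_near_optimal`). Once divided by the cell mass, a step is nearly a relaxation of c towards
c* with weight 1/(t+1). In mean, the squared distance is multiplied by 1 − 1.5/(t+1), plus a noise
of order (t+1)^(-2). Since 1.5 > 1, such a recursion decays like 1/t, whatever its initial value.

This contraction is local, so the iterates must stay in the ball of radius R₀ around c*. A Hoeffding
inequality in Hilbert spaces, free of the dimension (`measure_norm_average_sub_ge_le`), makes all
cell masses and gradients accurate outside an event of probability at most 4k/n^10. When they are
accurate, the ball is invariant (`norm_centroidUpdate_sub_le`). A union bound over the steps does
the rest (`integral_sq_norm_sub_le_of_local_contraction`).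

The denominators are random too. With split batches they are independent of the gradients and the
expectations factor (`projectedStep_contraction`). For sample points, a leave-one-out identity
computes the mean of the ratio exactly (`mul_integral_ratio_eq`, `plainStep_contraction`). -/

theorem norm_sub_le_of_mem_cell {c : Codebook d k} {j : Fin k} {x : Pt d} (h : x ∈ cell c j)
    (i : Fin k) : ‖x - c j‖ ≤ ‖x - c i‖ := by
  rcases lt_trichotomy i j with hij | rfl | hij
  · exact (h.1 i hij).le
  · exact le_rfl
  · exact h.2 i hij

theorem eq_of_mem_cell {c : Codebook d k} {i j : Fin k} {x : Pt d} (hi : x ∈ cell c i)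
    (hj : x ∈ cell c j) : i = j := by
  rcases lt_trichotomy i j with hij | rfl | hij
  · exact absurd (norm_sub_le_of_mem_cell hi j) (not_le.2 (hj.1 i hij))
  · rfl
  · exact absurd (norm_sub_le_of_mem_cell hj i) (not_le.2 (hi.1 j hij))

theorem exists_mem_cell (hk : 0 < k) (c : Codebook d k) (x : Pt d) : ∃ j, x ∈ cell c j := by
  classical
  have : Nonempty (Fin k) := ⟨⟨0, hk⟩⟩
  obtain ⟨j₀, -, hj₀⟩ := Finset.exists_min_image Finset.univ (fun j => ‖x - c j‖)
    Finset.univ_nonempty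
  set S : Finset (Fin k) := Finset.univ.filter fun j => ∀ i, ‖x - c j‖ ≤ ‖x - c i‖ with hS
  have hne : S.Nonempty := ⟨j₀, by simpa [hS] using hj₀⟩
  have hmem : ∀ i, ‖x - c (S.min' hne)‖ ≤ ‖x - c i‖ := by
    exact (Finset.mem_filter.1 (S.min'_mem hne)).2
  refine ⟨S.min' hne, fun i hi => ?_, fun i _ => hmem i⟩
  refine lt_of_le_of_ne (hmem i) fun heq => ?_
  have hiS : i ∈ S := by
    rw [hS, Finset.mem_filter]
    exact ⟨Finset.mem_univ _, fun l => heq ▸ hmem l⟩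
  exact absurd (S.min'_le i hiS) (not_le.2 hi)

theorem iInf_sq_eq_of_mem_cell {c : Codebook d k} {j : Fin k} {x : Pt d} (h : x ∈ cell c j) :
    ⨅ i, ‖x - c i‖ ^ 2 = ‖x - c j‖ ^ 2 := by
  have : Nonempty (Fin k) := ⟨j⟩
  refine le_antisymm (ciInf_le (Set.finite_range _).bddBelow j) (le_ciInf fun i => ?_)
  have := norm_sub_le_of_mem_cell h i
  gcongr

theorem iInf_sq_le (c : Codebook d k) (x : Pt d) (j : Fin k) :
    ⨅ i, ‖x - c i‖ ^ 2 ≤ ‖x - c j‖ ^ 2 :=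
  ciInf_le (Set.finite_range _).bddBelow j

theorem measurableSet_setOf_mem_cell (j : Fin k) :
    MeasurableSet {q : Codebook d k × Pt d | q.2 ∈ cell q.1 j} := by
  have hf : ∀ i : Fin k, Measurable fun q : Codebook d k × Pt d => ‖q.2 - q.1 i‖ := fun i =>
    Continuous.measurable (by fun_prop)
  have : {q : Codebook d k × Pt d | q.2 ∈ cell q.1 j} =
      (⋂ i, ⋂ (_ : i < j), {q | ‖q.2 - q.1 j‖ < ‖q.2 - q.1 i‖}) ∩
      ⋂ i, ⋂ (_ : j < i), {q | ‖q.2 - q.1 j‖ ≤ ‖q.2 - q.1 i‖} := by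
    ext q
    simp [cell]
  rw [this]
  exact (MeasurableSet.iInter fun i => MeasurableSet.iInter fun _ =>
    measurableSet_lt (hf j) (hf i)).inter (MeasurableSet.iInter fun i => MeasurableSet.iInter
    fun _ => measurableSet_le (hf j) (hf i))

theorem measurableSet_cell (c : Codebook d k) (j : Fin k) : MeasurableSet (cell c j) :=
  measurable_prodMk_left (measurableSet_setOf_mem_cell j)

theorem pairwise_disjoint_cell (c : Codebook d k) :
    Pairwise (Function.onFun Disjoint (cell c)) := fun _ _ hij =>
  Set.disjoint_left.2 fun _ hi hj => hij (eq_of_mem_cell hi hj)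

theorem iUnion_cell (hk : 0 < k) (c : Codebook d k) : ⋃ j, cell c j = Set.univ :=
  Set.eq_univ_of_forall fun x => Set.mem_iUnion.2 (exists_mem_cell hk c x)

theorem integral_eq_sum_cell {E : Type*} [NormedAddCommGroup E] [NormedSpace ℝ E]
    (hk : 0 < k) (c : Codebook d k) {μ : Measure (Pt d)} {f : Pt d → E} (hf : Integrable f μ) :
    ∫ x, f x ∂μ = ∑ j, ∫ x in cell c j, f x ∂μ := by
  rw [← integral_iUnion_fintype (measurableSet_cell c) (pairwise_disjoint_cell c)
    fun _ => hf.integrableOn, iUnion_cell hk, Measure.restrict_univ]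

theorem sum_real_cell (hk : 0 < k) (c : Codebook d k) (μ : Measure (Pt d)) [IsFiniteMeasure μ] :
    ∑ j, μ.real (cell c j) = μ.real Set.univ := by
  have := integral_eq_sum_cell hk c (integrable_const (μ := μ) (1 : ℝ))
  simpa using this.symm

/-! ### Distortion and optimal codebooks -/

theorem continuous_iInf_sq {X : Type*} [TopologicalSpace X] {f : X → Codebook d k} {g : X → Pt d}
    (hf : Continuous f) (hg : Continuous g) : Continuous fun x => ⨅ j, ‖g x - f x j‖ ^ 2 := by
  rcases isEmpty_or_nonempty (Fin k) with h | h
  · simp only [Real.iInf_of_isEmpty]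
    exact continuous_const
  · simp_rw [← Finset.inf'_univ_eq_ciInf]
    refine Continuous.finset_inf'_apply _ fun j _ => ?_
    fun_prop

theorem integrable_of_continuous {E : Type*} [NormedAddCommGroup E] {μ : Measure (Pt d)}
    [IsFiniteMeasure μ] {R : ℝ} (hμ : ∀ᵐ x ∂μ, ‖x‖ ≤ R) {f : Pt d → E} (hf : Continuous f) :
    Integrable f μ := by
  have h := hf.continuousOn.integrableOn_compact (μ := μ) (isCompact_closedBall (0 : Pt d) R)
  rwa [IntegrableOn, Measure.restrict_eq_self_of_ae_mem] at h
  filter_upwards [hμ] with x hx using by simpa using hx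

theorem optDistortion_eq {μ : Measure (Pt d)} {R : ℝ} {c : Codebook d k} (hc : c ∈ optimalCodebooks k R μ) :
    optDistortion k R μ = distortion μ c := by
  refine IsLeast.csInf_eq ⟨⟨c, hc.1, rfl⟩, ?_⟩
  rintro _ ⟨c', hc', rfl⟩
  exact hc.2 c' hc'

variable {μ : Measure (Pt d)} [IsFiniteMeasure μ] {R : ℝ}

theorem integrable_iInf_sq (hμ : ∀ᵐ x ∂μ, ‖x‖ ≤ R) (c : Codebook d k) :
    Integrable (fun x => ⨅ j, ‖x - c j‖ ^ 2) μ :=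
   integrable_of_continuous hμ (continuous_iInf_sq continuous_const continuous_id)

theorem distortion_eq_sum (hk : 0 < k) (hμ : ∀ᵐ x ∂μ, ‖x‖ ≤ R) (c : Codebook d k) :
    distortion μ c = ∑ j, ∫ x in cell c j, ‖x - c j‖ ^ 2 ∂μ := by
  rw [distortion, integral_eq_sum_cell hk c (integrable_iInf_sq hμ c)]
  exact Finset.sum_congr rfl fun j _ =>
    setIntegral_congr_fun (measurableSet_cell c j) fun x hx => iInf_sq_eq_of_mem_cell hx

/-- Assigning each point through the cells of another codebook can only raise the cost. -/
theorem distortion_le_sum (hk : 0 < k) (hμ : ∀ᵐ x ∂μ, ‖x‖ ≤ R) (c c' : Codebook d k) :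
    distortion μ c ≤ ∑ j, ∫ x in cell c' j, ‖x - c j‖ ^ 2 ∂μ := by
  rw [distortion, integral_eq_sum_cell hk c' (integrable_iInf_sq hμ c)]
  refine Finset.sum_le_sum fun j _ => ?_
  refine integral_mono (integrable_iInf_sq hμ c).integrableOn
    (integrable_of_continuous hμ (by fun_prop)).integrableOn fun x => iInf_sq_le c x j

theorem setIntegral_sq_norm_sub (hμ : ∀ᵐ x ∂μ, ‖x‖ ≤ R) (W : Set (Pt d)) (a b : Pt d) :
    ∫ x in W, ‖x - b‖ ^ 2 ∂μ = ∫ x in W, ‖x - a‖ ^ 2 ∂μ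
      + 2 * inner ℝ (∫ x in W, (a - x) ∂μ) (b - a) + μ.real W * ‖b - a‖ ^ 2 := by
  have h1 : Integrable (fun x => a - x) (μ.restrict W) :=
    (integrable_of_continuous hμ (by fun_prop)).integrableOn
  have h2 : Integrable (fun x => ‖x - a‖ ^ 2) (μ.restrict W) :=
    (integrable_of_continuous hμ (by fun_prop)).integrableOn
  have h3 : Integrable (fun x => 2 * inner ℝ (b - a) (a - x)) (μ.restrict W) :=
    (h1.const_inner _).const_mul _
  have h4 : Integrable (fun x => ‖x - a‖ ^ 2 + 2 * inner ℝ (b - a) (a - x)) (μ.restrict W) :=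
    h2.add h3
  have hpt : ∀ x, ‖x - b‖ ^ 2 = (‖x - a‖ ^ 2 + 2 * inner ℝ (b - a) (a - x)) + ‖b - a‖ ^ 2 := by
    intro x
    have : x - b = -((b - a) + (a - x)) := by abel
    rw [this, norm_neg, norm_add_sq_real, norm_sub_rev a x]
    ring
  simp_rw [hpt]
  rw [integral_add h4 (integrable_const _), integral_add h2 h3, integral_const_mul,
    integral_inner h1, real_inner_comm]
  simp [mul_comm]

/-- The codebook `c` with its `j`-th point replaced by `x`. -/
def replace (c : Codebook d k) (j : Fin k) (x : Pt d) : Codebook d k :=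
  WithLp.toLp 2 (Function.update (fun i => c i) j x)

theorem replace_self (c : Codebook d k) (j : Fin k) (x : Pt d) : replace c j x j = x := by
  simp [replace]

theorem replace_of_ne (c : Codebook d k) {i j : Fin k} (h : i ≠ j) (x : Pt d) :
    replace c j x i = c i := by
  simp [replace, h]

theorem replace_mem_codebooksIn {c : Codebook d k} (hc : c ∈ codebooksIn d k R) (j : Fin k)
    {x : Pt d} (hx : ‖x‖ ≤ R) : replace c j x ∈ codebooksIn d k R := by
  intro i
  by_cases h : i = j
  · subst h
    simpa [replace_self] using hx
  · rw [replace_of_ne c h]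
    exact hc i

theorem distortion_replace_le (hk : 0 < k) (hμ : ∀ᵐ x ∂μ, ‖x‖ ≤ R) (c : Codebook d k) (j : Fin k)
    (y : Pt d) : distortion μ (replace c j y) ≤ distortion μ c +
      (∫ x in cell c j, ‖x - y‖ ^ 2 ∂μ - ∫ x in cell c j, ‖x - c j‖ ^ 2 ∂μ) := by
  refine (distortion_le_sum hk hμ (replace c j y) c).trans (le_of_eq ?_)
  rw [distortion_eq_sum hk hμ c, ← Finset.add_sum_erase _ _ (Finset.mem_univ j),
    ← Finset.add_sum_erase (a := j) _ (fun j => ∫ x in cell c j, ‖x - c j‖ ^ 2 ∂μ)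
      (Finset.mem_univ j)]
  have : ∑ i ∈ Finset.univ.erase j, ∫ x in cell c i, ‖x - replace c j y i‖ ^ 2 ∂μ =
      ∑ i ∈ Finset.univ.erase j, ∫ x in cell c i, ‖x - c i‖ ^ 2 ∂μ :=
    Finset.sum_congr rfl fun i hi => by rw [replace_of_ne c (Finset.ne_of_mem_erase hi)]
  rw [this, replace_self]
  ring

/-- Moving c_j to the centroid of its cell lowers the distortion by at least ‖g‖²/μ(W), where g is
the gradient over the cell W. The centroid lies in B(0, R), so the new codebook is a legitimate
competitor and optimality forces g = 0. A cell of mass zero is trivial. -/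
theorem centroid_condition (hk : 0 < k) (hμ : ∀ᵐ x ∂μ, ‖x‖ ≤ R) {c : Codebook d k}
    (hc : c ∈ optimalCodebooks k R μ) (j : Fin k) : ∫ x in cell c j, (c j - x) ∂μ = 0 := by
  set W := cell c j
  set g := ∫ x in W, (c j - x) ∂μ with hg
  have hid : Integrable (fun x : Pt d => x) (μ.restrict W) :=
    (integrable_of_continuous hμ continuous_id).integrableOn
  rcases (measureReal_nonneg : 0 ≤ μ.real W).eq_or_lt with hp | hp
  · rw [hg, Measure.restrict_eq_zero.2 ((measureReal_eq_zero_iff).1 hp.symm),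
      integral_zero_measure]
  have hgm : g = μ.real W • c j - ∫ x in W, x ∂μ := by
    rw [hg, integral_sub (integrable_const _) hid]
    simp
  set m : Pt d := c j - (μ.real W)⁻¹ • g with hm
  have hm' : m = (μ.real W)⁻¹ • ∫ x in W, x ∂μ := by
    rw [hm, hgm, smul_sub, smul_smul, inv_mul_cancel₀ hp.ne', one_smul]
    abel
  have hmR : ‖m‖ ≤ R := by
    rw [hm', norm_smul, norm_inv, Real.norm_of_nonneg hp.le, inv_mul_le_iff₀ hp, mul_comm]
    refine (norm_integral_le_of_norm_le_const (ae_restrict_of_ae hμ)).trans (le_of_eq ?_)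
    simp
  have h1 := hc.2 _ (replace_mem_codebooksIn hc.1 j hmR)
  have h2 := distortion_replace_le hk hμ c j m
  rw [setIntegral_sq_norm_sub hμ W (c j) m, ← hg] at h2
  have h3 : m - c j = -((μ.real W)⁻¹ • g) := by rw [hm]; abel
  rw [h3, inner_neg_right, real_inner_smul_right, norm_neg, norm_smul, real_inner_self_eq_norm_sq,
    norm_inv, Real.norm_of_nonneg hp.le] at h2
  have h4 : μ.real W * ((μ.real W)⁻¹ * ‖g‖) ^ 2 = (μ.real W)⁻¹ * ‖g‖ ^ 2 := by
    field_simp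
  have h5 : (μ.real W)⁻¹ * ‖g‖ ^ 2 ≤ 0 := by linarith
  have h6 : ‖g‖ ^ 2 ≤ 0 := by
    by_contra! h
    exact absurd h5 (not_le.2 (mul_pos (inv_pos.2 hp) h))
  simpa using h6

theorem sq_norm_eq_sum (c : Codebook d k) : ‖c‖ ^ 2 = ∑ j, ‖c j‖ ^ 2 :=
  PiLp.norm_sq_eq_of_L2 _ c

theorem norm_apply_le (c : Codebook d k) (j : Fin k) : ‖c j‖ ≤ ‖c‖ :=
  PiLp.norm_apply_le c j

/-- Keep the cells of the optimal codebook and expand each square about c₀ j: the linear term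
vanishes by the centroid condition, and only μ(W_j)‖c j − c₀ j‖² remains. -/
theorem distortion_sub_le (hk : 0 < k) (hμ : ∀ᵐ x ∂μ, ‖x‖ ≤ R) {c₀ : Codebook d k}
    (hc₀ : c₀ ∈ optimalCodebooks k R μ) (c : Codebook d k) :
    distortion μ c - optDistortion k R μ ≤ μ.real Set.univ * ‖c - c₀‖ ^ 2 := by
  rw [optDistortion_eq hc₀, distortion_eq_sum hk hμ c₀, sub_le_iff_le_add]
  refine (distortion_le_sum hk hμ c c₀).trans ?_
  rw [sq_norm_eq_sum, Finset.mul_sum, ← Finset.sum_add_distrib]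
  refine Finset.sum_le_sum fun j _ => ?_
  rw [setIntegral_sq_norm_sub hμ _ (c₀ j) (c j), centroid_condition hk hμ hc₀ j, inner_zero_left]
  have : μ.real (cell c₀ j) ≤ μ.real Set.univ := measureReal_mono (Set.subset_univ _)
  have h2 : μ.real (cell c₀ j) * ‖c j - c₀ j‖ ^ 2 ≤ μ.real Set.univ * ‖(c - c₀) j‖ ^ 2 :=
    mul_le_mul_of_nonneg_right this (by positivity)
  linarith

end

/-! ### Compactness, and positivity of p_min and B -/

section

variable {d k : ℕ} {μ : Measure (Pt d)} [IsFiniteMeasure μ] {R : ℝ}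

theorem isCompact_codebooksIn (d k : ℕ) (R : ℝ) : IsCompact (codebooksIn d k R) := by
  refine Metric.isCompact_of_isClosed_isBounded ?_ ?_
  · have : codebooksIn d k R = ⋂ j, {c : Codebook d k | ‖c j‖ ≤ R} := by
      ext c
      simp [codebooksIn]
    rw [this]
    exact isClosed_iInter fun j => isClosed_le (by fun_prop) continuous_const
  · refine (Metric.isBounded_iff_subset_closedBall 0).2 ⟨√(k * R ^ 2), fun c hc => ?_⟩
    rw [mem_closedBall_zero_iff]
    refine Real.le_sqrt_of_sq_le ?_
    rw [sq_norm_eq_sum]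
    calc ∑ j, ‖c j‖ ^ 2 ≤ ∑ _j : Fin k, R ^ 2 := Finset.sum_le_sum fun j _ => by
          have := mem_closedBall_zero_iff.1 (hc j)
          gcongr
      _ = k * R ^ 2 := by simp

theorem continuousOn_distortion (hk : 0 < k) (hμ : ∀ᵐ x ∂μ, ‖x‖ ≤ R) :
    ContinuousOn (distortion μ) (codebooksIn d k R) := by
  refine continuousOn_of_dominated (bound := fun _ => (R + R) ^ 2) ?_ ?_ (integrable_const _) ?_
  · exact fun c _ => (integrable_iInf_sq hμ c).aestronglyMeasurable
  · intro c hc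
    filter_upwards [hμ] with x hx
    have h0 := iInf_sq_le c x ⟨0, hk⟩
    have h1 : ‖x - c ⟨0, hk⟩‖ ≤ R + R :=
      (norm_sub_le _ _).trans (add_le_add hx (mem_closedBall_zero_iff.1 (hc _)))
    rw [Real.norm_of_nonneg (Real.iInf_nonneg fun _ => sq_nonneg _)]
    exact h0.trans (by gcongr)
  · refine Filter.Eventually.of_forall fun x => Continuous.continuousOn ?_
    exact continuous_iInf_sq continuous_id continuous_const

/-- A repeated point is free to move. Put it on a point of the support of μ that is not a codepoint:
the integrand never increases and drops strictly on a neighbourhood of positive mass. -/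
theorem notMem_optimalCodebooks_of_apply_eq (hk : 0 < k) (hμ : ∀ᵐ x ∂μ, ‖x‖ ≤ R)
    (hsupp : SupportedByMoreThan k μ) {c : Codebook d k} {i j : Fin k} (hij : i ≠ j)
    (heq : c i = c j) : c ∉ optimalCodebooks k R μ := by
  classical
  intro hc
  have hS := hsupp (Finset.univ.image fun i => c i)
    (Finset.card_image_le.trans (by simp))
  set S : Set (Pt d) := ((Finset.univ.image fun i => c i : Finset (Pt d)) : Set (Pt d))ᶜ with hSdef
  have hmemS : ∀ x, x ∈ S ↔ ∀ i, x ≠ c i := by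
    intro x
    simp [hSdef, eq_comm]
  have hS' : μ (S ∩ {x | ‖x‖ ≤ R}) ≠ 0 := by
    rwa [Set.inter_comm, Measure.measure_inter_eq_of_ae (t := {x | ‖x‖ ≤ R}) hμ]
  obtain ⟨x, ⟨hxS, hxR⟩, hx⟩ := exists_mem_forall_mem_nhdsWithin_pos_measure hS'
  set c' := replace c j x with hc'
  have hle : ∀ y, ⨅ l, ‖y - c' l‖ ^ 2 ≤ ⨅ l, ‖y - c l‖ ^ 2 := by
    intro y
    have : Nonempty (Fin k) := ⟨j⟩
    refine le_ciInf fun l => ?_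
    by_cases hl : l = j
    · refine (iInf_sq_le c' y i).trans (le_of_eq ?_)
      rw [hc', replace_of_ne c hij, heq, hl]
    · refine (iInf_sq_le c' y l).trans (le_of_eq ?_)
      rw [hc', replace_of_ne c hl]
  have hopt := hc.2 c' (replace_mem_codebooksIn hc.1 j hxR)
  have hae : (fun y => ⨅ l, ‖y - c' l‖ ^ 2) =ᵐ[μ] fun y => ⨅ l, ‖y - c l‖ ^ 2 := by
    refine (integral_eq_iff_of_ae_le (integrable_iInf_sq hμ c') (integrable_iInf_sq hμ c)
      (Filter.Eventually.of_forall hle)).1 (le_antisymm ?_ hopt)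
    exact integral_mono (integrable_iInf_sq hμ c') (integrable_iInf_sq hμ c) hle
  have hnhds : {y | ‖y - x‖ ^ 2 < ⨅ l, ‖y - c l‖ ^ 2} ∈ nhds x := by
    refine (isOpen_lt (by fun_prop) (continuous_iInf_sq continuous_const continuous_id)).mem_nhds ?_
    obtain ⟨l, hl⟩ := exists_mem_cell hk c x
    have : 0 < ‖x - c l‖ := norm_pos_iff.2 (sub_ne_zero.2 ((hmemS x).1 hxS l))
    change ‖x - x‖ ^ 2 < ⨅ l, ‖x - c l‖ ^ 2
    rw [iInf_sq_eq_of_mem_cell hl, sub_self, norm_zero, zero_pow two_ne_zero]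
    positivity
  have hpos := hx _ (mem_nhdsWithin_of_mem_nhds hnhds)
  refine hpos.ne' (measure_mono_null (fun y hy => ?_) hae)
  simp only [Set.mem_ofPred_eq] at hy
  refine ne_of_lt (lt_of_le_of_lt ?_ hy)
  refine (iInf_sq_le c' y j).trans (le_of_eq ?_)
  rw [hc', replace_self]

theorem exists_distortion_gap (hk : 2 ≤ k) (hR : 0 < R) (hμ : ∀ᵐ x ∂μ, ‖x‖ ≤ R)
    (hsupp : SupportedByMoreThan k μ) (hne : (optimalCodebooks k R μ).Nonempty) :
    ∃ Δ > 0, ∀ c ∈ codebooksIn d k R, (∃ i j, i ≠ j ∧ c i = c j) →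
      optDistortion k R μ + Δ ≤ distortion μ c := by
  set G : Set (Codebook d k) := codebooksIn d k R ∩ ⋃ i, ⋃ j, ⋃ (_ : i ≠ j), {c | c i = c j}
    with hG
  have hGc : IsCompact G := by
    refine (isCompact_codebooksIn d k R).inter_right ?_
    refine isClosed_iUnion_of_finite fun i => isClosed_iUnion_of_finite fun j =>
      isClosed_iUnion_of_finite fun _ => isClosed_eq (by fun_prop) (by fun_prop)
  -- All the points of the zero codebook coincide, so the compact set of degenerate codebooks is
  -- nonempty.
  have h0 : (0 : Codebook d k) ∈ G := by
    refine ⟨fun j => by simpa using hR.le, ?_⟩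
    simp only [Set.mem_iUnion]
    exact ⟨⟨0, by omega⟩, ⟨1, by omega⟩, by simp, rfl⟩
  obtain ⟨c, hcG, hmin⟩ := hGc.exists_isMinOn ⟨0, h0⟩
    ((continuousOn_distortion (by omega) hμ).mono Set.inter_subset_left)
  obtain ⟨c₀, hc₀⟩ := hne
  have hc2 := hcG.2
  simp only [Set.mem_iUnion, Set.mem_ofPred_eq] at hc2
  obtain ⟨i, j, hij, heq⟩ := hc2
  have hnot := notMem_optimalCodebooks_of_apply_eq (by omega) hμ hsupp hij heq
  have hlt : distortion μ c₀ < distortion μ c := by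
    by_contra! h
    exact hnot ⟨hcG.1, fun c' hc' => h.trans (hc₀.2 c' hc')⟩
  refine ⟨distortion μ c - distortion μ c₀, sub_pos.2 hlt, fun c' hc' hdup => ?_⟩
  rw [optDistortion_eq hc₀]
  have : distortion μ c ≤ distortion μ c' := hmin ⟨hc', by
    simp only [Set.mem_iUnion]
    obtain ⟨i, j, h1, h2⟩ := hdup
    exact ⟨i, j, h1, h2⟩⟩
  linarith

theorem minMass_le {μ : Measure (Pt d)} {c : Codebook d k} (hc : c ∈ optimalCodebooks k R μ) (j : Fin k) :
    minMass k R μ ≤ μ.real (cell c j) :=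
  csInf_le ⟨0, by rintro _ ⟨c, -, j, rfl⟩; exact measureReal_nonneg⟩ ⟨c, hc, j, rfl⟩

theorem minSeparation_le {μ : Measure (Pt d)} {c : Codebook d k}
    (hc : c ∈ optimalCodebooks k R μ) {i j : Fin k}
    (hij : i ≠ j) : minSeparation k R μ ≤ ‖c i - c j‖ :=
  csInf_le ⟨0, by rintro _ ⟨c, -, i, j, -, rfl⟩; exact norm_nonneg _⟩ ⟨c, hc, i, j, hij, rfl⟩

/-- Moving c_j onto c_i makes an optimal codebook degenerate, which costs at least the gap Δ. It
costs at most 4R‖c_i − c_j‖ μ(W_j). So Δ ≤ 4R‖c_i − c_j‖ μ(W_j), and bounding either factor above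
bounds the other below, uniformly over the optimal codebooks. -/
theorem minMass_pos_and_minSeparation_pos (hk : 2 ≤ k) (hR : 0 < R) (hμ : ∀ᵐ x ∂μ, ‖x‖ ≤ R)
    (hsupp : SupportedByMoreThan k μ) (hne : (optimalCodebooks k R μ).Nonempty) :
    0 < minMass k R μ ∧ 0 < minSeparation k R μ := by
  obtain ⟨Δ, hΔ, hgap⟩ := exists_distortion_gap hk hR hμ hsupp hne
  have hk0 : 0 < k := by omega
  have key : ∀ c ∈ optimalCodebooks k R μ, ∀ i j, i ≠ j →
      Δ ≤ 4 * R * ‖c i - c j‖ * μ.real (cell c j) := by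
    intro c hc i j hij
    have hi := mem_closedBall_zero_iff.1 (hc.1 i)
    have hj := mem_closedBall_zero_iff.1 (hc.1 j)
    have h1 := hgap (replace c j (c i)) (replace_mem_codebooksIn hc.1 j hi)
      ⟨i, j, hij, by rw [replace_self, replace_of_ne c hij]⟩
    have h2 := distortion_replace_le hk0 hμ c j (c i)
    rw [optDistortion_eq hc] at h1
    have hi1 : IntegrableOn (fun x => ‖x - c i‖ ^ 2) (cell c j) μ :=
      (integrable_of_continuous hμ (by fun_prop)).integrableOn
    have hi2 : IntegrableOn (fun x => ‖x - c j‖ ^ 2) (cell c j) μ :=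
      (integrable_of_continuous hμ (by fun_prop)).integrableOn
    rw [← integral_sub hi1 hi2] at h2
    have h3 : ∫ x in cell c j, (‖x - c i‖ ^ 2 - ‖x - c j‖ ^ 2) ∂μ ≤
        ∫ _x in cell c j, 4 * R * ‖c i - c j‖ ∂μ := by
      refine integral_mono_ae (hi1.sub hi2) (integrable_const _) ?_
      filter_upwards [ae_restrict_of_ae hμ] with x hx
      have ha : ‖x - c i‖ - ‖x - c j‖ ≤ ‖c i - c j‖ := by
        have := norm_sub_norm_le (x - c i) (x - c j)
        rwa [show x - c i - (x - c j) = -(c i - c j) by abel, norm_neg] at this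
      have hb : ‖x - c i‖ + ‖x - c j‖ ≤ 4 * R := by
        linarith [norm_sub_le x (c i), norm_sub_le x (c j)]
      have : ‖x - c i‖ ^ 2 - ‖x - c j‖ ^ 2 =
        (‖x - c i‖ - ‖x - c j‖) * (‖x - c i‖ + ‖x - c j‖) := by ring
      simp only [this]
      calc _ ≤ ‖c i - c j‖ * (‖x - c i‖ + ‖x - c j‖) := by gcongr
        _ ≤ ‖c i - c j‖ * (4 * R) := by gcongr
        _ = _ := by ring
    rw [setIntegral_const, smul_eq_mul] at h3
    linarith
  have hm : 0 < μ.real Set.univ := by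
    refine ENNReal.toReal_pos ?_ (measure_ne_top _ _)
    simpa using hsupp ∅ (by simp)
  obtain ⟨c₀, hc₀⟩ := hne
  have h01 : (⟨0, by omega⟩ : Fin k) ≠ ⟨1, by omega⟩ := by simp
  constructor
  · refine lt_of_lt_of_le (show 0 < Δ / (4 * R * (2 * R)) by positivity)
      (le_csInf ⟨_, c₀, hc₀, ⟨0, hk0⟩, rfl⟩ ?_)
    rintro _ ⟨c, hc, j, rfl⟩
    obtain ⟨i, hij⟩ : ∃ i, i ≠ j := by
      by_cases h : j = ⟨0, hk0⟩
      · exact ⟨_, h ▸ h01.symm⟩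
      · exact ⟨_, Ne.symm h⟩
    have hi := mem_closedBall_zero_iff.1 (hc.1 i)
    have hj := mem_closedBall_zero_iff.1 (hc.1 j)
    have h2 : ‖c i - c j‖ ≤ 2 * R := by linarith [norm_sub_le (c i) (c j)]
    rw [div_le_iff₀ (by positivity)]
    calc Δ ≤ 4 * R * ‖c i - c j‖ * μ.real (cell c j) := key c hc i j hij
      _ ≤ 4 * R * (2 * R) * μ.real (cell c j) := by gcongr
      _ = _ := by ring
  · refine lt_of_lt_of_le (show 0 < Δ / (4 * R * μ.real Set.univ) by positivity)
      (le_csInf ⟨_, c₀, hc₀, _, _, h01, rfl⟩ ?_)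
    rintro _ ⟨c, hc, i, j, hij, rfl⟩
    rw [div_le_iff₀ (by positivity)]
    calc Δ ≤ 4 * R * ‖c i - c j‖ * μ.real (cell c j) := key c hc i j hij
      _ ≤ 4 * R * ‖c i - c j‖ * μ.real Set.univ := by
        gcongr
        exacts [measure_ne_top _ _, Set.subset_univ _]
      _ = _ := by ring

end

section

variable {d k : ℕ}

/-! ### The margin condition near an optimal codebook -/

/-- Along the segment, follow the distance to the nearest site other than c i minus the distance to
c i. It changes sign, so it vanishes somewhere, and there c i ties with another nearest site. -/
theorem exists_mem_segment_skeleton {c : Codebook d k} {i j : Fin k} (hij : j ≠ i) {x y : Pt d}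
    (hx : x ∈ cell c i) (hy : ‖y - c j‖ ≤ ‖y - c i‖) : ∃ z ∈ segment ℝ x y, z ∈ skeleton c := by
  have hne : (Finset.univ.erase i).Nonempty := ⟨j, by simp [hij]⟩
  set g : ℝ → ℝ := fun s => (Finset.univ.erase i).inf' hne
    (fun l => ‖AffineMap.lineMap x y s - c l‖) - ‖AffineMap.lineMap x y s - c i‖ with hg
  have hgc : Continuous g := by
    refine Continuous.sub (Continuous.finset_inf'_apply _ fun l _ => ?_) ?_ <;>
    exact (AffineMap.lineMap_continuous.sub continuous_const).norm
  have h0 : 0 ≤ g 0 := by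
    simp only [hg, AffineMap.lineMap_apply_zero, sub_nonneg]
    exact Finset.le_inf' _ _ fun l _ => norm_sub_le_of_mem_cell hx l
  have h1 : g 1 ≤ 0 := by
    simp only [hg, AffineMap.lineMap_apply_one, sub_nonpos]
    exact (Finset.inf'_le _ (by simp [hij])).trans hy
  obtain ⟨s, hs, hs0⟩ := intermediate_value_Icc' zero_le_one hgc.continuousOn
    (show (0 : ℝ) ∈ Set.Icc (g 1) (g 0) from ⟨h1, h0⟩)
  set z : Pt d := AffineMap.lineMap x y s with hz
  refine ⟨z, ?_, ?_⟩
  · rw [segment_eq_image_lineMap]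
    exact ⟨s, hs, rfl⟩
  have heq : (Finset.univ.erase i).inf' hne (fun l => ‖z - c l‖) = ‖z - c i‖ := by
    simpa [hg, sub_eq_zero] using hs0
  obtain ⟨l, hl, hl'⟩ := Finset.exists_mem_eq_inf' hne (fun l => ‖z - c l‖)
  rw [heq] at hl'
  have hli : l ≠ i := Finset.ne_of_mem_erase hl
  have hmin : ∀ m, ‖z - c i‖ ≤ ‖z - c m‖ := by
    intro m
    by_cases hm : m = i
    · rw [hm]
    · rw [← heq]
      exact Finset.inf'_le _ (by simp [hm])
  -- The skeleton asks that z belong to the cell of the smaller of two tied indices. The cell index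
  -- a of z is the least nearest index; it pairs with l if a = i, and with i otherwise.
  obtain ⟨a, ha⟩ := exists_mem_cell (i.pos) c z
  have hai : ‖z - c a‖ = ‖z - c i‖ := le_antisymm (norm_sub_le_of_mem_cell ha i) (hmin a)
  have hlt : ∀ b, b ≠ a → ‖z - c a‖ = ‖z - c b‖ → a < b := by
    intro b hb hab
    refine lt_of_le_of_ne (not_lt.1 fun h => ?_) hb.symm
    exact absurd hab (ha.1 b h).ne
  by_cases h : a = i
  · exact ⟨a, l, hlt l (h ▸ hli) (hai.trans hl'), ha, hai.trans hl'⟩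
  · exact ⟨a, i, hlt i (Ne.symm h) hai, ha, hai⟩

theorem norm_add_norm_le_sqrt_two (v : Codebook d k) {i j : Fin k} (hij : i ≠ j) :
    ‖v i‖ + ‖v j‖ ≤ √2 * ‖v‖ := by
  have h1 : ‖v i‖ ^ 2 + ‖v j‖ ^ 2 ≤ ‖v‖ ^ 2 := by
    rw [sq_norm_eq_sum, ← Finset.sum_pair (f := fun j => ‖v j‖ ^ 2) hij]
    exact Finset.sum_le_sum_of_subset_of_nonneg (Finset.subset_univ _) fun _ _ _ => sq_nonneg _
  refine abs_le_of_sq_le_sq' ?_ (by positivity) |>.2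
  rw [mul_pow, Real.sq_sqrt (by norm_num)]
  nlinarith [sq_nonneg (‖v i‖ - ‖v j‖)]

/-- Since x is nearer to c j than to c i, the difference h of its squared distances to c₀ j and c₀ i
is at most 4R·√2‖c − c₀‖. A translation of length h/(2D) along c₀ j − c₀ i brings x to the bisector,
so the segment crosses the skeleton. -/
theorem exists_skeleton_near_of_mem_cell_of_mem_cell {R : ℝ} {c₀ c : Codebook d k}
    (hc₀ : c₀ ∈ codebooksIn d k R) {i j : Fin k} (hij : i ≠ j) {x : Pt d} (hxR : ‖x‖ ≤ R)
    (hi : x ∈ cell c₀ i) (hj : x ∈ cell c j) (hD : 0 < ‖c₀ i - c₀ j‖) :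
    ∃ z ∈ skeleton c₀, ‖x - z‖ ≤ 2 * √2 * R * ‖c - c₀‖ / ‖c₀ i - c₀ j‖ := by
  set D := ‖c₀ i - c₀ j‖ with hDdef
  have hDs : ‖c₀ j - c₀ i‖ = D := norm_sub_rev _ _
  have hcell := norm_sub_le_of_mem_cell hi j
  set h := ‖x - c₀ j‖ ^ 2 - ‖x - c₀ i‖ ^ 2 with hh
  have h0 : 0 ≤ h := by
    have : ‖x - c₀ i‖ ^ 2 ≤ ‖x - c₀ j‖ ^ 2 := by gcongr
    linarith
  have ha : ‖x - c₀ j‖ - ‖x - c₀ i‖ ≤ √2 * ‖c - c₀‖ := by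
    refine le_trans ?_ (norm_add_norm_le_sqrt_two (c - c₀) hij)
    have h1 := norm_sub_le_of_mem_cell hj i
    have h2 : ‖x - c₀ j‖ ≤ ‖x - c j‖ + ‖(c - c₀) j‖ := by
      refine le_trans (le_of_eq ?_) (norm_add_le _ _)
      congr 1
      simp
    have h3 : ‖x - c i‖ ≤ ‖x - c₀ i‖ + ‖(c - c₀) i‖ := by
      refine le_trans (le_of_eq ?_) (norm_sub_le _ _)
      congr 1
      simp
    linarith
  have hi' := mem_closedBall_zero_iff.1 (hc₀ i)
  have hj' := mem_closedBall_zero_iff.1 (hc₀ j)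
  have hb : ‖x - c₀ j‖ + ‖x - c₀ i‖ ≤ 4 * R := by
    linarith [norm_sub_le x (c₀ i), norm_sub_le x (c₀ j)]
  have hle : h ≤ √2 * ‖c - c₀‖ * (4 * R) := by
    have : h = (‖x - c₀ j‖ - ‖x - c₀ i‖) * (‖x - c₀ j‖ + ‖x - c₀ i‖) := by rw [hh]; ring
    rw [this]
    have : 0 ≤ √2 * ‖c - c₀‖ := by positivity
    gcongr
  -- The difference of the squared distances decreases at rate 2D² in τ, so this value brings it to
  -- zero.
  set τ := h / (2 * D ^ 2) with hτ
  have hτ0 : 0 ≤ τ := by positivity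
  set y := x + τ • (c₀ j - c₀ i) with hy
  have hyeq : ‖y - c₀ j‖ ≤ ‖y - c₀ i‖ := by
    refine abs_le_of_sq_le_sq' ?_ (norm_nonneg _) |>.2
    have e1 : y - c₀ j = (x - c₀ j) + τ • (c₀ j - c₀ i) := by rw [hy]; abel
    have e2 : y - c₀ i = (x - c₀ i) + τ • (c₀ j - c₀ i) := by rw [hy]; abel
    have e3 : inner ℝ (x - c₀ i) (c₀ j - c₀ i) = inner ℝ (x - c₀ j) (c₀ j - c₀ i) + D ^ 2 := by
      rw [← hDs, ← real_inner_self_eq_norm_sq, ← inner_add_left]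
      congr 1
      abel
    rw [e1, e2, norm_add_sq_real, norm_add_sq_real, real_inner_smul_right, real_inner_smul_right,
      e3]
    have e4 : 2 * (τ * D ^ 2) = h := by
      rw [hτ]
      field_simp
    linarith
  obtain ⟨z, hz, hzs⟩ := exists_mem_segment_skeleton hij.symm hi hyeq
  refine ⟨z, hzs, ?_⟩
  have h1 : ‖x - z‖ ≤ ‖x - y‖ := by
    rw [← dist_eq_norm, ← dist_eq_norm, dist_comm, dist_comm x y]
    rw [segment_eq_image_lineMap] at hz
    obtain ⟨s, hs, rfl⟩ := hz
    rw [dist_lineMap_left, dist_comm x y, Real.norm_of_nonneg hs.1]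
    exact mul_le_of_le_one_left dist_nonneg hs.2
  refine h1.trans ?_
  have h2 : x - y = -(τ • (c₀ j - c₀ i)) := by rw [hy]; abel
  rw [h2, norm_neg, norm_smul, hDs, Real.norm_of_nonneg hτ0, le_div_iff₀ hD]
  have e4 : τ * D * D = h / 2 := by
    rw [hτ]
    field_simp
  rw [e4]
  linarith

variable {μ : Measure (Pt d)} [IsFiniteMeasure μ] {R r₀ : ℝ}

/-- The points whose cells for `c₀` and for `c` have distinct indices. -/
def misclassified (c₀ c : Codebook d k) : Set (Pt d) :=
  {x | ∃ i j, i ≠ j ∧ x ∈ cell c₀ i ∧ x ∈ cell c j}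

theorem measure_neighborhood_le {μ : Measure (Pt d)} {c₀ : Codebook d k} (hmar : MarginCondition k R r₀ μ)
    (hc₀ : c₀ ∈ optimalCodebooks k R μ) {t : ℝ} (ht : 0 ≤ t) (htr : t ≤ r₀)
    (hB : 0 ≤ minSeparation k R μ) (hp : 0 ≤ minMass k R μ) :
    μ.real (neighborhood (skeleton c₀) t) ≤
      minSeparation k R μ * minMass k R μ / (128 * R ^ 2) * t := by
  refine ENNReal.toReal_le_of_le_ofReal (by positivity) (le_trans ?_ (hmar.2 t ht htr))
  exact le_iSup₂ (f := fun c (_ : c ∈ optimalCodebooks k R μ) =>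
    μ (neighborhood (skeleton c) t)) c₀ hc₀

/-- If r₀ exceeded 2R, the margin condition at t = 2R would concern a neighbourhood containing all
of B(0, R), whose mass is at least p_min, yet would bound it by p_min/32. So r₀ ≤ 2R, while B ≤ 2R.
-/
theorem initRadius_le (hk : 2 ≤ k) (hR : 0 < R) (hμ : ∀ᵐ x ∂μ, ‖x‖ ≤ R) {c₀ : Codebook d k}
    (hc₀ : c₀ ∈ optimalCodebooks k R μ) (hB : 0 < minSeparation k R μ) (hp : 0 < minMass k R μ)
    (hmar : MarginCondition k R r₀ μ) : initRadius k R r₀ μ ≤ R := by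
  have h01 : (⟨0, by omega⟩ : Fin k) ≠ ⟨1, by omega⟩ := by simp
  set i : Fin k := ⟨0, by omega⟩
  set j : Fin k := ⟨1, by omega⟩
  have hi := mem_closedBall_zero_iff.1 (hc₀.1 i)
  have hj := mem_closedBall_zero_iff.1 (hc₀.1 j)
  have hB2 : minSeparation k R μ ≤ 2 * R :=
    (minSeparation_le hc₀ h01).trans (by linarith [norm_sub_le (c₀ i) (c₀ j)])
  have hr : r₀ ≤ 2 * R := by
    by_contra! hr
    have hcell : c₀ i ∈ cell c₀ i := by
      have : ∀ l, l ≠ i → ‖c₀ i - c₀ i‖ < ‖c₀ i - c₀ l‖ := by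
        intro l hl
        rw [sub_self, norm_zero]
        exact hB.trans_le (minSeparation_le hc₀ hl.symm)
      exact ⟨fun l hl => this l hl.ne, fun l hl => (this l hl.ne').le⟩
    -- The segment between two codepoints meets the skeleton inside B(0, R), and the ball of radius
    -- 2R about such a point covers B(0, R).
    obtain ⟨z, hz, hzs⟩ := exists_mem_segment_skeleton h01.symm hcell
      (y := c₀ j) (by rw [sub_self, norm_zero]; exact norm_nonneg _)
    have hzR : ‖z‖ ≤ R := mem_closedBall_zero_iff.1
      ((convex_closedBall (0 : Pt d) R).segment_subset (hc₀.1 i) (hc₀.1 j) hz)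
    have h1 := measure_neighborhood_le hmar hc₀ (t := 2 * R) (by positivity) hr.le hB.le hp.le
    have h2 : μ.real Set.univ ≤ μ.real (neighborhood (skeleton c₀) (2 * R)) := by
      refine ENNReal.toReal_mono (measure_ne_top _ _) (measure_mono_ae ?_)
      filter_upwards [hμ] with x hx _
      refine Set.mem_biUnion hzs ?_
      rw [mem_closedBall_iff_norm]
      linarith [norm_sub_le x z]
    have h3 : minMass k R μ ≤ μ.real Set.univ :=
      (minMass_le hc₀ i).trans (measureReal_mono (Set.subset_univ _))
    have h4 : minSeparation k R μ * minMass k R μ / (128 * R ^ 2) * (2 * R) ≤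
        minMass k R μ / 32 := by
      rw [div_mul_eq_mul_div, div_le_iff₀ (by positivity)]
      have := mul_le_mul_of_nonneg_right hB2 (by positivity : 0 ≤ minMass k R μ * (2 * R))
      nlinarith
    linarith
  have h2 : (1 : ℝ) ≤ √2 := Real.one_le_sqrt.2 (by norm_num)
  have hr0 := hmar.1
  rw [initRadius, div_le_iff₀ (by positivity)]
  calc minSeparation k R μ * r₀ ≤ 2 * R * (2 * R) := by gcongr
    _ ≤ R * (16 * √2 * R) := by nlinarith [mul_pos hR hR]

/-- Up to a null set, the misclassified points lie within t = 2√2 R‖c − c₀‖/B of the skeleton, and t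
≤ r₀ by the choice of R₀; the factor B cancels in the margin condition. -/
theorem measure_misclassified_le (hR : 0 < R) (hμ : ∀ᵐ x ∂μ, ‖x‖ ≤ R) {c₀ : Codebook d k}
    (hc₀ : c₀ ∈ optimalCodebooks k R μ) (hB : 0 < minSeparation k R μ) (hp : 0 < minMass k R μ)
    (hmar : MarginCondition k R r₀ μ) {c : Codebook d k} (hc : ‖c - c₀‖ ≤ initRadius k R r₀ μ) :
    μ.real (misclassified c₀ c) ≤ √2 * minMass k R μ * ‖c - c₀‖ / (64 * R) := by
  have hr0 := hmar.1
  have hs : √2 * √2 = 2 := Real.mul_self_sqrt (by norm_num)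
  set t := 2 * √2 * R * ‖c - c₀‖ / minSeparation k R μ with ht
  have ht0 : 0 ≤ t := by positivity
  have htr : t ≤ r₀ := by
    rw [initRadius, le_div_iff₀ (by positivity)] at hc
    rw [ht, div_le_iff₀ hB]
    nlinarith [norm_nonneg (c - c₀), mul_pos hB hr0,
      (by positivity : 0 ≤ ‖c - c₀‖ * (√2 * R))]
  have h1 := measure_neighborhood_le hmar hc₀ ht0 htr hB.le hp.le
  have h2 : μ.real (misclassified c₀ c) ≤ μ.real (neighborhood (skeleton c₀) t) := by
    refine ENNReal.toReal_mono (measure_ne_top _ _) (measure_mono_ae ?_)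
    filter_upwards [hμ] with x hx hmis
    obtain ⟨i, j, hij, hi, hj⟩ := hmis
    have hsep := minSeparation_le hc₀ hij
    obtain ⟨z, hz, hxz⟩ := exists_skeleton_near_of_mem_cell_of_mem_cell hc₀.1 hij hx hi hj
      (hB.trans_le hsep)
    refine Set.mem_biUnion hz (mem_closedBall_iff_norm.2 (hxz.trans ?_))
    rw [ht]
    gcongr
  refine h2.trans (h1.trans (le_of_eq ?_))
  rw [ht]
  field_simp
  ring

theorem sum_measure_misclassified_inter (hk : 0 < k) (c₀ c c' : Codebook d k) :
    ∑ j, μ.real (cell c' j ∩ misclassified c₀ c) = μ.real (misclassified c₀ c) := by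
  have := sum_real_cell hk c' (μ.restrict (misclassified c₀ c))
  simpa only [measureReal_restrict_apply (measurableSet_cell c' _),
    measureReal_restrict_apply MeasurableSet.univ, Set.univ_inter] using this

/-- Replacing W_j(c) by W_j(c₀) in ∫ (c₀ j − x) makes this integral vanish by the centroid
condition. The error is carried by the symmetric difference of the two cells, which consists of
misclassified points. -/
theorem gradient_near_optimal (hk : 2 ≤ k) (hR : 0 < R) (hμ : ∀ᵐ x ∂μ, ‖x‖ ≤ R)
    {c₀ : Codebook d k} (hc₀ : c₀ ∈ optimalCodebooks k R μ) (hB : 0 < minSeparation k R μ)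
    (hp : 0 < minMass k R μ) (hmar : MarginCondition k R r₀ μ) {c : Codebook d k}
    (hc : ‖c - c₀‖ ≤ initRadius k R r₀ μ) :
    (∀ j, 0.9 * minMass k R μ ≤ μ.real (cell c j)) ∧ ∃ e : Fin k → Pt d,
      (∀ j, ∫ x in cell c j, (c j - x) ∂μ = μ.real (cell c j) • (c j - c₀ j + e j)) ∧
      ∑ j, ‖e j‖ ≤ ‖c - c₀‖ / 10 := by
  have hk0 : 0 < k := by omega
  have hmis := measure_misclassified_le hR hμ hc₀ hB hp hmar hc
  have hs2 : √2 ≤ 1.415 := by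
    rw [Real.sqrt_le_left (by norm_num)]
    norm_num
  set δ := ‖c - c₀‖ with hδ
  have hδ0 : 0 ≤ δ := norm_nonneg _
  have hδR : δ ≤ R := hc.trans (initRadius_le hk hR hμ hc₀ hB hp hmar)
  set p := minMass k R μ
  set Mis := misclassified c₀ c
  have hmisp : μ.real Mis ≤ p / 10 := by
    refine hmis.trans ?_
    rw [div_le_div_iff₀ (by positivity) (by norm_num)]
    have : √2 * δ ≤ 1.415 * R := by gcongr
    nlinarith
  have hA : ∀ j, cell c j \ cell c₀ j ⊆ cell c j ∩ Mis := by
    rintro j x ⟨h1, h2⟩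
    obtain ⟨i, hi⟩ := exists_mem_cell hk0 c₀ x
    exact ⟨h1, i, j, fun h => h2 (h ▸ hi), hi, h1⟩
  have hA' : ∀ j, cell c₀ j \ cell c j ⊆ cell c₀ j ∩ Mis := by
    rintro j x ⟨h1, h2⟩
    obtain ⟨i, hi⟩ := exists_mem_cell hk0 c x
    exact ⟨h1, j, i, fun h => h2 (h ▸ hi), h1, hi⟩
  have hmass : ∀ j, 0.9 * p ≤ μ.real (cell c j) := by
    intro j
    have h1 : μ.real (cell c₀ j) ≤ μ.real (cell c j) + μ.real Mis := by
      refine (measureReal_mono (s₂ := cell c j ∪ Mis) fun x hx => ?_).trans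
        (measureReal_union_le _ _)
      by_cases h : x ∈ cell c j
      · exact Or.inl h
      · exact Or.inr (hA' j ⟨hx, h⟩).2
    linarith [minMass_le hc₀ j]
  have hpos : ∀ j, 0 < μ.real (cell c j) := fun j => lt_of_lt_of_le (by positivity) (hmass j)
  refine ⟨hmass, fun j => (μ.real (cell c j))⁻¹ •
    (∫ x in cell c j \ cell c₀ j, (c₀ j - x) ∂μ - ∫ x in cell c₀ j \ cell c j, (c₀ j - x) ∂μ),
    fun j => ?_, ?_⟩
  · have hint : ∀ (a : Pt d) (s : Set (Pt d)), IntegrableOn (fun x => a - x) s μ := fun a s =>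
      (integrable_of_continuous hμ (by fun_prop)).integrableOn
    have h1 := centroid_condition hk0 hμ hc₀ j
    have e1 : ∫ x in cell c j, (c j - x) ∂μ =
        μ.real (cell c j) • (c j - c₀ j) + ∫ x in cell c j, (c₀ j - x) ∂μ := by
      rw [← setIntegral_const, ← integral_add (integrable_const _) (hint _ _)]
      exact integral_congr_ae (Filter.Eventually.of_forall fun x => by simp)
    have e2 := integral_inter_add_sdiff (measurableSet_cell c₀ j) (hint (c₀ j) (cell c j))
    have e3 := integral_inter_add_sdiff (measurableSet_cell c j) (hint (c₀ j) (cell c₀ j))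
    rw [h1, Set.inter_comm] at e3
    rw [smul_add, smul_smul, mul_inv_cancel₀ (hpos j).ne', one_smul, e1, ← e2,
      eq_neg_of_add_eq_zero_left e3]
    congr 1
    abel
  · have hnorm : ∀ j (s : Set (Pt d)), ‖∫ x in s, (c₀ j - x) ∂μ‖ ≤ 2 * R * μ.real s := by
      intro j s
      refine (norm_setIntegral_le_of_norm_le_const_ae (C := 2 * R) (measure_lt_top _ _) ?_)
      filter_upwards [ae_restrict_of_ae hμ] with x hx
      linarith [norm_sub_le (c₀ j) x, mem_closedBall_zero_iff.1 (hc₀.1 j)]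
    have hle : ∀ j, ‖(μ.real (cell c j))⁻¹ • (∫ x in cell c j \ cell c₀ j, (c₀ j - x) ∂μ
        - ∫ x in cell c₀ j \ cell c j, (c₀ j - x) ∂μ)‖ ≤
        (0.9 * p)⁻¹ * (2 * R * (μ.real (cell c j ∩ Mis) + μ.real (cell c₀ j ∩ Mis))) := by
      intro j
      rw [norm_smul, norm_inv, Real.norm_of_nonneg (hpos j).le]
      have h1 : μ.real (cell c j \ cell c₀ j) ≤ μ.real (cell c j ∩ Mis) := measureReal_mono (hA j)
      have h2 : μ.real (cell c₀ j \ cell c j) ≤ μ.real (cell c₀ j ∩ Mis) :=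
        measureReal_mono (hA' j)
      have h3 := (norm_sub_le (∫ x in cell c j \ cell c₀ j, (c₀ j - x) ∂μ)
        (∫ x in cell c₀ j \ cell c j, (c₀ j - x) ∂μ)).trans
        (add_le_add (hnorm j _) (hnorm j _))
      refine mul_le_mul (inv_anti₀ (by positivity) (hmass j)) (h3.trans ?_) (norm_nonneg _)
        (by positivity)
      rw [← mul_add]
      gcongr
    refine (Finset.sum_le_sum fun j _ => hle j).trans ?_
    -- Each family of cells partitions the misclassified set, so its mass enters twice in all and
    -- not k times. The total is 4R/(0.9p)·√2pδ/(64R) < δ/10.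
    rw [← Finset.mul_sum, ← Finset.mul_sum, Finset.sum_add_distrib,
      sum_measure_misclassified_inter hk0, sum_measure_misclassified_inter hk0]
    have h4 : R * μ.real Mis ≤ √2 * p * δ / 64 := by
      calc R * μ.real Mis ≤ R * (√2 * p * δ / (64 * R)) := by gcongr
        _ = _ := by field_simp
    rw [inv_mul_le_iff₀ (by positivity)]
    have h5 : √2 * (p * δ) ≤ 1.415 * (p * δ) := by gcongr
    have h6 : 0 ≤ p * δ := by positivity
    change 2 * R * (μ.real Mis + μ.real Mis) ≤ _
    nlinarith

end

section

/-! ### A dimension-free Hoeffding inequality in Hilbert spaces -/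

theorem pow_add_pow_le_of_majorized {s t a b : ℝ} (hb : 0 ≤ b) (hbs : b ≤ s) (hsa : s ≤ a)
    (h : s + t = a + b) (n : ℕ) : s ^ n + t ^ n ≤ a ^ n + b ^ n := by
  rcases (hbs.trans hsa).eq_or_lt with hab | hab
  · obtain rfl : s = a := le_antisymm hsa (hab ▸ hbs)
    obtain rfl : t = b := by linarith
    exact le_rfl
  have hpos : 0 < a - b := sub_pos.2 hab
  set θ := (s - b) / (a - b) with hθ
  have hθ0 : 0 ≤ θ := div_nonneg (by linarith) hpos.le
  have hθ1 : 0 ≤ 1 - θ := by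
    rw [hθ, sub_nonneg, div_le_one hpos]
    linarith
  have hs : s = θ * a + (1 - θ) * b := by
    rw [hθ]
    field_simp
    ring
  have ht : t = (1 - θ) * a + θ * b := by linarith
  have hc := convexOn_pow (𝕜 := ℝ) n
  have h1 := hc.2 (x := a) (y := b) (by simp; linarith) (by simpa using hb) hθ0 hθ1 (by ring)
  have h2 := hc.2 (x := a) (y := b) (by simp; linarith) (by simpa using hb) hθ1 hθ0 (by ring)
  simp only [smul_eq_mul] at h1 h2
  rw [hs, ht]
  linarith

variable {E : Type*} [NormedAddCommGroup E] [InnerProductSpace ℝ E]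

/-- By the parallelogram law ‖x + w‖² and ‖x − w‖² have the same sum as (‖x‖ + ‖w‖)² and (‖x‖ −
‖w‖)², and lie between these two. As cosh is a power series in the square with nonnegative
coefficients, convexity of the powers compares the series termwise. -/
theorem cosh_norm_add_cosh_norm_sub_le (x w : E) :
    Real.cosh ‖x + w‖ + Real.cosh ‖x - w‖ ≤ 2 * (Real.cosh ‖x‖ * Real.cosh ‖w‖) := by
  have hprod : 2 * (Real.cosh ‖x‖ * Real.cosh ‖w‖) =
      Real.cosh (‖x‖ + ‖w‖) + Real.cosh (‖x‖ - ‖w‖) := by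
    rw [Real.cosh_add, Real.cosh_sub]
    ring
  rw [hprod]
  refine hasSum_le (fun n => ?_) ((Real.hasSum_cosh ‖x + w‖).add (Real.hasSum_cosh ‖x - w‖))
    ((Real.hasSum_cosh (‖x‖ + ‖w‖)).add (Real.hasSum_cosh (‖x‖ - ‖w‖)))
  rw [← add_div, ← add_div]
  gcongr ?_ / _
  simp only [pow_mul]
  refine pow_add_pow_le_of_majorized (sq_nonneg _) ?_ ?_ ?_ n
  · rw [sq_le_sq, abs_of_nonneg (norm_nonneg (x + w))]
    simpa using abs_norm_sub_norm_le x (-w)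
  · have := norm_add_le x w
    gcongr
  · rw [norm_add_sq_real, norm_sub_sq_real]
    ring

theorem convexOn_cosh : ConvexOn ℝ Set.univ Real.cosh := by
  have h : ConvexOn ℝ Set.univ fun x : ℝ => Real.exp (-x) := by
    refine ⟨convex_univ, fun x _ y _ a b ha hb hab => ?_⟩
    have := convexOn_exp.2 (Set.mem_univ (-x)) (Set.mem_univ (-y)) ha hb hab
    simp only [smul_eq_mul] at this ⊢
    rwa [show -(a * x + b * y) = a * -x + b * -y by ring]
  have h2 := (convexOn_exp.add h).smul (by norm_num : (0 : ℝ) ≤ 1 / 2)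
  refine h2.congr fun x _ => ?_
  simp only [Pi.add_apply, smul_eq_mul, Real.cosh_eq]
  ring

theorem convexOn_cosh_norm_sub (y : E) : ConvexOn ℝ Set.univ fun z => Real.cosh ‖y - z‖ := by
  refine ⟨convex_univ, fun z _ z' _ a b ha hb hab => ?_⟩
  have h1 : ‖y - (a • z + b • z')‖ ≤ a * ‖y - z‖ + b * ‖y - z'‖ := by
    have : y - (a • z + b • z') = a • (y - z) + b • (y - z') := by
      rw [smul_sub, smul_sub, sub_add_sub_comm, ← add_smul, hab, one_smul]
    rw [this]
    refine (norm_add_le _ _).trans (le_of_eq ?_)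
    rw [norm_smul, norm_smul, Real.norm_of_nonneg ha, Real.norm_of_nonneg hb]
  refine le_trans (Real.cosh_le_cosh.2 ?_)
    (convexOn_cosh.2 (Set.mem_univ ‖y - z‖) (Set.mem_univ ‖y - z'‖) ha hb hab)
  rw [abs_of_nonneg (norm_nonneg _), abs_of_nonneg]
  · exact h1
  · simp only [smul_eq_mul]
    positivity

variable [MeasurableSpace E] [BorelSpace E] [SecondCountableTopology E] [CompleteSpace E]

/-- Symmetrization: Jensen's inequality replaces the mean by an independent copy, and exchanging the
two copies allows averaging over the sign of w = z − z'. The previous inequality then splits off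
cosh ‖w‖ ≤ exp(‖w‖²/2) with ‖w‖ ≤ 2b. The dimension never enters. -/
theorem integral_cosh_norm_add_sub_le {ν : Measure E} [IsProbabilityMeasure ν] {b : ℝ}
    (hb : ∀ᵐ z ∂ν, ‖z‖ ≤ b) (x : E) :
    Integrable (fun z => Real.cosh ‖x + (z - ∫ y, y ∂ν)‖) ν ∧
    ∫ z, Real.cosh ‖x + (z - ∫ y, y ∂ν)‖ ∂ν ≤ Real.exp (2 * b ^ 2) * Real.cosh ‖x‖ := by
  set m := ∫ y, y ∂ν with hm
  have hb0 : 0 ≤ b := by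
    obtain ⟨z, hz⟩ := hb.exists
    exact (norm_nonneg z).trans hz
  have hmb : ‖m‖ ≤ b := by
    have := norm_integral_le_of_norm_le_const hb
    simpa using this
  have hcosh : ∀ {a c : ℝ}, 0 ≤ a → a ≤ c → Real.cosh a ≤ Real.cosh c := fun ha hac => by
    rw [Real.cosh_le_cosh, abs_of_nonneg ha, abs_of_nonneg (ha.trans hac)]
    exact hac
  have hi0 : Integrable (fun z => Real.cosh ‖x + (z - m)‖) ν := by
    refine Integrable.of_bound (by fun_prop) (Real.cosh (‖x‖ + (b + b))) ?_
    filter_upwards [hb] with z hz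
    rw [Real.norm_of_nonneg (Real.cosh_pos _).le]
    exact hcosh (norm_nonneg _) ((norm_add_le _ _).trans (by
      gcongr
      exact (norm_sub_le _ _).trans (add_le_add hz hmb)))
  refine ⟨hi0, ?_⟩
  have hb2 : ∀ᵐ q : E × E ∂ν.prod ν, ‖q.1‖ ≤ b ∧ ‖q.2‖ ≤ b :=
    (Measure.quasiMeasurePreserving_fst.ae hb).and (Measure.quasiMeasurePreserving_snd.ae hb)
  have hi2 : Integrable (fun q : E × E => Real.cosh ‖x + (q.1 - q.2)‖) (ν.prod ν) := by
    refine Integrable.of_bound (by fun_prop) (Real.cosh (‖x‖ + (b + b))) ?_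
    filter_upwards [hb2] with q hq
    rw [Real.norm_of_nonneg (Real.cosh_pos _).le]
    exact hcosh (norm_nonneg _) ((norm_add_le _ _).trans (by
      gcongr
      exact (norm_sub_le _ _).trans (add_le_add hq.1 hq.2)))
  have hi3 : Integrable (fun q : E × E => Real.cosh ‖x + (q.2 - q.1)‖) (ν.prod ν) := hi2.swap
  have h1 : ∫ z, Real.cosh ‖x + (z - m)‖ ∂ν ≤
      ∫ q : E × E, Real.cosh ‖x + (q.1 - q.2)‖ ∂ν.prod ν := by
    rw [integral_prod _ hi2]
    refine integral_mono_ae hi0 hi2.integral_prod_left ?_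
    filter_upwards [hi2.prod_right_ae] with z hz
    have hj := (convexOn_cosh_norm_sub (x + z)).map_integral_le (μ := ν) (f := fun y => y)
      (by fun_prop) isClosed_univ (by simp)
      (Integrable.of_bound (by fun_prop) b hb) (by simpa [Function.comp_def, add_sub_assoc] using hz)
    simpa [add_sub_assoc] using hj
  have h2 : ∫ q : E × E, Real.cosh ‖x + (q.1 - q.2)‖ ∂ν.prod ν =
      ∫ q : E × E, Real.cosh ‖x + (q.2 - q.1)‖ ∂ν.prod ν :=
    integral_prod_swap (μ := ν) (ν := ν) fun q : E × E => Real.cosh ‖x + (q.2 - q.1)‖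
  have h3 : ∫ q : E × E, (Real.cosh ‖x + (q.1 - q.2)‖ + Real.cosh ‖x + (q.2 - q.1)‖) ∂ν.prod ν ≤
      2 * (Real.exp (2 * b ^ 2) * Real.cosh ‖x‖) := by
    have : ∫ _q : E × E, 2 * (Real.exp (2 * b ^ 2) * Real.cosh ‖x‖) ∂ν.prod ν =
        2 * (Real.exp (2 * b ^ 2) * Real.cosh ‖x‖) := by simp
    rw [← this]
    refine integral_mono_ae (hi2.add hi3) (integrable_const _) ?_
    filter_upwards [hb2] with q hq
    have e : x + (q.2 - q.1) = x - (q.1 - q.2) := by abel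
    rw [e]
    refine (cosh_norm_add_cosh_norm_sub_le x (q.1 - q.2)).trans ?_
    have hw : Real.cosh ‖q.1 - q.2‖ ≤ Real.exp (2 * b ^ 2) := by
      refine (hcosh (norm_nonneg _) ((norm_sub_le _ _).trans (add_le_add hq.1 hq.2))).trans
        ((Real.cosh_le_exp_half_sq _).trans (le_of_eq ?_))
      congr 1
      ring
    have := (Real.cosh_pos ‖x‖).le
    rw [mul_comm (Real.exp _)]
    gcongr
  rw [integral_add hi2 hi3, ← h2] at h3
  linarith

variable {Ω : Type*} [MeasurableSpace Ω] {P : Measure Ω} [IsProbabilityMeasure P]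
  {ι : Type*}

/-- The summands are integrated out one at a time, conditionally on the sum of the others. Working
with lower integrals spares integrability of the partial sums. -/
theorem lintegral_cosh_norm_sum_le {Z : ι → Ω → E} (hZ : ∀ i, Measurable (Z i))
    (hind : iIndepFun Z P) {b : ℝ} (hb : ∀ i, ∀ᵐ ω ∂P, ‖Z i ω‖ ≤ b) {m : E}
    (hm : ∀ i, ∫ ω, Z i ω ∂P = m) (s : Finset ι) :
    ∫⁻ ω, ENNReal.ofReal (Real.cosh ‖∑ i ∈ s, (Z i ω - m)‖) ∂P ≤
      ENNReal.ofReal (Real.exp (2 * b ^ 2) ^ s.card) := by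
  classical
  induction s using Finset.induction_on with
  | empty => simp
  | insert a s ha ih =>
    have hindep : IndepFun (fun ω => ∑ i ∈ s, (Z i ω - m)) (Z a) P := by
      have h := hind.indepFun_finsetSum_of_notMem hZ ha
      have h' := h.comp (φ := fun y : E => y - s.card • m) (ψ := id) (by fun_prop) measurable_id
      rw [Function.id_comp] at h'
      convert h' using 1
      ext ω
      simp [Finset.sum_sub_distrib]
    have hS : Measurable fun ω => ∑ i ∈ s, (Z i ω - m) := by fun_prop
    have hmap := hindep.map_prod_eq_prod_map_map hS.aemeasurable (hZ a).aemeasurable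
    have hmeas : Measurable fun q : E × E => ENNReal.ofReal (Real.cosh ‖q.1 + (q.2 - m)‖) := by
      fun_prop
    have hprob : IsProbabilityMeasure (P.map (Z a)) :=
      Measure.isProbabilityMeasure_map (hZ a).aemeasurable
    have hmean : ∫ y, y ∂(P.map (Z a)) = m := by
      rw [integral_map (hZ a).aemeasurable (by fun_prop), hm]
    have hbd : ∀ᵐ z ∂(P.map (Z a)), ‖z‖ ≤ b :=
      (ae_map_iff (hZ a).aemeasurable (measurableSet_le measurable_norm measurable_const)).2 (hb a)
    calc ∫⁻ ω, ENNReal.ofReal (Real.cosh ‖∑ i ∈ insert a s, (Z i ω - m)‖) ∂P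
        = ∫⁻ ω, ENNReal.ofReal (Real.cosh ‖∑ i ∈ s, (Z i ω - m) + (Z a ω - m)‖) ∂P := by
          simp_rw [Finset.sum_insert ha, add_comm (Z a _ - m)]
      _ = ∫⁻ q, ENNReal.ofReal (Real.cosh ‖q.1 + (q.2 - m)‖)
            ∂((P.map fun ω => ∑ i ∈ s, (Z i ω - m)).prod (P.map (Z a))) := by
          rw [← hmap, lintegral_map hmeas (hS.prodMk (hZ a))]
      _ = ∫⁻ x, ∫⁻ z, ENNReal.ofReal (Real.cosh ‖x + (z - m)‖) ∂(P.map (Z a))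
            ∂(P.map fun ω => ∑ i ∈ s, (Z i ω - m)) := lintegral_prod _ hmeas.aemeasurable
      _ ≤ ∫⁻ x, ENNReal.ofReal (Real.exp (2 * b ^ 2)) * ENNReal.ofReal (Real.cosh ‖x‖)
            ∂(P.map fun ω => ∑ i ∈ s, (Z i ω - m)) := by
          refine lintegral_mono fun x => ?_
          have h := integral_cosh_norm_add_sub_le hbd x
          rw [hmean] at h
          rw [← ofReal_integral_eq_lintegral_ofReal h.1
            (Filter.Eventually.of_forall fun _ => (Real.cosh_pos _).le),
            ← ENNReal.ofReal_mul (Real.exp_pos _).le]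
          exact ENNReal.ofReal_le_ofReal h.2
      _ = ENNReal.ofReal (Real.exp (2 * b ^ 2)) *
            ∫⁻ ω, ENNReal.ofReal (Real.cosh ‖∑ i ∈ s, (Z i ω - m)‖) ∂P := by
          rw [lintegral_const_mul _ (by fun_prop), lintegral_map (by fun_prop) hS]
      _ ≤ ENNReal.ofReal (Real.exp (2 * b ^ 2)) *
            ENNReal.ofReal (Real.exp (2 * b ^ 2) ^ s.card) := by gcongr
      _ = _ := by
          rw [← ENNReal.ofReal_mul (Real.exp_pos _).le, Finset.card_insert_of_notMem ha, pow_succ' (Real.exp _)]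

theorem measure_norm_average_sub_ge_le {Z : ι → Ω → E} (hZ : ∀ i, Measurable (Z i))
    (hind : iIndepFun Z P) {b : ℝ} (hb0 : 0 < b) (hb : ∀ i, ∀ᵐ ω ∂P, ‖Z i ω‖ ≤ b) {m : E}
    (hm : ∀ i, ∫ ω, Z i ω ∂P = m) {s : Finset ι} (hs : 0 < s.card) {r : ℝ} (hr : 0 < r) :
    P.real {ω | r ≤ ‖(s.card : ℝ)⁻¹ • ∑ i ∈ s, Z i ω - m‖} ≤
      2 * Real.exp (-(s.card * r ^ 2 / (8 * b ^ 2))) := by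
  set N : ℝ := (s.card : ℝ) with hN
  have hN0 : 0 < N := by positivity
  -- The minimizer of the Chernoff exponent 2l²b²N − lNr, whose minimum is −Nr²/(8b²). The factor 2
  -- in the bound comes from cosh y ≥ exp(y)/2.
  set l : ℝ := r / (4 * b ^ 2) with hl
  have hl0 : 0 < l := by positivity
  have hind' : iIndepFun (fun i ω => l • Z i ω) P :=
    hind.comp (fun _ y => l • y) fun _ => measurable_const_smul l
  have h := lintegral_cosh_norm_sum_le (Z := fun i ω => l • Z i ω) (b := l * b) (m := l • m)
    (fun i => (hZ i).const_smul l) hind'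
    (fun i => by
      filter_upwards [hb i] with ω hω
      rw [norm_smul, Real.norm_of_nonneg hl0.le]
      gcongr)
    (fun i => by rw [integral_smul, hm]) s
  have hmark := mul_meas_ge_le_lintegral (μ := P)
    (f := fun ω => ENNReal.ofReal (Real.cosh ‖∑ i ∈ s, (l • Z i ω - l • m)‖))
    (by fun_prop) (ENNReal.ofReal (Real.exp (l * (N * r)) / 2))
  set A := {ω | r ≤ ‖N⁻¹ • ∑ i ∈ s, Z i ω - m‖} with hA
  have hsub : A ⊆ {ω | ENNReal.ofReal (Real.exp (l * (N * r)) / 2) ≤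
      ENNReal.ofReal (Real.cosh ‖∑ i ∈ s, (l • Z i ω - l • m)‖)} := by
    intro ω hω
    have hω' : r ≤ ‖N⁻¹ • ∑ i ∈ s, Z i ω - m‖ := hω
    have e : ∑ i ∈ s, (l • Z i ω - l • m) = (l * N) • (N⁻¹ • ∑ i ∈ s, Z i ω - m) := by
      rw [smul_sub, smul_smul, mul_assoc, mul_inv_cancel₀ hN0.ne', mul_one, Finset.sum_sub_distrib,
        Finset.sum_const, ← Finset.smul_sum, mul_smul, ← Nat.cast_smul_eq_nsmul ℝ, ← hN,
        smul_comm N l]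
    refine ENNReal.ofReal_le_ofReal ?_
    rw [e, norm_smul, Real.norm_of_nonneg (by positivity), Real.cosh_eq]
    have : Real.exp (l * (N * r)) ≤ Real.exp (l * N * ‖N⁻¹ • ∑ i ∈ s, Z i ω - m‖) := by
      rw [Real.exp_le_exp, mul_assoc]
      gcongr
    have := Real.exp_pos (-(l * N * ‖N⁻¹ • ∑ i ∈ s, Z i ω - m‖))
    linarith
  have h2 : ENNReal.ofReal (Real.exp (l * (N * r)) / 2) * P A ≤
      ENNReal.ofReal (Real.exp (2 * (l * b) ^ 2) ^ s.card) :=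
    le_trans (mul_le_mul_right (measure_mono hsub) _) (hmark.trans h)
  have h3 : Real.exp (l * (N * r)) / 2 * P.real A ≤ Real.exp (2 * (l * b) ^ 2) ^ s.card := by
    have := ENNReal.toReal_mono ENNReal.ofReal_ne_top h2
    rwa [ENNReal.toReal_mul, ENNReal.toReal_ofReal (by positivity),
      ENNReal.toReal_ofReal (by positivity)] at this
  rw [← Real.exp_nat_mul, ← hN] at h3
  have h4 : Real.exp (-(N * r ^ 2 / (8 * b ^ 2))) =
      Real.exp (N * (2 * (l * b) ^ 2)) / Real.exp (l * (N * r)) := by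
    rw [← Real.exp_sub]
    congr 1
    rw [hl]
    field_simp
    ring
  rw [h4, ← mul_div_assoc, le_div_iff₀ (Real.exp_pos _)]
  linarith

end

section

/-! ### A localized stochastic recursion -/

variable {Ω S E : Type*} [MeasurableSpace Ω] [MeasurableSpace S] {P : Measure Ω}
  [IsProbabilityMeasure P]

/-- Conditioning on c, expressed by Fubini for the product law of (c, ξ): a bound for each fixed x
integrates to a bound for the random c. -/
theorem integral_comp_le_of_indepFun [MeasurableSpace E] {c : Ω → E} {ξ : Ω → S}
    (hc : Measurable c) (hξ : Measurable ξ) (hind : IndepFun c ξ P) {φ : E × S → ℝ}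
    (hφ : Measurable φ) {C : ℝ} (hb : ∀ q, ‖φ q‖ ≤ C) {ψ : E → ℝ} (hψ : Measurable ψ)
    (hψi : Integrable (fun ω => ψ (c ω)) P) (h : ∀ x, ∫ ω, φ (x, ξ ω) ∂P ≤ ψ x) :
    ∫ ω, φ (c ω, ξ ω) ∂P ≤ ∫ ω, ψ (c ω) ∂P := by
  have h1 : IsProbabilityMeasure (P.map c) := Measure.isProbabilityMeasure_map hc.aemeasurable
  have h2 : IsProbabilityMeasure (P.map ξ) := Measure.isProbabilityMeasure_map hξ.aemeasurable
  have hi : Integrable φ ((P.map c).prod (P.map ξ)) :=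
    Integrable.of_bound hφ.aestronglyMeasurable C (Filter.Eventually.of_forall hb)
  calc ∫ ω, φ (c ω, ξ ω) ∂P = ∫ q, φ q ∂(P.map fun ω => (c ω, ξ ω)) :=
        (integral_map (hc.prodMk hξ).aemeasurable hφ.aestronglyMeasurable).symm
    _ = ∫ x, ∫ s, φ (x, s) ∂(P.map ξ) ∂(P.map c) := by
        rw [hind.map_prod_eq_prod_map_map hc.aemeasurable hξ.aemeasurable, integral_prod _ hi]
    _ ≤ ∫ x, ψ x ∂(P.map c) := by
        refine integral_mono hi.integral_prod_left
          ((integrable_map_measure hψ.aestronglyMeasurable hc.aemeasurable).2 hψi) fun x => ?_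
        change ∫ s, φ (x, s) ∂(P.map ξ) ≤ ψ x
        have hφx : Measurable fun s => φ (x, s) := hφ.comp measurable_prodMk_left
        rw [integral_map hξ.aemeasurable hφx.aestronglyMeasurable]
        exact h x
    _ = ∫ ω, ψ (c ω) ∂P := integral_map hc.aemeasurable hψ.aestronglyMeasurable

/-- At t = 0 the coefficient 1 − 1.5 is negative and is replaced by 0, so a 0 is forgotten.
Afterwards the bound 2V/t propagates with the margin V/(t(t+1)²), positive because 1.5 > 1. -/
theorem le_two_mul_div_of_recursion {a : ℕ → ℝ} {V : ℝ} (hV : 0 ≤ V) {T : ℕ}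
    (h : ∀ t < T, a (t + 1) ≤ max 0 (1 - 1.5 / ((t : ℝ) + 1)) * a t + V / ((t : ℝ) + 1) ^ 2) {t : ℕ}
    (ht : 1 ≤ t) (htT : t ≤ T) : a t ≤ 2 * V / t := by
  induction t, ht using Nat.le_induction with
  | base =>
    have := h 0 (by omega)
    norm_num at this ⊢
    linarith
  | succ t ht ih =>
    have h1 := h t (by omega)
    have h2 := ih (by omega)
    have ht' : (1 : ℝ) ≤ t := by exact_mod_cast ht
    have ht0 : (0 : ℝ) < t := by linarith
    have h3 : 0 ≤ 1 - 1.5 / ((t : ℝ) + 1) := by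
      rw [sub_nonneg, div_le_one (by positivity)]
      linarith
    rw [max_eq_right h3] at h1
    refine h1.trans ((add_le_add_left (mul_le_mul_of_nonneg_left h2 h3) _).trans ?_)
    push_cast
    have e : 2 * V / ((t : ℝ) + 1) - ((1 - 1.5 / ((t : ℝ) + 1)) * (2 * V / t) +
        V / ((t : ℝ) + 1) ^ 2) = V / (t * ((t : ℝ) + 1) ^ 2) := by
      field_simp
      ring
    have : 0 ≤ V / (t * ((t : ℝ) + 1) ^ 2) := by positivity
    linarith

variable [NormedAddCommGroup E] [MeasurableSpace E] [BorelSpace E]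

/-- Contraction is only known inside the ball of radius r, and a step from inside leaves it with
probability at most η. The iterate t is therefore outside with probability at most tη, where its
squared distance is charged K. This cost is absorbed in the noise, since tηK ≤ KηT³/(t+1)². The
minimum with K in `hstep` loses nothing, because K bounds the iterates almost surely. -/
theorem integral_sq_norm_sub_le_of_local_contraction {c : ℕ → Ω → E} {ξ : ℕ → Ω → S}
    {G : ℕ → E × S → E} (hG : ∀ t, Measurable (G t)) (hc : ∀ t, Measurable (c t))
    (hξ : ∀ t, Measurable (ξ t)) {T : ℕ} (hT : 1 ≤ T) {x₀ : E} {r K V η : ℝ} (hV : 0 ≤ V)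
    (hη : 0 ≤ η) (hrec : ∀ t < T, ∀ ω, c (t + 1) ω = G t (c t ω, ξ t ω))
    (hind : ∀ t < T, IndepFun (c t) (ξ t) P)
    (hK : ∀ t ≤ T, ∀ᵐ ω ∂P, ‖c t ω - x₀‖ ^ 2 ≤ K)
    (h0 : ∀ᵐ ω ∂P, ‖c 0 ω - x₀‖ ≤ r)
    (hstep : ∀ t < T, ∀ x, ‖x - x₀‖ ≤ r → ∫ ω, min (‖G t (x, ξ t ω) - x₀‖ ^ 2) K ∂P ≤
      (1 - 1.5 / ((t : ℝ) + 1)) * ‖x - x₀‖ ^ 2 + V / ((t : ℝ) + 1) ^ 2)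
    (hesc : ∀ t < T, ∀ x, ‖x - x₀‖ ≤ r → P.real {ω | r < ‖G t (x, ξ t ω) - x₀‖} ≤ η) :
    ∫ ω, ‖c T ω - x₀‖ ^ 2 ∂P ≤ 2 * (V + K * η * (T : ℝ) ^ 3) / T := by
  have hK0 : 0 ≤ K := by
    obtain ⟨ω, hω⟩ := (hK 0 (Nat.zero_le _)).exists
    exact (sq_nonneg _).trans hω
  have hball : MeasurableSet {x : E | ‖x - x₀‖ ≤ r} :=
    measurableSet_le (by fun_prop) measurable_const
  have hout : ∀ t, MeasurableSet {ω | r < ‖c t ω - x₀‖} := fun t =>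
    measurableSet_lt measurable_const ((hc t).sub_const x₀).norm
  -- Union bound over the first step that leaves the ball, each step being conditioned on the
  -- current iterate.
  have hescape : ∀ t ≤ T, P.real {ω | r < ‖c t ω - x₀‖} ≤ t * η := by
    intro t
    induction t with
    | zero =>
      intro _
      have : P {ω | r < ‖c 0 ω - x₀‖} = 0 := by
        refine measure_mono_null (fun ω hω => ?_) h0
        have hω' : r < ‖c 0 ω - x₀‖ := hω
        exact not_le.2 hω'
      simp [Measure.real, this]
    | succ t ih =>
      intro ht
      have h1 := ih (by omega)
      set A : Set (E × S) := {q | ‖q.1 - x₀‖ ≤ r ∧ r < ‖G t q - x₀‖} with hA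
      have hAm : MeasurableSet A :=
        (hball.preimage measurable_fst).inter
          (measurableSet_lt measurable_const ((hG t).sub_const x₀).norm)
      have h2 : P.real {ω | (c t ω, ξ t ω) ∈ A} ≤ η := by
        have h3 := integral_comp_le_of_indepFun (hc t) (hξ t) (hind t (by omega))
          (φ := A.indicator fun _ => 1) (measurable_const.indicator hAm) (C := 1)
          (fun q => by
            by_cases hq : q ∈ A <;> simp [hq]) (ψ := fun _ => η) measurable_const
          (integrable_const _) (fun x => ?_)
        · have e : (fun ω => A.indicator (fun _ => (1 : ℝ)) (c t ω, ξ t ω)) =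
              {ω | (c t ω, ξ t ω) ∈ A}.indicator fun _ => 1 := rfl
          have hm : MeasurableSet {ω | (c t ω, ξ t ω) ∈ A} := ((hc t).prodMk (hξ t)) hAm
          rw [e, integral_indicator_const _ hm] at h3
          simpa using h3
        · by_cases hx : ‖x - x₀‖ ≤ r
          · have e : (fun ω => A.indicator (fun _ => (1 : ℝ)) (x, ξ t ω)) =
                {ω | r < ‖G t (x, ξ t ω) - x₀‖}.indicator fun _ => 1 := by
              ext ω
              by_cases h : r < ‖G t (x, ξ t ω) - x₀‖ <;> simp [hA, hx, h]
            rw [e, integral_indicator_const]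
            · simpa using hesc t (by omega) x hx
            · exact measurableSet_lt measurable_const
                (((hG t).comp (measurable_prodMk_left.comp (hξ t))).sub_const x₀).norm
          · simpa [hA, hx] using hη
      calc P.real {ω | r < ‖c (t + 1) ω - x₀‖}
          ≤ P.real ({ω | r < ‖c t ω - x₀‖} ∪ {ω | (c t ω, ξ t ω) ∈ A}) := by
            refine measureReal_mono fun ω hω => ?_
            by_cases h : ‖c t ω - x₀‖ ≤ r
            · refine Or.inr ⟨h, ?_⟩
              rw [← hrec t (by omega)]
              exact hω
            · exact Or.inl (not_le.1 h)
        _ ≤ t * η + η := (measureReal_union_le _ _).trans (add_le_add h1 h2)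
        _ = (t + 1 : ℕ) * η := by push_cast; ring
  have hint : ∀ t ≤ T, Integrable (fun ω => ‖c t ω - x₀‖ ^ 2) P := fun t ht =>
    Integrable.of_bound (((hc t).sub_const x₀).norm.pow_const 2).aestronglyMeasurable K
      ((hK t ht).mono fun ω hω => by rwa [Real.norm_of_nonneg (sq_nonneg _)])
  have hT0 : (0 : ℝ) < T := by exact_mod_cast hT
  refine le_two_mul_div_of_recursion (a := fun t => ∫ ω, ‖c t ω - x₀‖ ^ 2 ∂P) (by positivity)
    (T := T) (fun t ht => ?_) hT le_rfl
  set s : ℝ := (t : ℝ) + 1 with hs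
  have hs0 : 0 < s := by positivity
  set g : E × S → ℝ := fun q => min (‖G t q - x₀‖ ^ 2) K with hg
  have hgm : Measurable g := (((hG t).sub_const x₀).norm.pow_const 2).min measurable_const
  have hg0 : ∀ q, 0 ≤ g q := fun q => le_min (sq_nonneg _) hK0
  set φ : E × S → ℝ := {q | ‖q.1 - x₀‖ ≤ r}.indicator g with hφ
  have hφm : Measurable φ := hgm.indicator (hball.preimage measurable_fst)
  have hφb : ∀ q, ‖φ q‖ ≤ K := fun q => by
    refine (norm_indicator_le_norm_self _ _).trans ?_
    rw [Real.norm_of_nonneg (hg0 q)]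
    exact min_le_right _ _
  set ψ : E → ℝ := fun x => max 0 (1 - 1.5 / s) * ‖x - x₀‖ ^ 2 + V / s ^ 2 with hψ
  have hψi : Integrable (fun ω => ψ (c t ω)) P :=
    ((hint t ht.le).const_mul _).add (integrable_const _)
  have h1 := integral_comp_le_of_indepFun (hc t) (hξ t) (hind t ht) hφm hφb (ψ := ψ)
    (by fun_prop) hψi (fun x => by
      by_cases hx : ‖x - x₀‖ ≤ r
      · simp only [hφ, Set.indicator, Set.mem_ofPred_eq, hx, if_true]
        refine (hstep t ht x hx).trans ?_
        simp only [hψ]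
        gcongr
        exact le_max_right _ _
      · simp only [hφ, Set.indicator, Set.mem_ofPred_eq, hx, if_false, integral_zero]
        positivity)
  have h2 : ∫ ω, ψ (c t ω) ∂P = max 0 (1 - 1.5 / s) * ∫ ω, ‖c t ω - x₀‖ ^ 2 ∂P + V / s ^ 2 := by
    rw [integral_add ((hint t ht.le).const_mul _) (integrable_const _), integral_const_mul]
    simp
  have hoi : Integrable ({ω | r < ‖c t ω - x₀‖}.indicator fun _ => K) P :=
    (integrable_const K).indicator (hout t)
  have hφi : Integrable (fun ω => φ (c t ω, ξ t ω)) P :=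
    Integrable.of_bound (hφm.comp ((hc t).prodMk (hξ t))).aestronglyMeasurable K
      (Filter.Eventually.of_forall fun ω => hφb _)
  have h3 : ∫ ω, ‖c (t + 1) ω - x₀‖ ^ 2 ∂P ≤
      ∫ ω, (φ (c t ω, ξ t ω) + {ω | r < ‖c t ω - x₀‖}.indicator (fun _ => K) ω) ∂P := by
    refine integral_mono_ae (hint (t + 1) ht) (hφi.add hoi) ?_
    filter_upwards [hK (t + 1) ht] with ω hω
    by_cases h : ‖c t ω - x₀‖ ≤ r
    · have e1 : φ (c t ω, ξ t ω) = ‖c (t + 1) ω - x₀‖ ^ 2 := by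
        simp only [hφ, Set.indicator, Set.mem_ofPred_eq, h, if_true, hg]
        rw [← hrec t ht, min_eq_left hω]
      simp [e1, h]
    · have : r < ‖c t ω - x₀‖ := not_le.1 h
      simp only [hφ, Set.indicator, Set.mem_ofPred_eq, h, if_false, this, if_true, zero_add]
      exact hω
  rw [integral_add hφi hoi, integral_indicator_const _ (hout t), smul_eq_mul] at h3
  have h4 := hescape t ht.le
  have h5 : P.real {ω | r < ‖c t ω - x₀‖} * K ≤ K * η * (T : ℝ) ^ 3 / s ^ 2 := by
    rw [le_div_iff₀ (by positivity)]
    have hsT : s ≤ T := by rw [hs]; exact_mod_cast ht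
    have htT : (t : ℝ) ≤ T := by exact_mod_cast ht.le
    calc P.real {ω | r < ‖c t ω - x₀‖} * K * s ^ 2 ≤ t * η * K * s ^ 2 := by gcongr
      _ ≤ T * η * K * (T : ℝ) ^ 2 := by gcongr
      _ = _ := by ring
  have h6 : (V + K * η * (T : ℝ) ^ 3) / s ^ 2 = V / s ^ 2 + K * η * (T : ℝ) ^ 3 / s ^ 2 :=
    add_div _ _ _
  change ∫ ω, ‖c (t + 1) ω - x₀‖ ^ 2 ∂P ≤
    max 0 (1 - 1.5 / s) * ∫ ω, ‖c t ω - x₀‖ ^ 2 ∂P + (V + K * η * (T : ℝ) ^ 3) / s ^ 2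
  linarith

end

section

/-! ### Measurability of the update -/

variable {d k n : ℕ} {R M : ℝ}

theorem measurableSet_boundedMeasures (d : ℕ) (R M : ℝ) :
    MeasurableSet (boundedMeasures d R M) := by
  have h1 : Measurable fun ν : Measure (Pt d) => ν (Metric.closedBall 0 R)ᶜ :=
    Measure.measurable_coe Metric.isClosed_closedBall.measurableSet.compl
  have h2 : Measurable fun ν : Measure (Pt d) => ν Set.univ :=
    Measure.measurable_coe MeasurableSet.univ
  exact (h1 (measurableSet_singleton 0)).inter (measurableSet_le h2 measurable_const)

theorem ae_norm_le_of_mem_boundedMeasures {ν : Measure (Pt d)} (h : ν ∈ boundedMeasures d R M) :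
    ∀ᵐ x ∂ν, ‖x‖ ≤ R := by
  refine measure_mono_null (fun x hx => ?_) h.1
  simpa using hx

theorem isFiniteMeasure_of_mem_boundedMeasures {ν : Measure (Pt d)}
    (h : ν ∈ boundedMeasures d R M) : IsFiniteMeasure ν :=
  ⟨h.2.trans_lt ENNReal.ofReal_lt_top⟩

theorem measureReal_le_of_mem_boundedMeasures (hM : 0 ≤ M) {ν : Measure (Pt d)}
    (h : ν ∈ boundedMeasures d R M) (A : Set (Pt d)) : ν.real A ≤ M :=
  ENNReal.toReal_le_of_le_ofReal hM ((measure_mono (Set.subset_univ A)).trans h.2)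

open Classical in
/-- The measure `ν` itself if it lies in `M(R, M)`, and `0` otherwise. -/
def truncate (R M : ℝ) (ν : Measure (Pt d)) : Measure (Pt d) :=
  if ν ∈ boundedMeasures d R M then ν else 0

theorem truncate_of_mem {ν : Measure (Pt d)} (h : ν ∈ boundedMeasures d R M) :
    truncate R M ν = ν := if_pos h

theorem truncate_mem (R M : ℝ) (ν : Measure (Pt d)) : truncate R M ν ∈ boundedMeasures d R M := by
  unfold truncate
  split_ifs with h
  · exact h
  · simp [boundedMeasures]

theorem measurable_truncate : Measurable (truncate R M : Measure (Pt d) → Measure (Pt d)) :=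
  Measurable.ite (measurableSet_boundedMeasures d R M) measurable_id measurable_const

/-- The kernel given by `truncate`. -/
def truncateKernel (d : ℕ) (R M : ℝ) : Kernel (Measure (Pt d)) (Pt d) :=
  ⟨truncate R M, measurable_truncate⟩

instance : IsFiniteKernel (truncateKernel d R M) :=
  ⟨⟨ENNReal.ofReal M, ENNReal.ofReal_lt_top, fun ν => (truncate_mem R M ν).2⟩⟩

/-- The use of `truncate`: it is a finite kernel, so the mass of a cell is measurable jointly in the
codebook and the measure. Batch means lie almost surely in M(R, M), where truncation changes
nothing. -/
theorem measurable_truncate_real_cell (j : Fin k) :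
    Measurable fun q : Codebook d k × Measure (Pt d) => (truncate R M q.2).real (cell q.1 j) := by
  have h := Kernel.measurable_kernel_prodMk_left
    (κ := (truncateKernel d R M).comap (Prod.snd : Codebook d k × Measure (Pt d) → _)
      measurable_snd)
    (t := {p : (Codebook d k × Measure (Pt d)) × Pt d | p.2 ∈ cell p.1.1 j})
    ((measurable_fst.fst.prodMk measurable_snd) (measurableSet_setOf_mem_cell j))
  exact h.ennreal_toReal

theorem measurable_setIntegral_truncate_cell (j : Fin k) :
    Measurable fun q : Codebook d k × Measure (Pt d) =>
      ∫ x in cell q.1 j, (q.1 j - x) ∂(truncate R M q.2) := by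
  have hf : StronglyMeasurable fun p : (Codebook d k × Measure (Pt d)) × Pt d =>
      {p : (Codebook d k × Measure (Pt d)) × Pt d | p.2 ∈ cell p.1.1 j}.indicator
        (fun p => p.1.1 j - p.2) p := by
    refine StronglyMeasurable.indicator (Measurable.stronglyMeasurable ?_)
      ((measurable_fst.fst.prodMk measurable_snd) (measurableSet_setOf_mem_cell j))
    have h1 : Measurable fun c : Codebook d k => c j := Continuous.measurable (by fun_prop)
    exact (h1.comp measurable_fst.fst).sub measurable_snd
  have h := hf.integral_kernel_prod_right'
    (κ := (truncateKernel d R M).comap (Prod.snd : Codebook d k × Measure (Pt d) → _)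
      measurable_snd)
  convert h.measurable using 2 with q
  rw [← integral_indicator (measurableSet_cell _ _)]
  rfl

theorem measurable_ballProj (R : ℝ) : Measurable (ballProj R : Pt d → Pt d) := by
  refine Measurable.ite (measurableSet_le measurable_norm measurable_const) measurable_id ?_
  exact (measurable_const.div measurable_norm).smul measurable_id

theorem measurable_centroidUpdate_truncate (R M : ℝ) (t : ℕ) :
    Measurable fun q : Codebook d k × (Measure (Pt d) × Measure (Pt d)) =>
      centroidUpdate t (truncate R M q.2.1) (truncate R M q.2.2) q.1 := by
  refine (WithLp.measurable_toLp 2 _).comp (measurable_pi_iff.2 fun j => ?_)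
  have h1 : Measurable fun c : Codebook d k => c j := Continuous.measurable (by fun_prop)
  have h2 := (measurable_truncate_real_cell (d := d) (R := R) (M := M) j).comp
    (measurable_fst.prodMk measurable_snd.fst :
      Measurable fun q : Codebook d k × (Measure (Pt d) × Measure (Pt d)) => (q.1, q.2.1))
  have h3 := (measurable_setIntegral_truncate_cell (d := d) (R := R) (M := M) j).comp
    (measurable_fst.prodMk measurable_snd.snd :
      Measurable fun q : Codebook d k × (Measure (Pt d) × Measure (Pt d)) => (q.1, q.2.2))
  exact (h1.comp measurable_fst).sub ((h2.const_mul _).inv.smul h3)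

/-- The split update, as a function of the codebook and of the two batch means. -/
def projectedStep (R M : ℝ) (t : ℕ) (q : Codebook d k × (Measure (Pt d) × Measure (Pt d))) :
    Codebook d k :=
  WithLp.toLp 2 fun j =>
    ballProj R (centroidUpdate t (truncate R M q.2.1) (truncate R M q.2.2) q.1 j)

/-- The unprojected update, as a function of the codebook and of the two batch means. -/
def plainStep (R M : ℝ) (t : ℕ) (q : Codebook d k × (Measure (Pt d) × Measure (Pt d))) :
    Codebook d k :=
  centroidUpdate t (truncate R M q.2.1) (truncate R M q.2.2) q.1

theorem measurable_plainStep (R M : ℝ) (t : ℕ) :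
    Measurable (plainStep R M t :
      Codebook d k × (Measure (Pt d) × Measure (Pt d)) → Codebook d k) :=
  measurable_centroidUpdate_truncate R M t

theorem measurable_projectedStep (R M : ℝ) (t : ℕ) :
    Measurable (projectedStep R M t :
      Codebook d k × (Measure (Pt d) × Measure (Pt d)) → Codebook d k) := by
  refine (WithLp.measurable_toLp 2 _).comp (measurable_pi_iff.2 fun j => ?_)
  have h1 : Measurable fun c : Codebook d k => c j := Continuous.measurable (by fun_prop)
  exact (measurable_ballProj R).comp (h1.comp (measurable_centroidUpdate_truncate R M t))

/-- The iterates of the random maps `G t (·, ξ t)`. -/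
def iterates {E S : Type*} (G : ℕ → E × S → E) (ξ : ℕ → S) (c₀ : E) : ℕ → E
  | 0 => c₀
  | t + 1 => G t (iterates G ξ c₀ t, ξ t)

theorem measurable_iterates {Ω E S : Type*} [MeasurableSpace Ω] [MeasurableSpace E]
    [MeasurableSpace S] {G : ℕ → E × S → E} (hG : ∀ t, Measurable (G t)) {ξ : ℕ → Ω → S} (c₀ : E)
    {t : ℕ} (hξ : ∀ s < t, Measurable (ξ s)) :
    Measurable fun ω => iterates G (fun s => ξ s ω) c₀ t := by
  induction t with
  | zero => exact measurable_const
  | succ t ih =>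
    exact (hG t).comp ((ih fun s hs => hξ s (by omega)).prodMk (hξ t (by omega)))

/-- The iterate t is a function of the earlier batches only, and these are disjoint from the batch
t. -/
theorem indepFun_iterates {Ω E S X ι : Type*} [mΩ : MeasurableSpace Ω] {P : Measure Ω}
    [MeasurableSpace E] [MeasurableSpace S] [mX : MeasurableSpace X] {G : ℕ → E × S → E}
    (hG : ∀ t, Measurable (G t)) {ξ : ℕ → Ω → S} (c₀ : E) {Xs : ι → Ω → X}
    (hXs : ∀ i, Measurable (Xs i)) (hind : iIndepFun Xs P) {B : ℕ → Finset ι} {t : ℕ}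
    (hdisj : ∀ s < t, Disjoint (B s) (B t))
    (hξ : ∀ s ≤ t, Measurable[⨆ i ∈ (B s : Set ι), mX.comap (Xs i)] (ξ s)) :
    IndepFun (fun ω => iterates G (fun s => ξ s ω) c₀ t) (ξ t) P := by
  set S₀ : Set ι := ⋃ s ∈ Set.Iio t, (B s : Set ι) with hS₀
  have hd : Disjoint S₀ (B t : Set ι) := by
    simp only [hS₀, Set.disjoint_iUnion_left]
    exact fun s hs => Finset.disjoint_coe.2 (hdisj s hs)
  have hI := indep_iSup_of_disjoint (m := fun i => mX.comap (Xs i))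
    (fun i => (hXs i).comap_le) hind hd
  have h1 : Measurable[⨆ i ∈ S₀, mX.comap (Xs i)]
      fun ω => iterates G (fun s => ξ s ω) c₀ t := by
    refine @measurable_iterates Ω E S (⨆ i ∈ S₀, mX.comap (Xs i)) _ _ G hG ξ c₀ t
      fun s hs => (hξ s hs.le).mono (biSup_mono fun i hi => ?_) le_rfl
    exact Set.mem_biUnion (show s ∈ Set.Iio t from hs) hi
  exact indep_of_indep_of_le_right (indep_of_indep_of_le_left hI h1.comap_le)
    (hξ t le_rfl).comap_le

/-! ### Batch means -/

theorem measurable_batchMean {Ω : Type*} [MeasurableSpace Ω] {Xs : Fin n → Ω → Measure (Pt d)}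
    {B : Finset (Fin n)} (h : ∀ i ∈ B, Measurable (Xs i)) :
    Measurable fun ω => batchMean (fun i => Xs i ω) B := by
  refine Measure.measurable_of_measurable_coe _ fun A hA => ?_
  simp only [batchMean, Measure.smul_apply, Measure.finsetSum_apply, smul_eq_mul]
  exact (Finset.measurable_sum _ fun i hi => (Measure.measurable_coe hA).comp (h i hi)).const_mul _

theorem batchMean_mem_boundedMeasures {ν : Fin n → Measure (Pt d)}
    (h : ∀ i, ν i ∈ boundedMeasures d R M) (B : Finset (Fin n)) :
    batchMean ν B ∈ boundedMeasures d R M := by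
  rcases B.eq_empty_or_nonempty with rfl | hB
  · simp [batchMean, boundedMeasures]
  constructor
  · simp only [batchMean, Measure.smul_apply, Measure.finsetSum_apply, smul_eq_mul]
    rw [Finset.sum_eq_zero fun i _ => (h i).1, mul_zero]
  · simp only [batchMean, Measure.smul_apply, Measure.finsetSum_apply, smul_eq_mul]
    have hc : (B.card : ENNReal) ≠ 0 := by exact_mod_cast hB.card_pos.ne'
    calc (B.card : ENNReal)⁻¹ * ∑ i ∈ B, ν i Set.univ
        ≤ (B.card : ENNReal)⁻¹ * ∑ _i ∈ B, ENNReal.ofReal M := by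
          gcongr with i
          exact (h i).2
      _ = ENNReal.ofReal M := by
          rw [Finset.sum_const, nsmul_eq_mul, ← mul_assoc,
            ENNReal.inv_mul_cancel hc (ENNReal.natCast_ne_top _), one_mul]

theorem integral_batchMean {E : Type*} [NormedAddCommGroup E] [NormedSpace ℝ E]
    {ν : Fin n → Measure (Pt d)} {B : Finset (Fin n)} {h : Pt d → E}
    (hi : ∀ i ∈ B, Integrable h (ν i)) :
    ∫ x, h x ∂(batchMean ν B) = (B.card : ℝ)⁻¹ • ∑ i ∈ B, ∫ x, h x ∂(ν i) := by
  rw [batchMean, integral_smul_measure, integral_finsetSum_measure hi]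
  simp

end

section

/-! ### Statistics of i.i.d. random measures -/

variable {d k n : ℕ} {R M : ℝ} {Ω : Type*} [MeasurableSpace Ω] {P : Measure Ω}
  {X : Ω → Measure (Pt d)} {Xs : Fin n → Ω → Measure (Pt d)}

theorem meanMeasure_mem_boundedMeasures [IsProbabilityMeasure P] (hXm : Measurable X)
    (hX : ∀ᵐ ω ∂P, X ω ∈ boundedMeasures d R M) : meanMeasure P X ∈ boundedMeasures d R M := by
  constructor
  · rw [meanMeasure_apply P X hXm Metric.isClosed_closedBall.measurableSet.compl,
      lintegral_congr_ae (hX.mono fun ω hω => hω.1)]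
    simp
  · rw [meanMeasure_apply P X hXm MeasurableSet.univ]
    refine (lintegral_mono_ae (hX.mono fun ω hω => hω.2)).trans ?_
    simp

theorem ae_forall_sample_mem (hiid : IsIIDSample P X Xs)
    (hX : ∀ᵐ ω ∂P, X ω ∈ boundedMeasures d R M) :
    ∀ᵐ ω ∂P, ∀ i, Xs i ω ∈ boundedMeasures d R M :=
  ae_all_iff.2 fun i =>
    (hiid.ident i).symm.ae_mem_snd (measurableSet_boundedMeasures d R M) hX

section Statistic

variable {E : Type*} [NormedAddCommGroup E] {h : Pt d → E} {b : ℝ}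

theorem integrable_of_mem_boundedMeasures (hm : StronglyMeasurable h)
    (hb : ∀ x, ‖x‖ ≤ R → ‖h x‖ ≤ b) {ν : Measure (Pt d)} (hν : ν ∈ boundedMeasures d R M) :
    Integrable h ν := by
  have := isFiniteMeasure_of_mem_boundedMeasures hν
  exact Integrable.of_bound hm.aestronglyMeasurable b
    ((ae_norm_le_of_mem_boundedMeasures hν).mono fun x hx => hb x hx)

variable [InnerProductSpace ℝ E]

theorem norm_integral_le_of_mem_boundedMeasures (hM : 0 ≤ M) (hb0 : 0 ≤ b)
    (hb : ∀ x, ‖x‖ ≤ R → ‖h x‖ ≤ b) {ν : Measure (Pt d)} (hν : ν ∈ boundedMeasures d R M) :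
    ‖∫ x, h x ∂ν‖ ≤ b * M := by
  have := isFiniteMeasure_of_mem_boundedMeasures hν
  refine (norm_integral_le_of_norm_le_const
    ((ae_norm_le_of_mem_boundedMeasures hν).mono fun x hx => hb x hx)).trans ?_
  exact mul_le_mul_of_nonneg_left (measureReal_le_of_mem_boundedMeasures hM hν _) hb0

theorem stronglyMeasurable_integral (hm : StronglyMeasurable h) :
    StronglyMeasurable fun ν : Measure (Pt d) => ∫ x, h x ∂ν :=
  hm.integral_kernel (κ := (⟨id, measurable_id⟩ : Kernel (Measure (Pt d)) (Pt d)))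

theorem integral_integral_sample [IsProbabilityMeasure P] [CompleteSpace E] [MeasurableSpace E] [BorelSpace E]
    [SecondCountableTopology E] (hiid : IsIIDSample P X Xs)
    (hX : ∀ᵐ ω ∂P, X ω ∈ boundedMeasures d R M) (hm : StronglyMeasurable h)
    (hb : ∀ x, ‖x‖ ≤ R → ‖h x‖ ≤ b) (i : Fin n) :
    ∫ ω, ∫ x, h x ∂(Xs i ω) ∂P = ∫ x, h x ∂(meanMeasure P X) := by
  have h1 : ∫ ω, ∫ x, h x ∂(Xs i ω) ∂P = ∫ ω, ∫ x, h x ∂(X ω) ∂P :=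
    ((hiid.ident i).comp (stronglyMeasurable_integral hm).measurable).integral_eq
  rw [h1]
  set κ : Kernel Ω (Pt d) := ⟨X, hiid.measurable_pop⟩ with hκ
  -- The mean measure is the composition of the kernel X with P, so integration against it is an
  -- iterated integral.
  have e : meanMeasure P X = (κ ∘ₖ Kernel.const Unit P) () := by
    rw [Kernel.comp_apply, Kernel.const_apply]
    rfl
  have hi := integrable_of_mem_boundedMeasures hm hb
    (meanMeasure_mem_boundedMeasures hiid.measurable_pop hX)
  rw [e] at hi ⊢
  rw [Kernel.integral_comp hi, Kernel.const_apply]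
  rfl

theorem measure_norm_integral_batchMean_sub_ge_le [IsProbabilityMeasure P] [CompleteSpace E]
    [MeasurableSpace E] [BorelSpace E] [SecondCountableTopology E] (hiid : IsIIDSample P X Xs)
    (hX : ∀ᵐ ω ∂P, X ω ∈ boundedMeasures d R M) (hM : 0 < M) (hm : StronglyMeasurable h)
    (hb0 : 0 < b) (hb : ∀ x, ‖x‖ ≤ R → ‖h x‖ ≤ b) {B : Finset (Fin n)} (hB : 0 < B.card) {r : ℝ}
    (hr : 0 < r) :
    P.real {ω | r ≤ ‖∫ x, h x ∂(batchMean (fun i => Xs i ω) B) - ∫ x, h x ∂(meanMeasure P X)‖} ≤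
      2 * Real.exp (-(B.card * r ^ 2 / (8 * (b * M) ^ 2))) := by
  have hall := ae_forall_sample_mem hiid hX
  have hmeas := (stronglyMeasurable_integral hm).measurable
  have hconc := measure_norm_average_sub_ge_le (P := P) (Z := fun i ω => ∫ x, h x ∂(Xs i ω))
    (b := b * M) (m := ∫ x, h x ∂(meanMeasure P X)) (s := B) (r := r)
    (fun i => hmeas.comp (hiid.measurable i)) (hiid.indep.comp _ fun _ => hmeas) (by positivity)
    (fun i => hall.mono fun ω hω =>
      norm_integral_le_of_mem_boundedMeasures hM.le hb0.le hb (hω i))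
    (fun i => integral_integral_sample hiid hX hm hb i) hB hr
  refine le_trans (le_of_eq ?_) hconc
  refine measureReal_congr ?_
  filter_upwards [hall] with ω hω
  have e := integral_batchMean (ν := fun i => Xs i ω) (B := B)
    fun i _ => integrable_of_mem_boundedMeasures hm hb (hω i)
  change (_ ≤ _) = (_ ≤ _)
  rw [e]

theorem integral_integral_batchMean [IsProbabilityMeasure P] [CompleteSpace E]
    [MeasurableSpace E] [BorelSpace E] [SecondCountableTopology E] (hiid : IsIIDSample P X Xs)
    (hX : ∀ᵐ ω ∂P, X ω ∈ boundedMeasures d R M) (hM : 0 < M) (hm : StronglyMeasurable h)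
    (hb0 : 0 ≤ b) (hb : ∀ x, ‖x‖ ≤ R → ‖h x‖ ≤ b) {B : Finset (Fin n)} (hB : 0 < B.card) :
    Integrable (fun ω => ∫ x, h x ∂(batchMean (fun i => Xs i ω) B)) P ∧
    ∫ ω, ∫ x, h x ∂(batchMean (fun i => Xs i ω) B) ∂P = ∫ x, h x ∂(meanMeasure P X) := by
  have hall := ae_forall_sample_mem hiid hX
  have hmeas := stronglyMeasurable_integral hm
  constructor
  · refine Integrable.of_bound (C := b * M) (hmeas.measurable.comp (measurable_batchMean
      fun i _ => hiid.measurable i)).aestronglyMeasurable (hall.mono fun ω hω => ?_)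
    exact norm_integral_le_of_mem_boundedMeasures hM.le hb0 hb (batchMean_mem_boundedMeasures hω B)
  · have e : (fun ω => ∫ x, h x ∂(batchMean (fun i => Xs i ω) B)) =ᵐ[P]
        fun ω => (B.card : ℝ)⁻¹ • ∑ i ∈ B, ∫ x, h x ∂(Xs i ω) := by
      filter_upwards [hall] with ω hω
      exact integral_batchMean fun i _ => integrable_of_mem_boundedMeasures hm hb (hω i)
    rw [integral_congr_ae e, integral_smul, integral_finsetSum]
    · simp_rw [integral_integral_sample hiid hX hm hb]
      rw [Finset.sum_const, ← Nat.cast_smul_eq_nsmul ℝ, smul_smul, inv_mul_cancel₀, one_smul]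
      exact_mod_cast hB.ne'
    · intro i _
      refine Integrable.of_bound (C := b * M) (hmeas.measurable.comp
        (hiid.measurable i)).aestronglyMeasurable (hall.mono fun ω hω => ?_)
      exact norm_integral_le_of_mem_boundedMeasures hM.le hb0 hb (hω i)

end Statistic

end

section

/-! ### One step from a codebook close to an optimal one -/

variable {d k n : ℕ} {R M r₀ : ℝ} {Ω : Type*} [MeasurableSpace Ω] {P : Measure Ω}
  {X : Ω → Measure (Pt d)} {Xs : Fin n → Ω → Measure (Pt d)} {c₀ : Codebook d k}

/-- The assumptions on the sample and on the optimal codebook `c₀`. -/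
structure QuantizationSetting (P : Measure Ω) (X : Ω → Measure (Pt d))
    (Xs : Fin n → Ω → Measure (Pt d)) (R M r₀ : ℝ) (c₀ : Codebook d k) : Prop where
  two_le : 2 ≤ k
  two_le_sample : 2 ≤ n
  radius_pos : 0 < R
  bound_pos : 0 < M
  iid : IsIIDSample P X Xs
  bounded : ∀ᵐ ω ∂P, X ω ∈ boundedMeasures d R M
  optimal : c₀ ∈ optimalCodebooks k R (meanMeasure P X)
  separation_pos : 0 < minSeparation k R (meanMeasure P X)
  mass_pos : 0 < minMass k R (meanMeasure P X)
  margin : MarginCondition k R r₀ (meanMeasure P X)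

theorem stronglyMeasurable_indicator_cell (c : Codebook d k) (j : Fin k) :
    StronglyMeasurable ((cell c j).indicator fun _ => (1 : ℝ)) :=
  stronglyMeasurable_const.indicator (measurableSet_cell c j)

theorem stronglyMeasurable_indicator_cell_sub (c : Codebook d k) (j : Fin k) :
    StronglyMeasurable ((cell c j).indicator fun x => c j - x) :=
  (Continuous.stronglyMeasurable (by fun_prop)).indicator (measurableSet_cell c j)

theorem integral_indicator_cell (c : Codebook d k) (j : Fin k) (ν : Measure (Pt d)) :
    ∫ x, (cell c j).indicator (fun _ => (1 : ℝ)) x ∂ν = ν.real (cell c j) := by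
  rw [integral_indicator_const _ (measurableSet_cell c j)]
  simp

theorem integral_indicator_cell_sub (c : Codebook d k) (j : Fin k) (ν : Measure (Pt d)) :
    ∫ x, (cell c j).indicator (fun x => c j - x) x ∂ν = ∫ x in cell c j, (c j - x) ∂ν :=
  integral_indicator (measurableSet_cell c j)

theorem measurable_real_cell (c : Codebook d k) (j : Fin k) :
    Measurable fun ν : Measure (Pt d) => ν.real (cell c j) :=
  (Measure.measurable_coe (measurableSet_cell c j)).ennreal_toReal

theorem measurable_setIntegral_cell (c : Codebook d k) (j : Fin k) :
    Measurable fun ν : Measure (Pt d) => ∫ x in cell c j, (c j - x) ∂ν := by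
  simpa only [integral_indicator_cell_sub] using
    (stronglyMeasurable_integral (stronglyMeasurable_indicator_cell_sub c j)).measurable

/-- The accuracy required from the batch means. -/
def accuracy (k : ℕ) (R r₀ : ℝ) (μ : Measure (Pt d)) : ℝ :=
  kappa k R r₀ μ * minMass k R μ / √k / 10

/-- The masses of the cells of `c` are close for `ν` and for `μ`. -/
def MassAccurate (r₀ R : ℝ) (μ ν : Measure (Pt d)) (c : Codebook d k) : Prop :=
  ∀ j, ‖ν.real (cell c j) - μ.real (cell c j)‖ < accuracy k R r₀ μ

/-- The gradients at `c` are close for `ν` and for `μ`. -/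
def GradientAccurate (r₀ R : ℝ) (μ ν : Measure (Pt d)) (c : Codebook d k) : Prop :=
  ∀ j, ‖∫ x in cell c j, (c j - x) ∂ν - ∫ x in cell c j, (c j - x) ∂μ‖ < R * accuracy k R r₀ μ

theorem measure_exists_ge_le {P : Measure Ω} [IsProbabilityMeasure P] {f : Fin k → Ω → ℝ}
    {r ε : ℝ} (h : ∀ j, P.real {ω | r ≤ f j ω} ≤ ε) :
    P.real {ω | ¬ ∀ j, f j ω < r} ≤ k * ε := by
  have e : {ω | ¬ ∀ j, f j ω < r} = ⋃ j, {ω | r ≤ f j ω} := by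
    ext ω
    simp
  rw [e]
  refine (measureReal_iUnion_fintype_le _).trans ((Finset.sum_le_sum fun j _ => h j).trans ?_)
  simp

namespace QuantizationSetting

variable (hS : QuantizationSetting P X Xs R M r₀ c₀)
include hS

theorem initRadius_pos : 0 < initRadius k R r₀ (meanMeasure P X) := by
  have h1 := hS.separation_pos
  have h2 := hS.margin.1
  have h3 := hS.radius_pos
  unfold initRadius
  positivity

theorem kappa_pos : 0 < kappa k R r₀ (meanMeasure P X) :=
  div_pos hS.initRadius_pos hS.radius_pos

theorem cast_pos : (0 : ℝ) < k := by
  have := hS.two_le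
  exact_mod_cast (by omega : 0 < k)

theorem batchScale_pos : 0 < batchScale k n R M r₀ (meanMeasure P X) := by
  have hκ := hS.kappa_pos
  have hp := hS.mass_pos
  have hM := hS.bound_pos
  have hk := hS.cast_pos
  have hlog : 0 < Real.log n := Real.log_pos (by exact_mod_cast hS.two_le_sample)
  unfold batchScale
  positivity

theorem accuracy_pos : 0 < accuracy k R r₀ (meanMeasure P X) := by
  have h1 := hS.kappa_pos
  have h2 := hS.mass_pos
  have h3 := hS.cast_pos
  unfold accuracy
  positivity

theorem card_pos {B : Finset (Fin n)}
    (hB : 72000 * batchScale k n R M r₀ (meanMeasure P X) ≤ B.card) : 0 < B.card := by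
  have := hS.batchScale_pos
  have h : (0 : ℝ) < B.card := lt_of_lt_of_le (by positivity) hB
  exact_mod_cast h

/-- The squared accuracy is (κp)²/(100k), so 72000 = 10·8·9·100 makes the exponent at least 10 log n
when b ≤ 3. The value b = 1 serves the masses, and b = 3 the gradients after scaling by R. -/
theorem exp_le_of_batchScale_le {B : Finset (Fin n)}
    (hB : 72000 * batchScale k n R M r₀ (meanMeasure P X) ≤ B.card) {b : ℝ} (hb0 : 0 < b)
    (hb : b ≤ 3) : 2 * Real.exp (-(B.card * (accuracy k R r₀ (meanMeasure P X)) ^ 2 /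
      (8 * (b * M) ^ 2))) ≤ 2 / (n : ℝ) ^ 10 := by
  have hκ := hS.kappa_pos
  have hp := hS.mass_pos
  have hM := hS.bound_pos
  have hk := hS.cast_pos
  have hn : (0 : ℝ) < n := by
    have := hS.two_le_sample
    exact_mod_cast (by omega : 0 < n)
  set κ := kappa k R r₀ (meanMeasure P X) with hκd
  set p := minMass k R (meanMeasure P X) with hpd
  have e : Real.exp (-(10 * Real.log n)) = ((n : ℝ) ^ 10)⁻¹ := by
    rw [Real.exp_neg, mul_comm, Real.exp_mul, Real.exp_log hn]
    norm_num
  rw [div_eq_mul_inv 2, ← e]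
  gcongr
  have hlog : 0 ≤ Real.log n := Real.log_natCast_nonneg n
  rw [le_div_iff₀ (by positivity)]
  have h1 : (accuracy k R r₀ (meanMeasure P X)) ^ 2 = (κ * p) ^ 2 / k / 100 := by
    rw [accuracy, div_pow, div_pow, Real.sq_sqrt hk.le, ← hκd, ← hpd]
    norm_num
  have h2 : batchScale k n R M r₀ (meanMeasure P X) * ((κ * p) ^ 2 / k / 100) =
      M ^ 2 * Real.log n / 100 := by
    rw [batchScale, ← hκd, ← hpd]
    field_simp
  have h3 := mul_le_mul_of_nonneg_right hB
    (show 0 ≤ (κ * p) ^ 2 / k / 100 by positivity)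
  rw [mul_assoc, h2] at h3
  rw [h1]
  have h4 : b ^ 2 ≤ 9 := by nlinarith
  have h5 : b ^ 2 * (M ^ 2 * Real.log n) ≤ 9 * (M ^ 2 * Real.log n) := by gcongr
  calc 10 * Real.log n * (8 * (b * M) ^ 2) = 80 * (b ^ 2 * (M ^ 2 * Real.log n)) := by ring
    _ ≤ 720 * (M ^ 2 * Real.log n) := by linarith
    _ = 72000 * (M ^ 2 * Real.log n / 100) := by ring
    _ ≤ _ := h3

variable [IsProbabilityMeasure P]

theorem mean_mem : meanMeasure P X ∈ boundedMeasures d R M :=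
  meanMeasure_mem_boundedMeasures hS.iid.measurable_pop hS.bounded

theorem isFiniteMeasure : IsFiniteMeasure (meanMeasure P X) :=
  isFiniteMeasure_of_mem_boundedMeasures hS.mean_mem

theorem ae_norm_le : ∀ᵐ x ∂(meanMeasure P X), ‖x‖ ≤ R :=
  ae_norm_le_of_mem_boundedMeasures hS.mean_mem

theorem initRadius_le : initRadius k R r₀ (meanMeasure P X) ≤ R :=
  have := hS.isFiniteMeasure
  MeanMeasure.initRadius_le hS.two_le hS.radius_pos hS.ae_norm_le hS.optimal hS.separation_pos
    hS.mass_pos hS.margin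

theorem kappa_le : kappa k R r₀ (meanMeasure P X) ≤ 1 :=
  (div_le_one hS.radius_pos).2 hS.initRadius_le

theorem minMass_le_bound : minMass k R (meanMeasure P X) ≤ M :=
  (minMass_le hS.optimal ⟨0, by have := hS.two_le; omega⟩).trans
    (measureReal_le_of_mem_boundedMeasures hS.bound_pos.le hS.mean_mem _)

/-- From κ ≤ 1 and √k ≥ 1.4. As cells near the optimum have mass at least 0.9p, the error 0.072p is
at most 8% of such a mass. -/
theorem accuracy_le : accuracy k R r₀ (meanMeasure P X) ≤ 0.072 * minMass k R (meanMeasure P X) := by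
  have h1 := hS.kappa_le
  have h2 := hS.mass_pos
  have h3 : (1.4 : ℝ) ≤ √k := by
    refine Real.le_sqrt_of_sq_le ?_
    have : (2 : ℝ) ≤ k := by exact_mod_cast hS.two_le
    norm_num
    linarith
  rw [accuracy, div_div, div_le_iff₀ (by positivity)]
  have h4 := mul_le_mul_of_nonneg_right h1 h2.le
  have h5 := mul_le_mul_of_nonneg_left h3 h2.le
  linarith

theorem apply_le {c : Codebook d k} (hc : ‖c - c₀‖ ≤ initRadius k R r₀ (meanMeasure P X))
    (j : Fin k) : ‖c j‖ ≤ 2 * R := by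
  have h1 := norm_apply_le (c - c₀) j
  have h2 := mem_closedBall_zero_iff.1 (hS.optimal.1 j)
  have h3 : c j = (c - c₀) j + c₀ j := by simp
  rw [h3]
  linarith [norm_add_le ((c - c₀) j) (c₀ j), hS.initRadius_le]

theorem gradient {c : Codebook d k} (hc : ‖c - c₀‖ ≤ initRadius k R r₀ (meanMeasure P X)) :
    (∀ j, 0.9 * minMass k R (meanMeasure P X) ≤ (meanMeasure P X).real (cell c j)) ∧
    ∃ e : Fin k → Pt d, (∀ j, ∫ x in cell c j, (c j - x) ∂(meanMeasure P X) =
      (meanMeasure P X).real (cell c j) • (c j - c₀ j + e j)) ∧ ∑ j, ‖e j‖ ≤ ‖c - c₀‖ / 10 :=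
  have := hS.isFiniteMeasure
  gradient_near_optimal hS.two_le hS.radius_pos hS.ae_norm_le hS.optimal hS.separation_pos
    hS.mass_pos hS.margin hc

theorem mass_bounds {c : Codebook d k}
    (hc : ‖c - c₀‖ ≤ initRadius k R r₀ (meanMeasure P X)) {ν : Measure (Pt d)}
    (hν : MassAccurate r₀ R (meanMeasure P X) ν c) (j : Fin k) :
    0.92 * (meanMeasure P X).real (cell c j) ≤ ν.real (cell c j) ∧
    ν.real (cell c j) ≤ 1.08 * (meanMeasure P X).real (cell c j) := by
  have h1 := (hS.gradient hc).1 j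
  have h2 := abs_lt.1 (hν j)
  have h3 := hS.accuracy_le
  constructor <;> linarith

/-- With s = 1/(t+1), the new difference is (1 − s)(c − c₀) − s(e + w), where e is the margin error
and w the sampling error. Since ‖e‖ ≤ 0.1ρ and ‖w‖ ≤ 0.26ρ, it is a convex combination of vectors of
norm at most ρ. The invariance is deterministic. -/
theorem norm_centroidUpdate_sub_le {c : Codebook d k}
    (hc : ‖c - c₀‖ ≤ initRadius k R r₀ (meanMeasure P X)) {ν₁ ν₂ : Measure (Pt d)}
    (h₁ : MassAccurate r₀ R (meanMeasure P X) ν₁ c)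
    (h₂ : GradientAccurate r₀ R (meanMeasure P X) ν₂ c) (t : ℕ) :
    ‖centroidUpdate t ν₁ ν₂ c - c₀‖ ≤ initRadius k R r₀ (meanMeasure P X) := by
  obtain ⟨hmass, e, he, hesum⟩ := hS.gradient hc
  have hbounds := hS.mass_bounds hc h₁
  have hp := hS.mass_pos
  have hR := hS.radius_pos
  have hρR := hS.initRadius_le
  have hρ0 := hS.initRadius_pos
  have hk := hS.cast_pos
  set μ := meanMeasure P X
  set ρ := initRadius k R r₀ μ with hρ
  set p := minMass k R μ
  set a := accuracy k R r₀ μ with ha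
  have ha0 : 0 < a := hS.accuracy_pos
  set s : ℝ := ((t : ℝ) + 1)⁻¹ with hs
  have hs0 : 0 < s := by positivity
  have hs1 : s ≤ 1 := inv_le_one_of_one_le₀ (by linarith [(Nat.cast_nonneg t : (0 : ℝ) ≤ t)])
  have hpj : ∀ j, 0 < μ.real (cell c j) := fun j => lt_of_lt_of_le (by positivity) (hmass j)
  have hqj : ∀ j, 0.828 * p ≤ ν₁.real (cell c j) := fun j => by
    linarith [(hbounds j).1, hmass j]
  have hqj0 : ∀ j, 0 < ν₁.real (cell c j) := fun j => lt_of_lt_of_le (by positivity) (hqj j)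
  set w : Fin k → Pt d := fun j => (ν₁.real (cell c j))⁻¹ •
    ((μ.real (cell c j) - ν₁.real (cell c j)) • (c j - c₀ j + e j) +
      (∫ x in cell c j, (c j - x) ∂ν₂ - ∫ x in cell c j, (c j - x) ∂μ)) with hw
  have hdecomp : centroidUpdate t ν₁ ν₂ c - c₀ =
      (1 - s) • (c - c₀) - s • (WithLp.toLp 2 e + WithLp.toLp 2 w : Codebook d k) := by
    ext1 j
    change c j - (((t : ℝ) + 1) * ν₁.real (cell c j))⁻¹ • (∫ x in cell c j, (c j - x) ∂ν₂) - c₀ j =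
      (1 - s) • (c j - c₀ j) - s • (e j + w j)
    have h1 : ∫ x in cell c j, (c j - x) ∂ν₂ =
        ν₁.real (cell c j) • (c j - c₀ j + e j + w j) := by
      rw [smul_add, hw]
      simp only
      rw [smul_smul, mul_inv_cancel₀ (hqj0 j).ne', one_smul, he j, ← add_assoc, ← add_smul]
      simp
    rw [h1, mul_inv, ← hs, smul_smul, mul_assoc, inv_mul_cancel₀ (hqj0 j).ne', mul_one, sub_smul,
      one_smul, smul_add, smul_add, smul_add]
    abel
  have hvj : ∀ j, ‖c j - c₀ j + e j‖ ≤ 1.1 * R := by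
    intro j
    have h1 : ‖c j - c₀ j‖ ≤ ‖c - c₀‖ := norm_apply_le (c - c₀) j
    have h2 : ‖e j‖ ≤ ∑ j, ‖e j‖ :=
      Finset.single_le_sum (fun i _ => norm_nonneg (e i)) (Finset.mem_univ j)
    linarith [norm_add_le (c j - c₀ j) (e j)]
  -- The factor 1/√k in the accuracy serves here, to sum the k squares. The constants are 0.828 =
  -- 0.92·0.9 for the mass and 2.1 = 1.1 + 1 for the mass and gradient errors.
  have hwj : ∀ j, ‖w j‖ ≤ 0.26 * ρ / √k := by
    intro j
    have h1 : ‖(μ.real (cell c j) - ν₁.real (cell c j)) • (c j - c₀ j + e j) +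
        (∫ x in cell c j, (c j - x) ∂ν₂ - ∫ x in cell c j, (c j - x) ∂μ)‖ ≤ 2.1 * R * a := by
      refine (norm_add_le _ _).trans ?_
      rw [norm_smul, norm_sub_rev]
      have := mul_le_mul (h₁ j).le (hvj j) (norm_nonneg _) ha0.le
      linarith [h₂ j]
    rw [hw]
    simp only
    rw [norm_smul, norm_inv, Real.norm_of_nonneg (hqj0 j).le, inv_mul_le_iff₀ (hqj0 j)]
    have h2 : R * a = p * (ρ / √k / 10) := by
      rw [ha, accuracy, kappa, ← hρ]
      change R * (ρ / R * p / √k / 10) = _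
      field_simp
    calc _ ≤ 2.1 * R * a := h1
      _ = 0.21 * p * (ρ / √k) := by rw [mul_assoc, h2]; ring
      _ ≤ 0.828 * p * (0.26 * (ρ / √k)) := by
        have : 0 ≤ p * (ρ / √k) := by positivity
        nlinarith
      _ ≤ ν₁.real (cell c j) * (0.26 * (ρ / √k)) :=
        mul_le_mul_of_nonneg_right (hqj j) (by positivity)
      _ = _ := by ring
  have hwn : ‖(WithLp.toLp 2 w : Codebook d k)‖ ≤ 0.26 * ρ := by
    refine abs_le_of_sq_le_sq' ?_ (by positivity) |>.2
    rw [sq_norm_eq_sum]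
    calc ∑ j, ‖w j‖ ^ 2 ≤ ∑ _j : Fin k, (0.26 * ρ / √k) ^ 2 :=
          Finset.sum_le_sum fun j _ => by
            have := hwj j
            gcongr
      _ = (0.26 * ρ) ^ 2 := by
          rw [Finset.sum_const, Finset.card_univ, Fintype.card_fin, nsmul_eq_mul, div_pow,
            Real.sq_sqrt hk.le]
          field_simp
  have hen : ‖(WithLp.toLp 2 e : Codebook d k)‖ ≤ 0.1 * ρ := by
    refine le_trans ?_ (show ∑ j, ‖e j‖ ≤ 0.1 * ρ by linarith)
    refine abs_le_of_sq_le_sq' ?_ (Finset.sum_nonneg fun j _ => norm_nonneg _) |>.2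
    rw [sq_norm_eq_sum]
    exact Finset.sum_sq_le_sq_sum_of_nonneg fun j _ => norm_nonneg (e j)
  rw [hdecomp]
  refine (norm_sub_le _ _).trans ?_
  rw [norm_smul, norm_smul, Real.norm_of_nonneg (sub_nonneg.2 hs1), Real.norm_of_nonneg hs0.le]
  have h1 : ‖(WithLp.toLp 2 e + WithLp.toLp 2 w : Codebook d k)‖ ≤ ρ :=
    (norm_add_le _ _).trans (by linarith)
  have h2 := mul_le_mul_of_nonneg_left h1 hs0.le
  have h3 := mul_le_mul_of_nonneg_left hc (sub_nonneg.2 hs1)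
  linarith

theorem measure_not_massAccurate_le {B : Finset (Fin n)}
    (hB : 72000 * batchScale k n R M r₀ (meanMeasure P X) ≤ B.card) (c : Codebook d k) :
    P.real {ω | ¬ MassAccurate r₀ R (meanMeasure P X) (batchMean (fun i => Xs i ω) B) c} ≤
      k * (2 / (n : ℝ) ^ 10) := by
  refine measure_exists_ge_le fun j => ?_
  have h := measure_norm_integral_batchMean_sub_ge_le hS.iid hS.bounded hS.bound_pos
    (stronglyMeasurable_indicator_cell c j) (b := 1) one_pos
    (fun x _ => (norm_indicator_le_norm_self _ _).trans (by simp)) (hS.card_pos hB) hS.accuracy_pos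
  simp only [integral_indicator_cell] at h
  exact h.trans (hS.exp_le_of_batchScale_le hB one_pos (by norm_num))

theorem measure_not_gradientAccurate_le {B : Finset (Fin n)}
    (hB : 72000 * batchScale k n R M r₀ (meanMeasure P X) ≤ B.card) {c : Codebook d k}
    (hc : ‖c - c₀‖ ≤ initRadius k R r₀ (meanMeasure P X)) :
    P.real {ω | ¬ GradientAccurate r₀ R (meanMeasure P X) (batchMean (fun i => Xs i ω) B) c} ≤
      k * (2 / (n : ℝ) ^ 10) := by
  have hR := hS.radius_pos
  refine measure_exists_ge_le fun j => ?_
  have h := measure_norm_integral_batchMean_sub_ge_le hS.iid hS.bounded hS.bound_pos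
    (stronglyMeasurable_indicator_cell_sub c j) (b := 3 * R) (by positivity)
    (fun x hx => (norm_indicator_le_norm_self _ _).trans (by
      linarith [norm_sub_le (c j) x, hS.apply_le hc j]))
    (hS.card_pos hB) (mul_pos hR hS.accuracy_pos)
  simp only [integral_indicator_cell_sub] at h
  refine h.trans (le_trans (le_of_eq ?_)
    (hS.exp_le_of_batchScale_le hB (b := 3) (by norm_num) le_rfl))
  congr 3
  have hM := hS.bound_pos
  field_simp

theorem measure_initRadius_lt_le {B₁ B₂ : Finset (Fin n)}
    (hB₁ : 72000 * batchScale k n R M r₀ (meanMeasure P X) ≤ B₁.card)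
    (hB₂ : 72000 * batchScale k n R M r₀ (meanMeasure P X) ≤ B₂.card) {c : Codebook d k}
    (hc : ‖c - c₀‖ ≤ initRadius k R r₀ (meanMeasure P X)) (t : ℕ) :
    P.real {ω | initRadius k R r₀ (meanMeasure P X) <
      ‖centroidUpdate t (batchMean (fun i => Xs i ω) B₁) (batchMean (fun i => Xs i ω) B₂) c - c₀‖} ≤
      4 * k / (n : ℝ) ^ 10 := by
  have h1 := hS.measure_not_massAccurate_le hB₁ c
  have h2 := hS.measure_not_gradientAccurate_le hB₂ hc
  refine (measureReal_mono fun ω hω => ?_).trans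
    ((measureReal_union_le _ _).trans ((add_le_add h1 h2).trans (le_of_eq (by ring))))
  by_contra hcon
  simp only [Set.mem_union, Set.mem_ofPred_eq, not_or, not_not] at hcon
  exact absurd (hS.norm_centroidUpdate_sub_le hc hcon.1 hcon.2 t) (not_le.2 hω)

end QuantizationSetting

end

section

/-! ### Contraction in mean of one step -/

variable {d k n : ℕ} {R M r₀ : ℝ}

theorem norm_ballProj_sub_le (hR : 0 < R) (x : Pt d) {y : Pt d} (hy : ‖y‖ ≤ R) :
    ‖ballProj R x - y‖ ≤ ‖x - y‖ := by
  unfold ballProj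
  split_ifs with hx
  · exact le_rfl
  push Not at hx
  have hx0 : 0 < ‖x‖ := hR.trans hx
  set l := R / ‖x‖ with hl
  have hl1 : l ≤ 1 := (div_le_one hx0).2 hx.le
  have hlx : l * ‖x‖ = R := div_mul_cancel₀ _ hx0.ne'
  refine abs_le_of_sq_le_sq' ?_ (norm_nonneg _) |>.2
  rw [norm_sub_sq_real, norm_sub_sq_real, norm_smul, real_inner_smul_left,
    Real.norm_of_nonneg (by positivity)]
  have h1 : inner ℝ x y ≤ ‖x‖ * R := (real_inner_le_norm x y).trans (by gcongr)
  have h2 := mul_le_mul_of_nonneg_left h1 (sub_nonneg.2 hl1)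
  have h3 : (1 - l) * (‖x‖ * R) ≤ (1 - l) * ((‖x‖ + R) / 2 * ‖x‖) := by
    refine mul_le_mul_of_nonneg_left ?_ (sub_nonneg.2 hl1)
    nlinarith
  have h4 : (1 - l) * ((‖x‖ + R) / 2 * ‖x‖) = (‖x‖ ^ 2 - (l * ‖x‖) ^ 2) / 2 := by
    rw [← hlx]
    ring
  linarith

theorem norm_ballProj_le (hR : 0 < R) (x : Pt d) : ‖ballProj R x‖ ≤ R := by
  unfold ballProj
  split_ifs with hx
  · exact hx
  push Not at hx
  rw [norm_smul, Real.norm_of_nonneg (by positivity), div_mul_cancel₀ _ (hR.trans hx).ne']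

/-- The error term costs at most 1.1‖v‖∑‖e j‖ ≤ 0.11‖v‖², and 0.9 − 0.11 exceeds 0.75. Doubling
gives the 1.5 of the contraction. -/
theorem weighted_inner_ge {v : Codebook d k} {e : Fin k → Pt d} {θ : Fin k → ℝ}
    (he : ∑ j, ‖e j‖ ≤ ‖v‖ / 10) (hθ : ∀ j, 0.9 ≤ θ j ∧ θ j ≤ 1.1) :
    0.75 * ‖v‖ ^ 2 ≤ ∑ j, θ j * inner ℝ (v j + e j) (v j) := by
  have h1 : ∀ j, 0.9 * ‖v j‖ ^ 2 - 1.1 * (‖v‖ * ‖e j‖) ≤ θ j * inner ℝ (v j + e j) (v j) := by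
    intro j
    rw [inner_add_left, real_inner_self_eq_norm_sq]
    have a1 : -(‖e j‖ * ‖v j‖) ≤ inner ℝ (e j) (v j) :=
      neg_le_of_abs_le (abs_real_inner_le_norm _ _)
    have a2 : ‖e j‖ * ‖v j‖ ≤ ‖v‖ * ‖e j‖ := by
      rw [mul_comm]
      exact mul_le_mul_of_nonneg_right (norm_apply_le v j) (norm_nonneg _)
    have a3 : θ j * -(‖v‖ * ‖e j‖) ≤ θ j * inner ℝ (e j) (v j) :=
      mul_le_mul_of_nonneg_left (by linarith) (by linarith [(hθ j).1])
    have a4 : 0.9 * ‖v j‖ ^ 2 ≤ θ j * ‖v j‖ ^ 2 :=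
      mul_le_mul_of_nonneg_right (hθ j).1 (sq_nonneg _)
    have a5 : θ j * (‖v‖ * ‖e j‖) ≤ 1.1 * (‖v‖ * ‖e j‖) :=
      mul_le_mul_of_nonneg_right (hθ j).2 (by positivity)
    linarith
  refine le_trans ?_ (Finset.sum_le_sum fun j _ => h1 j)
  rw [Finset.sum_sub_distrib, ← Finset.mul_sum, ← sq_norm_eq_sum, ← Finset.mul_sum,
    ← Finset.mul_sum]
  have := mul_le_mul_of_nonneg_left he (norm_nonneg v)
  nlinarith [sq_nonneg ‖v‖]

/-- The normalized gradient of the `j`-th cell. -/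
def cellStep (ν₁ ν₂ : Measure (Pt d)) (c : Codebook d k) (j : Fin k) : Pt d :=
  (ν₁.real (cell c j))⁻¹ • ∫ x in cell c j, (c j - x) ∂ν₂

theorem centroidUpdate_apply (t : ℕ) (ν₁ ν₂ : Measure (Pt d)) (c : Codebook d k) (j : Fin k) :
    centroidUpdate t ν₁ ν₂ c j = c j - ((t : ℝ) + 1)⁻¹ • cellStep ν₁ ν₂ c j := by
  rw [cellStep, smul_smul, ← mul_inv]
  rfl

theorem sq_norm_centroidUpdate_sub (t : ℕ) (ν₁ ν₂ : Measure (Pt d)) (c c₀ : Codebook d k) :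
    ‖centroidUpdate t ν₁ ν₂ c - c₀‖ ^ 2 = ‖c - c₀‖ ^ 2
      - 2 * ((t : ℝ) + 1)⁻¹ * ∑ j, inner ℝ (cellStep ν₁ ν₂ c j) ((c - c₀) j)
      + (((t : ℝ) + 1)⁻¹) ^ 2 * ∑ j, ‖cellStep ν₁ ν₂ c j‖ ^ 2 := by
  rw [sq_norm_eq_sum, sq_norm_eq_sum (c - c₀), Finset.mul_sum, Finset.mul_sum,
    ← Finset.sum_sub_distrib, ← Finset.sum_add_distrib]
  refine Finset.sum_congr rfl fun j _ => ?_
  set s := ((t : ℝ) + 1)⁻¹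
  have : (centroidUpdate t ν₁ ν₂ c - c₀) j = (c - c₀) j - s • cellStep ν₁ ν₂ c j := by
    rw [PiLp.sub_apply, PiLp.sub_apply, centroidUpdate_apply]
    abel
  rw [this, norm_sub_sq_real, real_inner_smul_right, norm_smul, real_inner_comm,
    Real.norm_of_nonneg (by positivity)]
  ring

theorem norm_setIntegral_cell_sub_le {ν : Measure (Pt d)} [IsFiniteMeasure ν]
    (hν : ∀ᵐ x ∂ν, ‖x‖ ≤ R) {c : Codebook d k} {j : Fin k} (hc : ‖c j‖ ≤ 2 * R) :
    ‖∫ x in cell c j, (c j - x) ∂ν‖ ≤ 3 * R * ν.real (cell c j) := by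
  refine norm_setIntegral_le_of_norm_le_const_ae (C := 3 * R) (measure_lt_top _ _) ?_
  filter_upwards [ae_restrict_of_ae hν] with x hx
  linarith [norm_sub_le (c j) x]

theorem norm_cellStep_self_le (hR : 0 < R) {ν : Measure (Pt d)} [IsFiniteMeasure ν]
    (hν : ∀ᵐ x ∂ν, ‖x‖ ≤ R) {c : Codebook d k} {j : Fin k} (hc : ‖c j‖ ≤ 2 * R) :
    ‖cellStep ν ν c j‖ ≤ 3 * R := by
  rw [cellStep, norm_smul, norm_inv, Real.norm_of_nonneg measureReal_nonneg]
  rcases (measureReal_nonneg : 0 ≤ ν.real (cell c j)).eq_or_lt with h | h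
  · rw [← h, inv_zero, zero_mul]
    positivity
  · rw [inv_mul_le_iff₀ h, mul_comm]
    exact norm_setIntegral_cell_sub_le hν hc

theorem measurableSet_massAccurate (μ : Measure (Pt d)) (c : Codebook d k) :
    MeasurableSet {ν | MassAccurate r₀ R μ ν c} := by
  have : {ν | MassAccurate r₀ R μ ν c} = ⋂ j, {ν : Measure (Pt d) |
      ‖ν.real (cell c j) - μ.real (cell c j)‖ < accuracy k R r₀ μ} := by
    ext ν
    simp [MassAccurate]
  rw [this]
  exact MeasurableSet.iInter fun j =>
    measurableSet_lt ((measurable_real_cell c j).sub_const _).norm measurable_const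

variable {Ω : Type*} [MeasurableSpace Ω] {P : Measure Ω} {X : Ω → Measure (Pt d)}
  {Xs : Fin n → Ω → Measure (Pt d)} {c₀ : Codebook d k}

theorem measurable_batchMean_iSup_comap {Ω : Type*} {Xs : Fin n → Ω → Measure (Pt d)}
    (B : Finset (Fin n)) :
    Measurable[⨆ i ∈ (B : Set (Fin n)), MeasurableSpace.comap (Xs i) inferInstance]
      fun ω => batchMean (fun i => Xs i ω) B := by
  refine @measurable_batchMean d n Ω (⨆ i ∈ (B : Set (Fin n)),
    MeasurableSpace.comap (Xs i) inferInstance) Xs B fun i hi => ?_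
  exact (comap_measurable (Xs i)).mono
    (le_biSup (fun i => MeasurableSpace.comap (Xs i) inferInstance) (by exact_mod_cast hi)) le_rfl

theorem indepFun_batchMean (hXs : ∀ i, Measurable (Xs i)) (hind : iIndepFun Xs P)
    {B₁ B₂ : Finset (Fin n)} (hB : Disjoint B₁ B₂) :
    IndepFun (fun ω => batchMean (fun i => Xs i ω) B₁) (fun ω => batchMean (fun i => Xs i ω) B₂)
      P := by
  have hI := indep_iSup_of_disjoint (m := fun i => MeasurableSpace.comap (Xs i) inferInstance)
    (fun i => (hXs i).comap_le) hind (Finset.disjoint_coe.2 hB)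
  exact indep_of_indep_of_le_right (indep_of_indep_of_le_left hI
    (measurable_batchMean_iSup_comap B₁).comap_le) (measurable_batchMean_iSup_comap B₂).comap_le

namespace QuantizationSetting

variable (hS : QuantizationSetting P X Xs R M r₀ c₀)
include hS

theorem failure_le (hkn : (k : ℝ) ≤ n) : k * (2 / (n : ℝ) ^ 10) ≤ 0.01 := by
  have hn : (2 : ℝ) ≤ n := by exact_mod_cast hS.two_le_sample
  have h1 : (2 : ℝ) ^ 9 ≤ (n : ℝ) ^ 9 := by gcongr
  rw [← mul_div_assoc, div_le_iff₀ (by positivity)]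
  calc (k : ℝ) * 2 ≤ n * 2 := by linarith
    _ ≤ 0.01 * ((n : ℝ) ^ 9 * n) := by nlinarith
    _ = _ := by ring

theorem measurableSet_massAccurate_batchMean (c : Codebook d k) (B : Finset (Fin n)) :
    MeasurableSet {ω | MassAccurate r₀ R (meanMeasure P X) (batchMean (fun i => Xs i ω) B) c} :=
  (measurable_batchMean fun i _ => hS.iid.measurable i) (measurableSet_massAccurate _ c)

variable [IsProbabilityMeasure P]

theorem measure_massAccurate_ge {B : Finset (Fin n)}
    (hB : 72000 * batchScale k n R M r₀ (meanMeasure P X) ≤ B.card) (hkn : (k : ℝ) ≤ n)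
    (c : Codebook d k) : 0.99 ≤
      P.real {ω | MassAccurate r₀ R (meanMeasure P X) (batchMean (fun i => Xs i ω) B) c} := by
  have h1 := hS.measure_not_massAccurate_le hB c
  have h2 := hS.failure_le hkn
  have h3 := probReal_compl_eq_one_sub (μ := P) (hS.measurableSet_massAccurate_batchMean c B)
  have h4 : {ω | MassAccurate r₀ R (meanMeasure P X) (batchMean (fun i => Xs i ω) B) c}ᶜ =
    {ω | ¬ MassAccurate r₀ R (meanMeasure P X) (batchMean (fun i => Xs i ω) B) c} := rfl
  rw [h4] at h3
  linarith

/-- Projection does not increase the distance to c₀, so the unprojected square can be expanded. When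
the masses of the first half are accurate, independence of the halves turns the mean of the cross
term into ∑ θ_j⟨v_j + e_j, v_j⟩ with v = c − c₀ and θ_j close to 1. Otherwise the truncated square
is charged 9kR². -/
theorem projectedStep_contraction {B₁ B₂ : Finset (Fin n)} (hdisj : Disjoint B₁ B₂)
    (hB₁ : 72000 * batchScale k n R M r₀ (meanMeasure P X) ≤ B₁.card)
    (hB₂ : 72000 * batchScale k n R M r₀ (meanMeasure P X) ≤ B₂.card) (hkn : (k : ℝ) ≤ n)
    {c : Codebook d k} (hc : ‖c - c₀‖ ≤ initRadius k R r₀ (meanMeasure P X)) (t : ℕ) :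
    ∫ ω, min (‖projectedStep R M t (c, batchMean (fun i => Xs i ω) B₁,
        batchMean (fun i => Xs i ω) B₂) - c₀‖ ^ 2) (9 * k * R ^ 2) ∂P ≤
      (1 - 1.5 / ((t : ℝ) + 1)) * ‖c - c₀‖ ^ 2
        + 12 * k * R ^ 2 * M / minMass k R (meanMeasure P X) / ((t : ℝ) + 1) ^ 2
        + 9 * k * R ^ 2 * (k * (2 / (n : ℝ) ^ 10)) := by
  obtain ⟨hmass, e, he, hesum⟩ := hS.gradient hc
  have hR := hS.radius_pos
  have hM := hS.bound_pos
  have hp := hS.mass_pos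
  have hk := hS.cast_pos
  have hall := ae_forall_sample_mem hS.iid hS.bounded
  have hA99 := hS.measure_massAccurate_ge hB₁ hkn c
  have hAc := hS.measure_not_massAccurate_le hB₁ c
  have hAm := hS.measurableSet_massAccurate_batchMean c B₁
  have hbnd := fun (ν : Measure (Pt d))
    (hν : MassAccurate r₀ R (meanMeasure P X) ν c) => hS.mass_bounds hc hν
  have hcj := hS.apply_le hc
  have hb1 := hS.card_pos hB₁
  have hb2 := hS.card_pos hB₂
  set μ := meanMeasure P X
  set p := minMass k R μ
  set ν₁ : Ω → Measure (Pt d) := fun ω => batchMean (fun i => Xs i ω) B₁ with hν₁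
  set ν₂ : Ω → Measure (Pt d) := fun ω => batchMean (fun i => Xs i ω) B₂ with hν₂
  have hm₁ : Measurable ν₁ := measurable_batchMean fun i _ => hS.iid.measurable i
  have hm₂ : Measurable ν₂ := measurable_batchMean fun i _ => hS.iid.measurable i
  set A : Set Ω := {ω | MassAccurate r₀ R μ (ν₁ ω) c} with hA
  set s : ℝ := ((t : ℝ) + 1)⁻¹ with hs
  have hs0 : 0 < s := by positivity
  have hpj : ∀ j, 0 < μ.real (cell c j) := fun j => lt_of_lt_of_le (by positivity) (hmass j)
  -- the inverse masses
  set F : Fin k → Measure (Pt d) → ℝ := fun j =>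
    {ν | MassAccurate r₀ R μ ν c}.indicator fun ν => (ν.real (cell c j))⁻¹ with hF
  have hFm : ∀ j, Measurable (F j) := fun j =>
    (measurable_real_cell c j).inv.indicator (measurableSet_massAccurate μ c)
  have hFle : ∀ j ν, 0 ≤ F j ν ∧ F j ν ≤ (0.92 * μ.real (cell c j))⁻¹ := by
    intro j ν
    have := hpj j
    by_cases hν : MassAccurate r₀ R μ ν c
    · have h := (hbnd ν hν j).1
      simp only [hF, Set.indicator, Set.mem_ofPred_eq, hν, if_true]
      exact ⟨inv_nonneg.2 measureReal_nonneg, inv_anti₀ (by positivity) h⟩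
    · simp only [hF, Set.indicator, Set.mem_ofPred_eq, hν, if_false]
      exact ⟨le_rfl, by positivity⟩
  have hFi : ∀ j, Integrable (fun ω => F j (ν₁ ω)) P := fun j =>
    Integrable.of_bound ((hFm j).comp hm₁).aestronglyMeasurable _ (Filter.Eventually.of_forall
      fun ω => by
        rw [Real.norm_of_nonneg (hFle j _).1]
        exact (hFle j _).2)
  -- The mean ratio of true to empirical mass on the accurate event. It lies between 0.99/1.08 and
  -- 1/0.92.
  set θ : Fin k → ℝ := fun j => μ.real (cell c j) * ∫ ω, F j (ν₁ ω) ∂P with hθ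
  have hθb : ∀ j, 0.9 ≤ θ j ∧ θ j ≤ 1.1 := by
    intro j
    have hq := hpj j
    constructor
    · have h1 : ∫ ω, A.indicator (fun _ => (1.08 * μ.real (cell c j))⁻¹) ω ∂P ≤
          ∫ ω, F j (ν₁ ω) ∂P := by
        refine integral_mono ((integrable_const _).indicator hAm) (hFi j) fun ω => ?_
        by_cases hω : MassAccurate r₀ R μ (ν₁ ω) c
        · have h := hbnd _ hω j
          simp only [hF, hA, Set.indicator, Set.mem_ofPred_eq, hω, if_true]
          exact inv_anti₀ (lt_of_lt_of_le (by positivity) h.1) h.2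
        · simp only [hF, hA, Set.indicator, Set.mem_ofPred_eq, hω, if_false]
          exact le_rfl
      rw [integral_indicator_const _ hAm, smul_eq_mul] at h1
      have h2 := mul_le_mul_of_nonneg_left h1 hq.le
      have h3 : μ.real (cell c j) * (P.real A * (1.08 * μ.real (cell c j))⁻¹) =
          P.real A / 1.08 := by field_simp
      rw [h3] at h2
      refine le_trans ?_ h2
      rw [le_div_iff₀ (by norm_num)]
      linarith
    · have h1 : ∫ ω, F j (ν₁ ω) ∂P ≤ ∫ _ω, (0.92 * μ.real (cell c j))⁻¹ ∂P :=
        integral_mono (hFi j) (integrable_const _) fun ω => (hFle j _).2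
      rw [integral_const, probReal_univ, one_smul] at h1
      have h2 := mul_le_mul_of_nonneg_left h1 hq.le
      refine h2.trans ?_
      rw [mul_inv, mul_left_comm, mul_inv_cancel₀ hq.ne']
      norm_num
  -- the gradients
  have hgrad := fun j => integral_integral_batchMean hS.iid hS.bounded hM
    (stronglyMeasurable_indicator_cell_sub c j) (b := 3 * R) (by positivity)
    (fun x hx => (norm_indicator_le_norm_self _ _).trans (by
      linarith [norm_sub_le (c j) x, hcj j])) hb2
  simp only [integral_indicator_cell_sub] at hgrad
  have hmean := fun j => integral_integral_batchMean hS.iid hS.bounded hM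
    (stronglyMeasurable_indicator_cell c j) (b := 1) zero_le_one
    (fun x _ => (norm_indicator_le_norm_self _ _).trans (by simp)) hb2
  simp only [integral_indicator_cell] at hmean
  have hind := indepFun_batchMean hS.iid.measurable hS.iid.indep hdisj
  set I : Fin k → Ω → ℝ := fun j ω =>
    F j (ν₁ ω) * inner ℝ (∫ x in cell c j, (c j - x) ∂(ν₂ ω)) ((c - c₀) j) with hI
  have hinner : ∀ j, Integrable
      (fun ω => inner ℝ (∫ x in cell c j, (c j - x) ∂(ν₂ ω)) ((c - c₀) j)) P := fun j =>
    (hgrad j).1.inner_const _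
  have hIi : ∀ j, Integrable (I j) P := fun j =>
    (hinner j).bdd_mul ((hFm j).comp hm₁).aestronglyMeasurable (c := (0.92 * μ.real (cell c j))⁻¹)
      (Filter.Eventually.of_forall fun ω => by
        rw [Real.norm_of_nonneg (hFle j _).1]
        exact (hFle j _).2)
  have hIint : ∀ j, ∫ ω, I j ω ∂P = θ j * inner ℝ ((c - c₀) j + e j) ((c - c₀) j) := by
    intro j
    have hGm : Measurable fun ν : Measure (Pt d) =>
        inner ℝ (∫ x in cell c j, (c j - x) ∂ν) ((c - c₀) j) :=
      (measurable_setIntegral_cell c j).inner measurable_const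
    have h1 := (hind.comp (hFm j) hGm).integral_fun_mul_eq_mul_integral
      ((hFm j).comp hm₁).aestronglyMeasurable (hGm.comp hm₂).aestronglyMeasurable
    have h2 : ∫ ω, inner ℝ (∫ x in cell c j, (c j - x) ∂(ν₂ ω)) ((c - c₀) j) ∂P =
        inner ℝ (∫ x in cell c j, (c j - x) ∂μ) ((c - c₀) j) := by
      rw [← (hgrad j).2, real_inner_comm, ← integral_inner (hgrad j).1]
      simp_rw [real_inner_comm]
      rfl
    refine h1.trans ?_
    change (∫ ω, F j (ν₁ ω) ∂P) *
      ∫ ω, inner ℝ (∫ x in cell c j, (c j - x) ∂(ν₂ ω)) ((c - c₀) j) ∂P = _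
    rw [h2, he j, real_inner_smul_left, hθ, PiLp.sub_apply]
    ring
  -- In the squared gradient one factor ν₂(W_j) is bounded by M and the other is kept, its mean
  -- being μ(W_j). The variance is thus of order M/p, and not M²/p²; the constant is 9/(0.92²·0.9) <
  -- 12.
  set J : Fin k → Ω → ℝ := fun j ω =>
    9 * R ^ 2 * M / (0.92 * μ.real (cell c j)) ^ 2 * (ν₂ ω).real (cell c j) with hJ
  have hJi : ∀ j, Integrable (J j) P := fun j => (hmean j).1.const_mul _
  have hJint : ∀ j, ∫ ω, J j ω ∂P ≤ 12 * R ^ 2 * M / p := by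
    intro j
    have hq := hpj j
    simp only [hJ]
    rw [integral_const_mul, (hmean j).2]
    have : 9 * R ^ 2 * M / (0.92 * μ.real (cell c j)) ^ 2 * μ.real (cell c j) =
        9 * R ^ 2 * M / (0.92 ^ 2 * μ.real (cell c j)) := by
      field_simp
    change 9 * R ^ 2 * M / (0.92 * μ.real (cell c j)) ^ 2 * μ.real (cell c j) ≤ _
    rw [this, div_le_div_iff₀ (by positivity) hp]
    have h1 := mul_le_mul_of_nonneg_left (hmass j) (by positivity : 0 ≤ R ^ 2 * M)
    nlinarith [mul_pos (mul_pos (pow_pos hR 2) hM) hp]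
  have hae : ∀ᵐ ω ∂P, min (‖projectedStep R M t (c, ν₁ ω, ν₂ ω) - c₀‖ ^ 2) (9 * k * R ^ 2) ≤
      ‖c - c₀‖ ^ 2 - 2 * s * ∑ j, I j ω + s ^ 2 * ∑ j, J j ω +
        Aᶜ.indicator (fun _ => 9 * k * R ^ 2) ω := by
    filter_upwards [hall] with ω hω
    have hb₁ := batchMean_mem_boundedMeasures hω B₁
    have hb₂ := batchMean_mem_boundedMeasures hω B₂
    have hfin : IsFiniteMeasure (ν₂ ω) := isFiniteMeasure_of_mem_boundedMeasures hb₂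
    have hJ0 : ∀ j, 0 ≤ J j ω := fun j => by positivity
    by_cases hωA : MassAccurate r₀ R μ (ν₁ ω) c
    · have hind0 : Aᶜ.indicator (fun _ => 9 * k * R ^ 2) ω = 0 :=
        Set.indicator_of_notMem (Set.notMem_compl_iff.2 (show ω ∈ A from hωA)) _
      rw [hind0, add_zero]
      have h1 : ‖projectedStep R M t (c, ν₁ ω, ν₂ ω) - c₀‖ ^ 2 ≤
          ‖centroidUpdate t (ν₁ ω) (ν₂ ω) c - c₀‖ ^ 2 := by
        rw [sq_norm_eq_sum, sq_norm_eq_sum]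
        refine Finset.sum_le_sum fun j _ => ?_
        have h := norm_ballProj_sub_le hR (centroidUpdate t (ν₁ ω) (ν₂ ω) c j)
          (mem_closedBall_zero_iff.1 (hS.optimal.1 j))
        have e1 : projectedStep R M t (c, ν₁ ω, ν₂ ω) j =
            ballProj R (centroidUpdate t (ν₁ ω) (ν₂ ω) c j) := by
          simp only [projectedStep]
          rw [truncate_of_mem hb₁, truncate_of_mem hb₂]
        rw [PiLp.sub_apply, PiLp.sub_apply, e1]
        gcongr
      refine (min_le_left _ _).trans (h1.trans ?_)
      rw [sq_norm_centroidUpdate_sub, ← hs]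
      have e1 : ∀ j, inner ℝ (cellStep (ν₁ ω) (ν₂ ω) c j) ((c - c₀) j) = I j ω := by
        intro j
        simp only [hI, hF, Set.indicator, Set.mem_ofPred_eq, hωA, if_true, cellStep]
        rw [real_inner_smul_left]
      have e2 : ∀ j, ‖cellStep (ν₁ ω) (ν₂ ω) c j‖ ^ 2 ≤ J j ω := by
        intro j
        have hq := hpj j
        have hlo := (hbnd _ hωA j).1
        have g1 := norm_setIntegral_cell_sub_le (ae_norm_le_of_mem_boundedMeasures hb₂) (hcj j)
        have g2 := measureReal_le_of_mem_boundedMeasures hM.le hb₂ (cell c j)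
        have g0 : 0 ≤ (ν₂ ω).real (cell c j) := measureReal_nonneg
        rw [cellStep, norm_smul, norm_inv, Real.norm_of_nonneg measureReal_nonneg, mul_pow, inv_pow]
        calc ((ν₁ ω).real (cell c j) ^ 2)⁻¹ * ‖∫ x in cell c j, (c j - x) ∂(ν₂ ω)‖ ^ 2
            ≤ ((0.92 * μ.real (cell c j)) ^ 2)⁻¹ *
                (9 * R ^ 2 * M * (ν₂ ω).real (cell c j)) := by
              refine mul_le_mul (inv_anti₀ (by positivity) (by gcongr)) ?_ (by positivity)
                (by positivity)
              calc ‖∫ x in cell c j, (c j - x) ∂(ν₂ ω)‖ ^ 2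
                  ≤ (3 * R * (ν₂ ω).real (cell c j)) ^ 2 := by gcongr
                _ = 9 * R ^ 2 * ((ν₂ ω).real (cell c j) * (ν₂ ω).real (cell c j)) := by ring
                _ ≤ 9 * R ^ 2 * (M * (ν₂ ω).real (cell c j)) := by gcongr
                _ = _ := by ring
          _ = J j ω := by
              simp only [hJ]
              rw [div_eq_mul_inv]
              ring
      simp_rw [e1]
      have := Finset.sum_le_sum fun j (_ : j ∈ Finset.univ) => e2 j
      gcongr
    · have hind0 : Aᶜ.indicator (fun _ => 9 * k * R ^ 2) ω = 9 * k * R ^ 2 :=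
        Set.indicator_of_mem (show ω ∈ Aᶜ from hωA) _
      have hI0 : ∀ j, I j ω = 0 := by
        intro j
        simp only [hI, hF, Set.indicator, Set.mem_ofPred_eq, hωA, if_false, zero_mul]
      rw [hind0]
      simp only [hI0, Finset.sum_const_zero, mul_zero, sub_zero]
      refine (min_le_right _ _).trans ?_
      have : 0 ≤ s ^ 2 * ∑ j, J j ω :=
        mul_nonneg (sq_nonneg _) (Finset.sum_nonneg fun j _ => hJ0 j)
      linarith [sq_nonneg ‖c - c₀‖]
  have hsumI : Integrable (fun ω => ∑ j, I j ω) P := integrable_finsetSum _ fun j _ => hIi j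
  have hsumJ : Integrable (fun ω => ∑ j, J j ω) P := integrable_finsetSum _ fun j _ => hJi j
  have i1 : Integrable (fun ω => ‖c - c₀‖ ^ 2 - 2 * s * ∑ j, I j ω) P :=
    (integrable_const _).sub (hsumI.const_mul _)
  have i2 : Integrable (fun ω => ‖c - c₀‖ ^ 2 - 2 * s * ∑ j, I j ω + s ^ 2 * ∑ j, J j ω) P :=
    i1.add (hsumJ.const_mul _)
  have i3 : Integrable (Aᶜ.indicator fun _ => 9 * k * R ^ 2) P :=
    (integrable_const _).indicator hAm.compl
  have hmin : Integrable (fun ω =>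
      min (‖projectedStep R M t (c, ν₁ ω, ν₂ ω) - c₀‖ ^ 2) (9 * k * R ^ 2)) P := by
    have hm : Measurable fun ω => projectedStep R M t (c, ν₁ ω, ν₂ ω) :=
      (measurable_projectedStep R M t).comp (measurable_const.prodMk (hm₁.prodMk hm₂))
    refine Integrable.of_bound (((hm.sub_const c₀).norm.pow_const 2).min
      measurable_const).aestronglyMeasurable (9 * k * R ^ 2) (Filter.Eventually.of_forall fun ω => ?_)
    rw [Real.norm_of_nonneg (le_min (sq_nonneg _) (by positivity))]
    exact min_le_right _ _
  refine (integral_mono_ae hmin (i2.add i3) hae).trans ?_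
  have eint : ∫ ω, (‖c - c₀‖ ^ 2 - 2 * s * ∑ j, I j ω + s ^ 2 * ∑ j, J j ω +
        Aᶜ.indicator (fun _ => 9 * k * R ^ 2) ω) ∂P = ‖c - c₀‖ ^ 2 -
      2 * s * ∑ j, θ j * inner ℝ ((c - c₀) j + e j) ((c - c₀) j) +
      s ^ 2 * ∑ j, ∫ ω, J j ω ∂P + P.real Aᶜ * (9 * k * R ^ 2) := by
    rw [integral_add i2 i3, integral_add i1 (hsumJ.const_mul _),
      integral_sub (integrable_const _) (hsumI.const_mul _), integral_const_mul, integral_const_mul,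
      integral_finsetSum _ fun j _ => hIi j, integral_finsetSum _ fun j _ => hJi j,
      integral_indicator_const _ hAm.compl]
    simp_rw [hIint]
    simp
  refine (le_of_eq eint).trans ?_
  have b1 := weighted_inner_ge hesum hθb
  have b2 : ∑ j, ∫ ω, J j ω ∂P ≤ 12 * k * R ^ 2 * M / p := by
    refine (Finset.sum_le_sum fun j _ => hJint j).trans (le_of_eq ?_)
    simp
    ring
  have b3 : P.real Aᶜ * (9 * k * R ^ 2) ≤ 9 * k * R ^ 2 * (k * (2 / (n : ℝ) ^ 10)) := by
    rw [mul_comm]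
    exact mul_le_mul_of_nonneg_left hAc (by positivity)
  have b4 := mul_le_mul_of_nonneg_left b1 (by positivity : 0 ≤ 2 * s)
  have b5 := mul_le_mul_of_nonneg_left b2 (sq_nonneg s)
  have e3 : 12 * k * R ^ 2 * M / p / ((t : ℝ) + 1) ^ 2 = s ^ 2 * (12 * k * R ^ 2 * M / p) := by
    rw [hs]
    field_simp
  have e4 : (1.5 : ℝ) / ((t : ℝ) + 1) = 1.5 * s := by rw [hs, div_eq_mul_inv]
  rw [e3, e4]
  linarith

end QuantizationSetting

end

section

/-! ### Contraction in mean without splitting, for sample points -/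

/-- On Y_i ∈ W the denominator is 1 plus the count over the other indices, which is independent of
Y_i. So for every β the mean of the ratio is E(β 1_W) times one common factor, and β = 1 identifies
p times this factor as the probability that the batch meets W. Multiplying by p avoids dividing by a
possible zero. -/
theorem mul_integral_ratio_eq {Ω S ι : Type*} [MeasurableSpace Ω] [MeasurableSpace S]
    {P : Measure Ω} [IsProbabilityMeasure P] {Y : ι → Ω → S} (hY : ∀ i, Measurable (Y i))
    (hind : iIndepFun Y P) {W : Set S} (hW : MeasurableSet W) {α : S → ℝ} (hα : Measurable α)
    {C : ℝ} (hC : ∀ i, ∀ᵐ ω ∂P, |α (Y i ω)| ≤ C) {a p : ℝ} {B : Finset ι}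
    (ha : ∀ i ∈ B, ∫ ω, W.indicator α (Y i ω) ∂P = a)
    (hp : ∀ i ∈ B, ∫ ω, W.indicator (fun _ => (1 : ℝ)) (Y i ω) ∂P = p) :
    p * ∫ ω, (∑ i ∈ B, W.indicator (fun _ => (1 : ℝ)) (Y i ω))⁻¹ *
        (∑ i ∈ B, W.indicator α (Y i ω)) ∂P =
      a * P.real {ω | ∃ i ∈ B, Y i ω ∈ W} := by
  classical
  have key : ∀ (β : S → ℝ) (D : ℝ), Measurable β → (∀ i, ∀ᵐ ω ∂P, |β (Y i ω)| ≤ D) →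
      ∀ b, (∀ i ∈ B, ∫ ω, W.indicator β (Y i ω) ∂P = b) →
      ∫ ω, (∑ i ∈ B, W.indicator (fun _ => (1 : ℝ)) (Y i ω))⁻¹ *
        (∑ i ∈ B, W.indicator β (Y i ω)) ∂P =
      b * ∑ i ∈ B, ∫ ω, (1 + ∑ l ∈ B.erase i, W.indicator (fun _ => (1 : ℝ)) (Y l ω))⁻¹ ∂P := by
    intro β D hβ hD b hb
    have hWβ : Measurable (W.indicator β) := hβ.indicator hW
    have hW1 : Measurable (W.indicator fun _ => (1 : ℝ)) := measurable_const.indicator hW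
    have h1 : ∀ ω, (∑ i ∈ B, W.indicator (fun _ => (1 : ℝ)) (Y i ω))⁻¹ *
        (∑ i ∈ B, W.indicator β (Y i ω)) = ∑ i ∈ B, W.indicator β (Y i ω) *
          (1 + ∑ l ∈ B.erase i, W.indicator (fun _ => (1 : ℝ)) (Y l ω))⁻¹ := by
      intro ω
      rw [Finset.mul_sum]
      refine Finset.sum_congr rfl fun i hi => ?_
      by_cases hiW : Y i ω ∈ W
      · rw [← Finset.add_sum_erase _ _ hi, Set.indicator_of_mem hiW, mul_comm]
      · rw [Set.indicator_of_notMem hiW, mul_zero, zero_mul]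
    have hm : ∀ i, Measurable fun ω =>
        (1 + ∑ l ∈ B.erase i, W.indicator (fun _ => (1 : ℝ)) (Y l ω))⁻¹ := fun i =>
      (measurable_const.add (Finset.measurable_sum _ fun l _ => hW1.comp (hY l))).inv
    have h01 : ∀ i ω, ‖(1 + ∑ l ∈ B.erase i, W.indicator (fun _ => (1 : ℝ)) (Y l ω))⁻¹‖ ≤ 1 := by
      intro i ω
      have h0 : 0 ≤ ∑ l ∈ B.erase i, W.indicator (fun _ => (1 : ℝ)) (Y l ω) :=
        Finset.sum_nonneg fun l _ => Set.indicator_nonneg (fun _ _ => zero_le_one) _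
      rw [Real.norm_of_nonneg (by positivity)]
      exact inv_le_one_of_one_le₀ (by linarith)
    have hi1 : ∀ i, Integrable (fun ω => W.indicator β (Y i ω)) P := fun i =>
      Integrable.of_bound (hWβ.comp (hY i)).aestronglyMeasurable D ((hD i).mono fun ω hω =>
        (norm_indicator_le_norm_self _ _).trans hω)
    simp_rw [h1]
    rw [integral_finsetSum, Finset.mul_sum]
    · refine Finset.sum_congr rfl fun i hi => ?_
      have hindep : IndepFun (fun ω => W.indicator β (Y i ω)) (fun ω =>
          (1 + ∑ l ∈ B.erase i, W.indicator (fun _ => (1 : ℝ)) (Y l ω))⁻¹) P := by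
        have h := hind.indepFun_finset {i} (B.erase i) (by simp) hY
        have hφ : Measurable fun y : ({i} : Finset ι) → S =>
            W.indicator β (y ⟨i, Finset.mem_singleton_self i⟩) :=
          hWβ.comp (measurable_pi_apply _)
        have hψ : Measurable fun y : ↥(B.erase i) → S =>
            (1 + ∑ l, W.indicator (fun _ => (1 : ℝ)) (y l))⁻¹ :=
          (measurable_const.add (Finset.measurable_sum _ fun l _ =>
            hW1.comp (measurable_pi_apply l))).inv
        have h' := h.comp hφ hψ
        have e : ∀ ω, ∑ l ∈ B.erase i, W.indicator (fun _ => (1 : ℝ)) (Y l ω) =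
            ∑ l : ↥(B.erase i), W.indicator (fun _ => (1 : ℝ)) (Y l ω) := fun ω =>
          (Finset.sum_coe_sort (B.erase i) fun l => W.indicator (fun _ => (1 : ℝ)) (Y l ω)).symm
        simp_rw [e]
        exact h'
      rw [hindep.integral_fun_mul_eq_mul_integral (hi1 i).aestronglyMeasurable
        (hm i).aestronglyMeasurable, hb i hi]
    · intro i _
      exact (hi1 i).mul_bdd (hm i).aestronglyMeasurable (Filter.Eventually.of_forall (h01 i))
  have k1 := key α C hα hC a ha
  have k2 := key (fun _ => 1) 1 measurable_const (fun i => Filter.Eventually.of_forall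
    fun ω => by simp) p hp
  have hAm : MeasurableSet {ω | ∃ i ∈ B, Y i ω ∈ W} := by
    have : {ω | ∃ i ∈ B, Y i ω ∈ W} = ⋃ i ∈ B, Y i ⁻¹' W := by
      ext ω
      simp
    rw [this]
    exact Finset.measurableSet_biUnion _ fun i _ => hY i hW
  have h2 : ∫ ω, (∑ i ∈ B, W.indicator (fun _ => (1 : ℝ)) (Y i ω))⁻¹ *
        (∑ i ∈ B, W.indicator (fun _ => (1 : ℝ)) (Y i ω)) ∂P =
      P.real {ω | ∃ i ∈ B, Y i ω ∈ W} := by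
    have e : ∀ ω, (∑ i ∈ B, W.indicator (fun _ => (1 : ℝ)) (Y i ω))⁻¹ *
        (∑ i ∈ B, W.indicator (fun _ => (1 : ℝ)) (Y i ω)) =
        {ω | ∃ i ∈ B, Y i ω ∈ W}.indicator (fun _ => 1) ω := by
      intro ω
      by_cases h : ∃ i ∈ B, Y i ω ∈ W
      · rw [Set.indicator_of_mem (show ω ∈ {ω | ∃ i ∈ B, Y i ω ∈ W} from h)]
        obtain ⟨i, hi, hiW⟩ := h
        refine inv_mul_cancel₀ (ne_of_gt ?_)
        refine Finset.sum_pos' (fun l _ => Set.indicator_nonneg (fun _ _ => zero_le_one) _)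
          ⟨i, hi, ?_⟩
        rw [Set.indicator_of_mem hiW]
        exact one_pos
      · rw [Set.indicator_of_notMem (show ω ∉ {ω | ∃ i ∈ B, Y i ω ∈ W} from h)]
        rw [Finset.sum_eq_zero, mul_zero]
        intro i hi
        exact Set.indicator_of_notMem (fun hiW => h ⟨i, hi, hiW⟩) _
    simp_rw [e]
    rw [integral_indicator_const _ hAm]
    simp
  rw [k1, ← h2, k2]
  ring

variable {d k n : ℕ} {R M r₀ : ℝ} {Ω : Type*} [MeasurableSpace Ω] {P : Measure Ω}
  {X : Ω → Measure (Pt d)} {c₀ : Codebook d k} {Ys : Fin n → Ω → Pt d}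

theorem cellStep_batchMean_dirac (y : Fin n → Pt d) (B : Finset (Fin n)) (c : Codebook d k)
    (j : Fin k) :
    cellStep (batchMean (fun i => Measure.dirac (y i)) B)
        (batchMean (fun i => Measure.dirac (y i)) B) c j =
      (∑ i ∈ B, (cell c j).indicator (fun _ => (1 : ℝ)) (y i))⁻¹ •
        ∑ i ∈ B, (cell c j).indicator (fun x => c j - x) (y i) := by
  have h1 := integral_batchMean (ν := fun i => Measure.dirac (y i)) (B := B)
    (h := (cell c j).indicator fun _ => (1 : ℝ)) fun i _ =>
      (integrable_const _).indicator (measurableSet_cell c j)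
  have h2 := integral_batchMean (ν := fun i => Measure.dirac (y i)) (B := B)
    (h := (cell c j).indicator fun x => c j - x) fun i _ => integrable_dirac (by
      exact enorm_lt_top)
  simp only [integral_dirac] at h1 h2
  rw [integral_indicator_cell] at h1
  rw [integral_indicator_cell_sub] at h2
  rw [cellStep, h1, h2, smul_eq_mul, mul_inv, inv_inv, smul_smul]
  rcases B.eq_empty_or_nonempty with rfl | hB
  · simp
  congr 1
  have : (B.card : ℝ) ≠ 0 := by exact_mod_cast hB.card_pos.ne'
  field_simp

namespace QuantizationSetting

variable [IsProbabilityMeasure P]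

/-- Here θ_j is the probability that the batch meets the cell, and the normalized gradient is an
average over the sample points of the cell, or 0. It is therefore bounded by 3R with no accuracy
event, and the last term of the bound is only slack. -/
theorem plainStep_contraction
    (hS : QuantizationSetting P X (fun i ω => Measure.dirac (Ys i ω)) R M r₀ c₀)
    (hY : ∀ i, Measurable (Ys i)) (hind : iIndepFun Ys P) {B : Finset (Fin n)}
    (hB : 72000 * batchScale k n R M r₀ (meanMeasure P X) ≤ B.card) (hkn : (k : ℝ) ≤ n)
    {c : Codebook d k} (hc : ‖c - c₀‖ ≤ initRadius k R r₀ (meanMeasure P X)) (t : ℕ) :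
    ∫ ω, min (‖plainStep R M t (c, batchMean (fun i => Measure.dirac (Ys i ω)) B,
        batchMean (fun i => Measure.dirac (Ys i ω)) B) - c₀‖ ^ 2) (9 * k * R ^ 2) ∂P ≤
      (1 - 1.5 / ((t : ℝ) + 1)) * ‖c - c₀‖ ^ 2
        + 12 * k * R ^ 2 * M / minMass k R (meanMeasure P X) / ((t : ℝ) + 1) ^ 2
        + 9 * k * R ^ 2 * (k * (2 / (n : ℝ) ^ 10)) := by
  obtain ⟨hmass, e, he, hesum⟩ := hS.gradient hc
  have hR := hS.radius_pos
  have hM := hS.bound_pos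
  have hp := hS.mass_pos
  have hk := hS.cast_pos
  have hall := ae_forall_sample_mem hS.iid hS.bounded
  have hA99 := hS.measure_massAccurate_ge hB hkn c
  have hcj := hS.apply_le hc
  have hpM := hS.minMass_le_bound
  have hb := hS.card_pos hB
  have hbnd := fun (ν : Measure (Pt d))
    (hν : MassAccurate r₀ R (meanMeasure P X) ν c) => hS.mass_bounds hc hν
  set μ := meanMeasure P X
  set p := minMass k R μ
  set ν : Ω → Measure (Pt d) := fun ω => batchMean (fun i => Measure.dirac (Ys i ω)) B with hν
  have hm : Measurable ν := measurable_batchMean fun i _ => hS.iid.measurable i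
  set s : ℝ := ((t : ℝ) + 1)⁻¹ with hs
  have hs0 : 0 < s := by positivity
  have hpj : ∀ j, 0 < μ.real (cell c j) := fun j => lt_of_lt_of_le (by positivity) (hmass j)
  have hYR : ∀ i, ∀ᵐ ω ∂P, ‖Ys i ω‖ ≤ R := by
    intro i
    filter_upwards [hall] with ω hω
    have := ae_norm_le_of_mem_boundedMeasures (hω i)
    rwa [ae_dirac_iff (measurableSet_le measurable_norm measurable_const)] at this
  set θ : Fin k → ℝ := fun j => P.real {ω | ∃ i ∈ B, Ys i ω ∈ cell c j} with hθ
  have hθb : ∀ j, 0.9 ≤ θ j ∧ θ j ≤ 1.1 := by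
    intro j
    refine ⟨le_trans (by linarith) (hA99.trans (measureReal_mono fun ω hω => ?_)),
      measureReal_le_one.trans (by norm_num)⟩
    -- A cell missed by the batch has empirical mass zero, which contradicts mass accuracy. So θ_j ≥
    -- 0.99.
    by_contra hcon
    have h0 := (hbnd _ hω j).1
    have h1 := integral_batchMean (ν := fun i => Measure.dirac (Ys i ω)) (B := B)
      (h := (cell c j).indicator fun _ => (1 : ℝ)) fun i _ =>
        (integrable_const _).indicator (measurableSet_cell c j)
    simp only [integral_dirac] at h1
    rw [integral_indicator_cell, Finset.sum_eq_zero, smul_zero] at h1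
    · rw [h1] at h0
      linarith [hpj j]
    · intro i hi
      exact Set.indicator_of_notMem (fun h => hcon ⟨i, hi, h⟩) _
  set I : Fin k → Ω → ℝ := fun j ω =>
    inner ℝ (cellStep (ν ω) (ν ω) c j) ((c - c₀) j) with hI
  have hstep : ∀ᵐ ω ∂P, ∀ j, ‖cellStep (ν ω) (ν ω) c j‖ ≤ 3 * R := by
    filter_upwards [hall] with ω hω j
    have hb := batchMean_mem_boundedMeasures hω B
    have hfin : IsFiniteMeasure (ν ω) := isFiniteMeasure_of_mem_boundedMeasures hb
    exact norm_cellStep_self_le hR (ae_norm_le_of_mem_boundedMeasures hb) (hcj j)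
  have hIm : ∀ j, Measurable (I j) := fun j =>
    (((measurable_real_cell c j).inv.smul (measurable_setIntegral_cell c j)).comp hm).inner
      measurable_const
  have hIi : ∀ j, Integrable (I j) P := fun j =>
    Integrable.of_bound (hIm j).aestronglyMeasurable (3 * R * ‖(c - c₀) j‖)
      (hstep.mono fun ω hω => (norm_inner_le_norm _ _).trans (by
        have := hω j
        gcongr))
  have hIint : ∀ j, ∫ ω, I j ω ∂P = θ j * inner ℝ ((c - c₀) j + e j) ((c - c₀) j) := by
    intro j
    set α : Pt d → ℝ := fun x => inner ℝ (c j - x) ((c - c₀) j) with hα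
    have hαm : Measurable α := Continuous.measurable (by fun_prop)
    have hmean1 := integral_integral_sample hS.iid hS.bounded
      (stronglyMeasurable_indicator_cell c j) (b := 1)
      (fun x _ => (norm_indicator_le_norm_self _ _).trans (by simp))
    have hmean2 := integral_integral_sample hS.iid hS.bounded
      (stronglyMeasurable_indicator_cell_sub c j) (b := 3 * R)
      (fun x hx => (norm_indicator_le_norm_self _ _).trans (by
        linarith [norm_sub_le (c j) x, hcj j]))
    simp only [integral_dirac] at hmean1 hmean2
    rw [integral_indicator_cell] at hmean1
    rw [integral_indicator_cell_sub] at hmean2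
    have hαW : ∀ x, (cell c j).indicator α x =
        inner ℝ ((c - c₀) j) ((cell c j).indicator (fun x => c j - x) x) := by
      intro x
      by_cases hx : x ∈ cell c j
      · rw [Set.indicator_of_mem hx, Set.indicator_of_mem hx, real_inner_comm]
      · rw [Set.indicator_of_notMem hx, Set.indicator_of_notMem hx, inner_zero_right]
    have hratio := mul_integral_ratio_eq hY hind (measurableSet_cell c j) hαm
      (C := 3 * R * ‖(c - c₀) j‖) (a := inner ℝ (∫ x in cell c j, (c j - x) ∂μ) ((c - c₀) j))
      (p := μ.real (cell c j)) (B := B)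
      (fun i => (hYR i).mono fun ω hω => (abs_real_inner_le_norm _ _).trans (by
        have : ‖c j - Ys i ω‖ ≤ 3 * R := by linarith [norm_sub_le (c j) (Ys i ω), hcj j]
        gcongr))
      (fun i _ => by
        simp_rw [hαW]
        rw [integral_inner, hmean2 i, real_inner_comm]
        refine Integrable.of_bound ((stronglyMeasurable_indicator_cell_sub c j).measurable.comp
          (hY i)).aestronglyMeasurable (3 * R) ((hYR i).mono fun ω hω => ?_)
        exact (norm_indicator_le_norm_self _ _).trans (by
          linarith [norm_sub_le (c j) (Ys i ω), hcj j]))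
      (fun i _ => hmean1 i)
    have e1 : ∀ ω, I j ω = (∑ i ∈ B, (cell c j).indicator (fun _ => (1 : ℝ)) (Ys i ω))⁻¹ *
        (∑ i ∈ B, (cell c j).indicator α (Ys i ω)) := by
      intro ω
      simp only [hI, hν]
      rw [cellStep_batchMean_dirac, real_inner_smul_left, sum_inner]
      simp_rw [hαW, real_inner_comm]
    simp_rw [e1]
    refine mul_left_cancel₀ (hpj j).ne' (hratio.trans ?_)
    rw [he j, real_inner_smul_left, PiLp.sub_apply]
    ring
  have hae : ∀ᵐ ω ∂P, min (‖plainStep R M t (c, ν ω, ν ω) - c₀‖ ^ 2) (9 * k * R ^ 2) ≤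
      ‖c - c₀‖ ^ 2 - 2 * s * ∑ j, I j ω + s ^ 2 * (9 * k * R ^ 2) := by
    filter_upwards [hall, hstep] with ω hω hω2
    have hb := batchMean_mem_boundedMeasures hω B
    have e1 : plainStep R M t (c, ν ω, ν ω) = centroidUpdate t (ν ω) (ν ω) c := by
      simp only [plainStep]
      rw [truncate_of_mem hb]
    refine (min_le_left _ _).trans ?_
    rw [e1, sq_norm_centroidUpdate_sub, ← hs]
    have : ∑ j, ‖cellStep (ν ω) (ν ω) c j‖ ^ 2 ≤ 9 * k * R ^ 2 := by
      calc ∑ j, ‖cellStep (ν ω) (ν ω) c j‖ ^ 2 ≤ ∑ _j : Fin k, (3 * R) ^ 2 :=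
            Finset.sum_le_sum fun j _ => by
              have := hω2 j
              gcongr
        _ = 9 * k * R ^ 2 := by
            simp
            ring
    gcongr
  have hsumI : Integrable (fun ω => ∑ j, I j ω) P := integrable_finsetSum _ fun j _ => hIi j
  have i1 : Integrable (fun ω => ‖c - c₀‖ ^ 2 - 2 * s * ∑ j, I j ω) P :=
    (integrable_const _).sub (hsumI.const_mul _)
  have hmin : Integrable (fun ω =>
      min (‖plainStep R M t (c, ν ω, ν ω) - c₀‖ ^ 2) (9 * k * R ^ 2)) P := by
    have hm : Measurable fun ω => plainStep R M t (c, ν ω, ν ω) :=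
      (measurable_plainStep R M t).comp (measurable_const.prodMk (hm.prodMk hm))
    refine Integrable.of_bound (((hm.sub_const c₀).norm.pow_const 2).min
      measurable_const).aestronglyMeasurable (9 * k * R ^ 2) (Filter.Eventually.of_forall fun ω => ?_)
    rw [Real.norm_of_nonneg (le_min (sq_nonneg _) (by positivity))]
    exact min_le_right _ _
  refine (integral_mono_ae hmin (i1.add (integrable_const _)) hae).trans ?_
  have eint : ∫ ω, (‖c - c₀‖ ^ 2 - 2 * s * ∑ j, I j ω + s ^ 2 * (9 * k * R ^ 2)) ∂P =
      ‖c - c₀‖ ^ 2 - 2 * s * ∑ j, θ j * inner ℝ ((c - c₀) j + e j) ((c - c₀) j) +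
      s ^ 2 * (9 * k * R ^ 2) := by
    rw [integral_add i1 (integrable_const _),
      integral_sub (integrable_const _) (hsumI.const_mul _), integral_const_mul,
      integral_finsetSum _ fun j _ => hIi j]
    simp_rw [hIint]
    simp
  refine (le_of_eq eint).trans ?_
  have b1 := weighted_inner_ge hesum hθb
  have b2 : 9 * k * R ^ 2 ≤ 12 * k * R ^ 2 * M / p := by
    rw [le_div_iff₀ hp]
    have := mul_le_mul_of_nonneg_left hpM (by positivity : 0 ≤ 12 * k * R ^ 2)
    have h0 : 0 ≤ k * R ^ 2 * p := by positivity
    linarith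
  have b4 := mul_le_mul_of_nonneg_left b1 (by positivity : 0 ≤ 2 * s)
  have b5 := mul_le_mul_of_nonneg_left b2 (sq_nonneg s)
  have e3 : 12 * k * R ^ 2 * M / p / ((t : ℝ) + 1) ^ 2 = s ^ 2 * (12 * k * R ^ 2 * M / p) := by
    rw [hs]
    field_simp
  have e4 : (1.5 : ℝ) / ((t : ℝ) + 1) = 1.5 * s := by rw [hs, div_eq_mul_inv]
  have b6 : 0 ≤ 9 * k * R ^ 2 * (k * (2 / (n : ℝ) ^ 10)) := by positivity
  rw [e3, e4]
  linarith

end QuantizationSetting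

end

section

/-! ### Risk bounds -/

variable {d k n : ℕ} {R M r₀ : ℝ} {Ω : Type*} [MeasurableSpace Ω] {P : Measure Ω}
  {X : Ω → Measure (Pt d)} {Xs : Fin n → Ω → Measure (Pt d)} {c₀ : Codebook d k}

theorem measurable_distortion (μ : Measure (Pt d)) [SFinite μ] :
    Measurable (distortion μ : Codebook d k → ℝ) := by
  have h : StronglyMeasurable fun q : Codebook d k × Pt d => ⨅ j, ‖q.2 - q.1 j‖ ^ 2 :=
    (continuous_iInf_sq continuous_fst continuous_snd).stronglyMeasurable
  exact (h.integral_prod_right' (ν := μ)).measurable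

/-- The new codepoint is a convex combination of the old one and of the empirical centroid of its
cell, which lies in B(0, R). This replaces the projection in the unsplit algorithm. -/
theorem norm_centroidUpdate_apply_le {ν : Measure (Pt d)} [IsFiniteMeasure ν] (hR : 0 < R)
    (hν : ∀ᵐ x ∂ν, ‖x‖ ≤ R) {c : Codebook d k} {j : Fin k} (hc : ‖c j‖ ≤ 2 * R) (t : ℕ) :
    ‖centroidUpdate t ν ν c j‖ ≤ 2 * R := by
  rw [centroidUpdate_apply, cellStep]
  rcases (measureReal_nonneg : 0 ≤ ν.real (cell c j)).eq_or_lt with h | h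
  · simpa [← h] using hc
  set s : ℝ := ((t : ℝ) + 1)⁻¹ with hs
  have hs0 : 0 < s := by positivity
  have hs1 : s ≤ 1 := inv_le_one_of_one_le₀ (by linarith [(Nat.cast_nonneg t : (0 : ℝ) ≤ t)])
  have hid : Integrable (fun x : Pt d => x) (ν.restrict (cell c j)) :=
    (integrable_of_continuous hν continuous_id).integrableOn
  have h1 : ∫ x in cell c j, (c j - x) ∂ν = ν.real (cell c j) • c j - ∫ x in cell c j, x ∂ν := by
    rw [integral_sub (integrable_const _) hid]
    simp
  have h2 : ‖∫ x in cell c j, x ∂ν‖ ≤ R * ν.real (cell c j) :=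
    norm_setIntegral_le_of_norm_le_const_ae (measure_lt_top _ _) (ae_restrict_of_ae hν)
  have h3 : c j - s • (ν.real (cell c j))⁻¹ • ∫ x in cell c j, (c j - x) ∂ν =
      (1 - s) • c j + s • ((ν.real (cell c j))⁻¹ • ∫ x in cell c j, x ∂ν) := by
    rw [h1, smul_sub, smul_smul (ν.real (cell c j))⁻¹, inv_mul_cancel₀ h.ne', one_smul, smul_sub,
      sub_smul, one_smul]
    abel
  have h4 : ‖(ν.real (cell c j))⁻¹ • ∫ x in cell c j, x ∂ν‖ ≤ R := by
    rw [norm_smul, norm_inv, Real.norm_of_nonneg h.le, inv_mul_le_iff₀ h, mul_comm]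
    exact h2
  rw [h3]
  refine (norm_add_le _ _).trans ?_
  rw [norm_smul, norm_smul, Real.norm_of_nonneg (sub_nonneg.2 hs1), Real.norm_of_nonneg hs0.le]
  have := mul_le_mul_of_nonneg_left hc (sub_nonneg.2 hs1)
  have := mul_le_mul_of_nonneg_left h4 hs0.le
  nlinarith

namespace QuantizationSetting

variable (hS : QuantizationSetting P X Xs R M r₀ c₀)
include hS

theorem sq_norm_sub_le_of_apply_le {c : Codebook d k} (hc : ∀ j, ‖c j‖ ≤ 2 * R) :
    ‖c - c₀‖ ^ 2 ≤ 9 * k * R ^ 2 := by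
  have hR := hS.radius_pos
  rw [sq_norm_eq_sum]
  calc ∑ j, ‖(c - c₀) j‖ ^ 2 ≤ ∑ _j : Fin k, (3 * R) ^ 2 := Finset.sum_le_sum fun j _ => by
        have h1 := mem_closedBall_zero_iff.1 (hS.optimal.1 j)
        have h2 : ‖(c - c₀) j‖ ≤ 3 * R := by
          rw [PiLp.sub_apply]
          linarith [norm_sub_le (c j) (c₀ j), hc j]
        gcongr
    _ = 9 * k * R ^ 2 := by
        simp
        ring

theorem norm_projectedStep_sub_le {ν₁ ν₂ : Measure (Pt d)} (h₁ : ν₁ ∈ boundedMeasures d R M)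
    (h₂ : ν₂ ∈ boundedMeasures d R M) (c : Codebook d k) (t : ℕ) :
    ‖projectedStep R M t (c, ν₁, ν₂) - c₀‖ ≤ ‖centroidUpdate t ν₁ ν₂ c - c₀‖ := by
  refine abs_le_of_sq_le_sq' ?_ (norm_nonneg _) |>.2
  rw [sq_norm_eq_sum, sq_norm_eq_sum]
  refine Finset.sum_le_sum fun j _ => ?_
  have h := norm_ballProj_sub_le hS.radius_pos (centroidUpdate t ν₁ ν₂ c j)
    (mem_closedBall_zero_iff.1 (hS.optimal.1 j))
  have e1 : projectedStep R M t (c, ν₁, ν₂) j = ballProj R (centroidUpdate t ν₁ ν₂ c j) := by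
    simp only [projectedStep]
    rw [truncate_of_mem h₁, truncate_of_mem h₂]
  rw [PiLp.sub_apply, PiLp.sub_apply, e1]
  gcongr

variable [IsProbabilityMeasure P]

/-- Since κp ≤ M and log n ≥ 1/2, the batch scale is at least k/2, so one full batch already needs
more than k sample elements. -/
theorem le_sample_size {L : ℕ} (hL : 144000 * batchScale k n R M r₀ (meanMeasure P X) ≤ L)
    (hLn : L ≤ n) : (k : ℝ) ≤ n := by
  have hκ := hS.kappa_pos
  have hκ1 := hS.kappa_le
  have hp := hS.mass_pos
  have hpM := hS.minMass_le_bound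
  have hk := hS.cast_pos
  have hM := hS.bound_pos
  have hlog : (1 / 2 : ℝ) ≤ Real.log n := by
    have h1 : Real.log 2 ≤ Real.log n :=
      Real.log_le_log (by norm_num) (by exact_mod_cast hS.two_le_sample)
    linarith [Real.log_two_gt_d9]
  have h1 : kappa k R r₀ (meanMeasure P X) * minMass k R (meanMeasure P X) ≤ M := by
    nlinarith
  have h2 : (k : ℝ) / 2 ≤ batchScale k n R M r₀ (meanMeasure P X) := by
    rw [batchScale, le_div_iff₀ (by positivity)]
    calc (k : ℝ) / 2 * (kappa k R r₀ (meanMeasure P X) * minMass k R (meanMeasure P X)) ^ 2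
        ≤ k / 2 * M ^ 2 := by gcongr
      _ = k * M ^ 2 * (1 / 2) := by ring
      _ ≤ k * M ^ 2 * Real.log n := by gcongr
  have h3 : (L : ℝ) ≤ n := by exact_mod_cast hLn
  linarith

theorem integral_sq_norm_iterates_sub_le
    {G : ℕ → Codebook d k × (Measure (Pt d) × Measure (Pt d)) → Codebook d k}
    (hG : ∀ t, Measurable (G t)) {ξ : ℕ → Ω → Measure (Pt d) × Measure (Pt d)}
    (hξ : ∀ t, Measurable (ξ t)) {T : ℕ} (hT : 1 ≤ T) (hTn : T ≤ n) (hkn : (k : ℝ) ≤ n)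
    {cInit : Codebook d k} (hinit : ‖cInit - c₀‖ ≤ initRadius k R r₀ (meanMeasure P X))
    (hind : ∀ t < T, IndepFun (fun ω => iterates G (fun s => ξ s ω) cInit t) (ξ t) P)
    (hK : ∀ t, ∀ᵐ ω ∂P, ‖iterates G (fun s => ξ s ω) cInit t - c₀‖ ^ 2 ≤ 9 * k * R ^ 2)
    (hstep : ∀ t < T, ∀ c, ‖c - c₀‖ ≤ initRadius k R r₀ (meanMeasure P X) →
      ∫ ω, min (‖G t (c, ξ t ω) - c₀‖ ^ 2) (9 * k * R ^ 2) ∂P ≤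
        (1 - 1.5 / ((t : ℝ) + 1)) * ‖c - c₀‖ ^ 2
        + 12 * k * R ^ 2 * M / minMass k R (meanMeasure P X) / ((t : ℝ) + 1) ^ 2
        + 9 * k * R ^ 2 * (k * (2 / (n : ℝ) ^ 10)))
    (hesc : ∀ t < T, ∀ c, ‖c - c₀‖ ≤ initRadius k R r₀ (meanMeasure P X) →
      P.real {ω | initRadius k R r₀ (meanMeasure P X) < ‖G t (c, ξ t ω) - c₀‖} ≤
        4 * k / (n : ℝ) ^ 10) :
    ∫ ω, ‖iterates G (fun s => ξ s ω) cInit T - c₀‖ ^ 2 ∂P ≤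
      26 * k * R ^ 2 * M / minMass k R (meanMeasure P X) / T := by
  have hR := hS.radius_pos
  have hM := hS.bound_pos
  have hp := hS.mass_pos
  have hk := hS.cast_pos
  have hpM := hS.minMass_le_bound
  have hn : (2 : ℝ) ≤ n := by exact_mod_cast hS.two_le_sample
  set p := minMass k R (meanMeasure P X)
  -- The failure term of each step is written with denominator (t+1)², at the price of the factor
  -- n², because t + 1 ≤ T ≤ n.
  set V := 12 * k * R ^ 2 * M / p + 9 * k * R ^ 2 * (k * (2 / (n : ℝ) ^ 10)) * (n : ℝ) ^ 2 with hV
  have hTn' : (T : ℝ) ≤ n := by exact_mod_cast hTn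
  have hT0 : (0 : ℝ) < T := by exact_mod_cast hT
  have h := integral_sq_norm_sub_le_of_local_contraction (P := P) (ξ := ξ) (G := G)
    (c := fun t ω => iterates G (fun s => ξ s ω) cInit t) hG
    (fun t => measurable_iterates hG cInit fun s _ => hξ s) hξ hT (x₀ := c₀)
    (r := initRadius k R r₀ (meanMeasure P X)) (K := 9 * k * R ^ 2) (V := V)
    (η := 4 * k / (n : ℝ) ^ 10) (by positivity) (by positivity) (fun t _ ω => rfl) hind
    (fun t _ => hK t) (Filter.Eventually.of_forall fun ω => hinit)
    (fun t ht c hc => by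
      refine (hstep t ht c hc).trans ?_
      have htn : (t : ℝ) + 1 ≤ n := by exact_mod_cast (by omega : t + 1 ≤ n)
      have h1 : 9 * k * R ^ 2 * (k * (2 / (n : ℝ) ^ 10)) ≤
          9 * k * R ^ 2 * (k * (2 / (n : ℝ) ^ 10)) * (n : ℝ) ^ 2 / ((t : ℝ) + 1) ^ 2 := by
        rw [le_div_iff₀ (by positivity)]
        gcongr
      rw [hV, add_div]
      linarith) hesc
  refine h.trans ?_
  gcongr
  -- With k, T ≤ n and n ≥ 2, the power n^10 makes both failure terms negligible: the factor 24 =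
  -- 2·12 rises to 26 at most.
  have hn6 : (2 : ℝ) ^ 6 ≤ (n : ℝ) ^ 6 := by gcongr
  have hn7 : (2 : ℝ) ^ 7 ≤ (n : ℝ) ^ 7 := by gcongr
  have hn0 : (0 : ℝ) < n := by linarith
  have b1 : k * (2 / (n : ℝ) ^ 10) * (n : ℝ) ^ 2 ≤ 2 / 2 ^ 7 := by
    calc k * (2 / (n : ℝ) ^ 10) * (n : ℝ) ^ 2 ≤ n * (2 / (n : ℝ) ^ 10) * (n : ℝ) ^ 2 := by gcongr
      _ = 2 / (n : ℝ) ^ 7 := by field_simp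
      _ ≤ 2 / 2 ^ 7 := by gcongr
  have b2 : 4 * k / (n : ℝ) ^ 10 * (T : ℝ) ^ 3 ≤ 4 / 2 ^ 6 := by
    calc 4 * k / (n : ℝ) ^ 10 * (T : ℝ) ^ 3 ≤ 4 * n / (n : ℝ) ^ 10 * (n : ℝ) ^ 3 := by gcongr
      _ = 4 / (n : ℝ) ^ 6 := by field_simp
      _ ≤ 4 / 2 ^ 6 := by gcongr
  have b3 : k * R ^ 2 ≤ k * R ^ 2 * M / p := by
    rw [le_div_iff₀ hp]
    gcongr
  have b4 := mul_le_mul_of_nonneg_left b1 (by positivity : 0 ≤ 9 * k * R ^ 2)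
  have b5 := mul_le_mul_of_nonneg_left b2 (by positivity : 0 ≤ 9 * k * R ^ 2)
  have e1 : 12 * k * R ^ 2 * M / p = 12 * (k * R ^ 2 * M / p) := by ring
  have e2 : 26 * k * R ^ 2 * M / p = 26 * (k * R ^ 2 * M / p) := by ring
  have e3 : 9 * k * R ^ 2 * (k * (2 / (n : ℝ) ^ 10)) * (n : ℝ) ^ 2 =
      9 * k * R ^ 2 * (k * (2 / (n : ℝ) ^ 10) * (n : ℝ) ^ 2) := mul_assoc _ _ _
  have e4 : 9 * k * R ^ 2 * (4 * k / (n : ℝ) ^ 10) * (T : ℝ) ^ 3 =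
      9 * k * R ^ 2 * (4 * k / (n : ℝ) ^ 10 * (T : ℝ) ^ 3) := mul_assoc _ _ _
  have e5 : 0 ≤ k * R ^ 2 := by positivity
  rw [hV, e1, e2, e3, e4]
  linarith

theorem risk_bound {c₁ : ℝ} (hc₁ : 0 < c₁) {L T : ℕ}
    (hL₀ : 144000 * batchScale k n R M r₀ (meanMeasure P X) ≤ L)
    (hL₁ : L ≤ c₁ * batchScale k n R M r₀ (meanMeasure P X)) (hT : T = n / L)
    {cT : Ω → Codebook d k} (hcT : Measurable cT)
    (hK : ∀ᵐ ω ∂P, ‖cT ω - c₀‖ ^ 2 ≤ 9 * k * R ^ 2)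
    (h0 : T = 0 → ∀ ω, ‖cT ω - c₀‖ ≤ initRadius k R r₀ (meanMeasure P X))
    (h1 : 1 ≤ T → ∫ ω, ‖cT ω - c₀‖ ^ 2 ∂P ≤
      26 * k * R ^ 2 * M / minMass k R (meanMeasure P X) / T) :
    Integrable (fun ω => distortion (meanMeasure P X) (cT ω)
      - optDistortion k R (meanMeasure P X)) P ∧
    ∫ ω, (distortion (meanMeasure P X) (cT ω) - optDistortion k R (meanMeasure P X)) ∂P ≤
      (meanMeasure P X).real Set.univ * (52 * c₁ * k ^ 2 * M ^ 3 * R ^ 2 * (Real.log n /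
        (n * kappa k R r₀ (meanMeasure P X) ^ 2 * minMass k R (meanMeasure P X) ^ 3))) := by
  have hfin := hS.isFiniteMeasure
  have hR := hS.radius_pos
  have hM := hS.bound_pos
  have hp := hS.mass_pos
  have hk := hS.cast_pos
  have hpM := hS.minMass_le_bound
  have hκ := hS.kappa_pos
  have hbs := hS.batchScale_pos
  have hρ0 := hS.initRadius_pos
  have hρR := hS.initRadius_le
  have hn : (0 : ℝ) < n := by
    have := hS.two_le_sample
    exact_mod_cast (by omega : 0 < n)
  have hlog : 0 < Real.log n := Real.log_pos (by exact_mod_cast hS.two_le_sample)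
  have hexc := fun c => distortion_sub_le (by have := hS.two_le; omega) hS.ae_norm_le hS.optimal c
  set μ := meanMeasure P X
  set p := minMass k R μ with hpd
  set κ := kappa k R r₀ μ with hκd
  have hLpos : (0 : ℝ) < L := lt_of_lt_of_le (by positivity) hL₀
  have hLpos' : 0 < L := by exact_mod_cast hLpos
  set D := 52 * c₁ * k ^ 2 * M ^ 3 * R ^ 2 * (Real.log n / (n * κ ^ 2 * p ^ 3)) with hD
  have hDeq : D = 52 * (k * R ^ 2 * M / p) * (c₁ * batchScale k n R M r₀ μ) / n := by
    rw [hD, batchScale, ← hκd, ← hpd]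
    field_simp
  have hDL : 52 * (k * R ^ 2 * M / p) * L / n ≤ D := by
    rw [hDeq]
    gcongr
  have hsq : Integrable (fun ω => ‖cT ω - c₀‖ ^ 2) P :=
    Integrable.of_bound ((hcT.sub_const c₀).norm.pow_const 2).aestronglyMeasurable _
      (hK.mono fun ω hω => by rwa [Real.norm_of_nonneg (sq_nonneg _)])
  have hbound : ∫ ω, ‖cT ω - c₀‖ ^ 2 ∂P ≤ D := by
    -- If T = 0 then n < L and the bound exceeds R², so the starting point suffices. Otherwise n ≤
    -- 2LT, and 26/T becomes 52L/n.
    rcases Nat.eq_zero_or_pos T with hT0 | hT0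
    · have hnL : n < L := by
        rcases Nat.div_eq_zero_iff.1 (hT ▸ hT0) with h | h
        · omega
        · exact h
      have hnL' : (n : ℝ) ≤ L := by exact_mod_cast hnL.le
      calc ∫ ω, ‖cT ω - c₀‖ ^ 2 ∂P ≤ ∫ _ω, R ^ 2 ∂P :=
            integral_mono hsq (integrable_const _) fun ω => by
              have := (h0 hT0 ω).trans hρR
              change ‖cT ω - c₀‖ ^ 2 ≤ R ^ 2
              gcongr
        _ = R ^ 2 := by simp
        _ ≤ 52 * (k * R ^ 2 * M / p) * L / n := by
            have hk1 : (1 : ℝ) ≤ k := by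
              have := hS.two_le
              exact_mod_cast (by omega : 1 ≤ k)
            have b1 : R ^ 2 ≤ k * R ^ 2 * M / p := by
              rw [le_div_iff₀ hp]
              calc R ^ 2 * p ≤ R ^ 2 * M := by gcongr
                _ ≤ k * (R ^ 2 * M) := le_mul_of_one_le_left (by positivity) hk1
                _ = _ := by ring
            rw [le_div_iff₀ hn]
            have := mul_le_mul b1 hnL' hn.le (by positivity)
            have : 0 ≤ k * R ^ 2 * M / p * L := by positivity
            linarith
        _ ≤ D := hDL
    · have hT0' : (0 : ℝ) < T := by exact_mod_cast hT0
      have hnT : n ≤ 2 * L * T := by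
        have h2 := Nat.lt_mul_div_succ n hLpos'
        rw [← hT] at h2
        nlinarith
      have hnT' : (n : ℝ) ≤ 2 * L * T := by exact_mod_cast hnT
      calc ∫ ω, ‖cT ω - c₀‖ ^ 2 ∂P ≤ 26 * k * R ^ 2 * M / p / T := h1 hT0
        _ = 26 * (k * R ^ 2 * M / p) / T := by ring
        _ ≤ 52 * (k * R ^ 2 * M / p) * L / n := by
            rw [div_le_div_iff₀ hT0' hn]
            have := mul_le_mul_of_nonneg_left hnT'
              (by positivity : 0 ≤ 26 * (k * R ^ 2 * M / p))
            linarith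
        _ ≤ D := hDL
  have hint : Integrable (fun ω => distortion μ (cT ω) - optDistortion k R μ) P := by
    refine Integrable.of_bound (C := μ.real Set.univ * (9 * k * R ^ 2) + |optDistortion k R μ|)
      (((measurable_distortion μ).comp hcT).sub_const _).aestronglyMeasurable ?_
    filter_upwards [hK] with ω hω
    have b1 := hexc (cT ω)
    have b2 : μ.real Set.univ * ‖cT ω - c₀‖ ^ 2 ≤ μ.real Set.univ * (9 * k * R ^ 2) := by gcongr
    have b3 : 0 ≤ distortion μ (cT ω) :=
      integral_nonneg fun x => Real.iInf_nonneg fun _ => sq_nonneg _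
    have b4 : 0 ≤ μ.real Set.univ * (9 * k * R ^ 2) := by positivity
    rw [Real.norm_eq_abs, abs_le]
    constructor
    · linarith [le_abs_self (optDistortion k R μ)]
    · linarith [abs_nonneg (optDistortion k R μ)]
  refine ⟨hint, ?_⟩
  calc ∫ ω, (distortion μ (cT ω) - optDistortion k R μ) ∂P
      ≤ ∫ ω, μ.real Set.univ * ‖cT ω - c₀‖ ^ 2 ∂P :=
        integral_mono hint (hsq.const_mul _) fun ω => hexc (cT ω)
    _ = μ.real Set.univ * ∫ ω, ‖cT ω - c₀‖ ^ 2 ∂P := integral_const_mul _ _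
    _ ≤ μ.real Set.univ * D := by gcongr

end QuantizationSetting

/-! ### From the truncated recursions to the two algorithms -/

theorem macQueen_eq_iterates {ν₁ ν₂ : ℕ → Measure (Pt d)}
    (h₁ : ∀ t, ν₁ t ∈ boundedMeasures d R M) (h₂ : ∀ t, ν₂ t ∈ boundedMeasures d R M)
    (cInit : Codebook d k) (t : ℕ) :
    macQueen R ν₁ ν₂ cInit t = iterates (projectedStep R M) (fun s => (ν₁ s, ν₂ s)) cInit t := by
  induction t with
  | zero => rfl
  | succ t ih =>
    simp only [macQueen, iterates, projectedStep]
    rw [truncate_of_mem (h₁ t), truncate_of_mem (h₂ t), ih]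

theorem macQueenUnsplit_eq_iterates {ν : ℕ → Measure (Pt d)}
    (h : ∀ t, ν t ∈ boundedMeasures d R M) (cInit : Codebook d k) (t : ℕ) :
    macQueenUnsplit ν cInit t = iterates (plainStep R M) (fun s => (ν s, ν s)) cInit t := by
  induction t with
  | zero => rfl
  | succ t ih =>
    simp only [macQueenUnsplit, iterates, plainStep]
    rw [truncate_of_mem (h t), ih]

namespace QuantizationSetting

theorem macQueen_risk_bound [IsProbabilityMeasure P]
    (hS : QuantizationSetting P X Xs R M r₀ c₀) {c₁ : ℝ} (hc₁ : 0 < c₁)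
    {L T : ℕ} (hL₀ : 144000 * batchScale k n R M r₀ (meanMeasure P X) ≤ L)
    (hL₁ : L ≤ c₁ * batchScale k n R M r₀ (meanMeasure P X)) (hT : T = n / L)
    {B B₁ B₂ : ℕ → Finset (Fin n)} (hB : IsMiniBatches T L B) (hH : IsHalving T B B₁ B₂)
    {cInit : Codebook d k} (hinit : ‖cInit - c₀‖ ≤ initRadius k R r₀ (meanMeasure P X)) :
    Integrable (fun ω => distortion (meanMeasure P X)
        (macQueen R (fun t => batchMean (fun i => Xs i ω) (B₁ t))
          (fun t => batchMean (fun i => Xs i ω) (B₂ t)) cInit T)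
        - optDistortion k R (meanMeasure P X)) P ∧
    ∫ ω, (distortion (meanMeasure P X)
        (macQueen R (fun t => batchMean (fun i => Xs i ω) (B₁ t))
          (fun t => batchMean (fun i => Xs i ω) (B₂ t)) cInit T)
        - optDistortion k R (meanMeasure P X)) ∂P ≤
      (meanMeasure P X).real Set.univ * (52 * c₁ * k ^ 2 * M ^ 3 * R ^ 2 * (Real.log n /
        (n * kappa k R r₀ (meanMeasure P X) ^ 2 * minMass k R (meanMeasure P X) ^ 3))) := by
  have hall := ae_forall_sample_mem hS.iid hS.bounded
  have hR := hS.radius_pos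
  set ξ : ℕ → Ω → Measure (Pt d) × Measure (Pt d) := fun t ω =>
    (batchMean (fun i => Xs i ω) (B₁ t), batchMean (fun i => Xs i ω) (B₂ t)) with hξd
  have hξ : ∀ t, Measurable (ξ t) := fun t =>
    (measurable_batchMean fun i _ => hS.iid.measurable i).prodMk
      (measurable_batchMean fun i _ => hS.iid.measurable i)
  set cT : ℕ → Ω → Codebook d k := fun t ω =>
    iterates (projectedStep R M) (fun s => ξ s ω) cInit t with hcTd
  have hG := fun t => measurable_projectedStep (d := d) (k := k) R M t
  have hcT : ∀ t, Measurable (cT t) := fun t => measurable_iterates hG cInit fun s _ => hξ s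
  have hinit2 := hS.apply_le hinit
  have hK : ∀ t ω, ‖cT t ω - c₀‖ ^ 2 ≤ 9 * k * R ^ 2 := by
    intro t ω
    refine hS.sq_norm_sub_le_of_apply_le fun j => ?_
    -- The starting point may lie outside B(0, R), hence only the bound 2R; later iterates are
    -- projected.
    cases t with
    | zero => exact hinit2 j
    | succ t =>
      refine (norm_ballProj_le hR _).trans ?_
      linarith
  have hmain := hS.risk_bound hc₁ hL₀ hL₁ hT (hcT T) (Filter.Eventually.of_forall (hK T))
    (fun hT0 ω => by
      subst hT0
      exact hinit)
    (fun hT1 => by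
      have hLn : L ≤ n := by
        by_contra! h
        rw [hT, Nat.div_eq_of_lt h] at hT1
        omega
      have hTn : T ≤ n := hT ▸ Nat.div_le_self n L
      have hcard : ∀ t < T, 72000 * batchScale k n R M r₀ (meanMeasure P X) ≤ (B₁ t).card ∧
          72000 * batchScale k n R M r₀ (meanMeasure P X) ≤ (B₂ t).card := by
        intro t ht
        have h1 := Finset.card_union_of_disjoint (hH.disjoint t ht)
        rw [hH.union_eq t ht, hB.card_eq t ht, hH.card_eq t ht] at h1
        have h2 : (L : ℝ) = (B₂ t).card + (B₂ t).card := by exact_mod_cast h1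
        rw [hH.card_eq t ht]
        constructor <;> linarith
      have hkn := hS.le_sample_size hL₀ hLn
      refine hS.integral_sq_norm_iterates_sub_le hG hξ hT1 hTn hkn hinit (fun t ht => ?_)
        (fun t => Filter.Eventually.of_forall (hK t)) (fun t ht c hc => ?_) (fun t ht c hc => ?_)
      · refine indepFun_iterates hG cInit hS.iid.measurable hS.iid.indep
          (fun s hs => hB.disjoint s (hs.trans ht) t ht hs.ne) fun s hs => ?_
        have hsT := hs.trans_lt ht
        have hsub₁ : (B₁ s : Set (Fin n)) ⊆ B s := by
          rw [← hH.union_eq s hsT]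
          exact_mod_cast Finset.subset_union_left
        have hsub₂ : (B₂ s : Set (Fin n)) ⊆ B s := by
          rw [← hH.union_eq s hsT]
          exact_mod_cast Finset.subset_union_right
        exact ((measurable_batchMean_iSup_comap (B₁ s)).mono (biSup_mono hsub₁) le_rfl).prodMk
          ((measurable_batchMean_iSup_comap (B₂ s)).mono (biSup_mono hsub₂) le_rfl)
      · exact hS.projectedStep_contraction (hH.disjoint t ht) (hcard t ht).1 (hcard t ht).2 hkn hc t
      · refine le_trans ?_ (hS.measure_initRadius_lt_le (hcard t ht).1 (hcard t ht).2 hc t)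
        refine ENNReal.toReal_mono (measure_ne_top _ _) (measure_mono_ae ?_)
        filter_upwards [hall] with ω hω hlt
        exact lt_of_lt_of_le hlt (hS.norm_projectedStep_sub_le
          (batchMean_mem_boundedMeasures hω _) (batchMean_mem_boundedMeasures hω _) c t))
  have hae : (fun ω => distortion (meanMeasure P X) (cT T ω) - optDistortion k R (meanMeasure P X))
      =ᵐ[P] fun ω => distortion (meanMeasure P X)
        (macQueen R (fun t => batchMean (fun i => Xs i ω) (B₁ t))
          (fun t => batchMean (fun i => Xs i ω) (B₂ t)) cInit T)
        - optDistortion k R (meanMeasure P X) := by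
    filter_upwards [hall] with ω hω
    rw [macQueen_eq_iterates (M := M) (fun t => batchMean_mem_boundedMeasures hω _)
      (fun t => batchMean_mem_boundedMeasures hω _)]
  exact ⟨hmain.1.congr hae, integral_congr_ae hae ▸ hmain.2⟩

theorem macQueenUnsplit_risk_bound [IsProbabilityMeasure P] {Ys : Fin n → Ω → Pt d}
    (hS : QuantizationSetting P X (fun i ω => Measure.dirac (Ys i ω)) R M r₀ c₀)
    (hY : ∀ i, Measurable (Ys i)) (hindY : iIndepFun Ys P) {c₁ : ℝ} (hc₁ : 0 < c₁)
    {L T : ℕ} (hL₀ : 144000 * batchScale k n R M r₀ (meanMeasure P X) ≤ L)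
    (hL₁ : L ≤ c₁ * batchScale k n R M r₀ (meanMeasure P X)) (hT : T = n / L)
    {B : ℕ → Finset (Fin n)} (hB : IsMiniBatches T L B)
    {cInit : Codebook d k} (hinit : ‖cInit - c₀‖ ≤ initRadius k R r₀ (meanMeasure P X)) :
    Integrable (fun ω => distortion (meanMeasure P X)
        (macQueenUnsplit (fun t => batchMean (fun i => Measure.dirac (Ys i ω)) (B t)) cInit T)
        - optDistortion k R (meanMeasure P X)) P ∧
    ∫ ω, (distortion (meanMeasure P X)
        (macQueenUnsplit (fun t => batchMean (fun i => Measure.dirac (Ys i ω)) (B t)) cInit T)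
        - optDistortion k R (meanMeasure P X)) ∂P ≤
      (meanMeasure P X).real Set.univ * (52 * c₁ * k ^ 2 * M ^ 3 * R ^ 2 * (Real.log n /
        (n * kappa k R r₀ (meanMeasure P X) ^ 2 * minMass k R (meanMeasure P X) ^ 3))) := by
  have hall := ae_forall_sample_mem hS.iid hS.bounded
  have hR := hS.radius_pos
  set ξ : ℕ → Ω → Measure (Pt d) × Measure (Pt d) := fun t ω =>
    (batchMean (fun i => Measure.dirac (Ys i ω)) (B t),
      batchMean (fun i => Measure.dirac (Ys i ω)) (B t)) with hξd
  have hξ : ∀ t, Measurable (ξ t) := fun t =>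
    (measurable_batchMean fun i _ => hS.iid.measurable i).prodMk
      (measurable_batchMean fun i _ => hS.iid.measurable i)
  set cT : ℕ → Ω → Codebook d k := fun t ω =>
    iterates (plainStep R M) (fun s => ξ s ω) cInit t with hcTd
  have hG := fun t => measurable_plainStep (d := d) (k := k) R M t
  have hcT : ∀ t, Measurable (cT t) := fun t => measurable_iterates hG cInit fun s _ => hξ s
  have hinit2 := hS.apply_le hinit
  have hK : ∀ t ω, ‖cT t ω - c₀‖ ^ 2 ≤ 9 * k * R ^ 2 := by
    intro t ω
    refine hS.sq_norm_sub_le_of_apply_le ?_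
    induction t with
    | zero => exact hinit2
    | succ t ih =>
      intro j
      have hb := truncate_mem R M (batchMean (fun i => Measure.dirac (Ys i ω)) (B t))
      have hfin := isFiniteMeasure_of_mem_boundedMeasures hb
      exact norm_centroidUpdate_apply_le hR (ae_norm_le_of_mem_boundedMeasures hb) (ih j) t
  have hmain := hS.risk_bound hc₁ hL₀ hL₁ hT (hcT T) (Filter.Eventually.of_forall (hK T))
    (fun hT0 ω => by
      subst hT0
      exact hinit)
    (fun hT1 => by
      have hLn : L ≤ n := by
        by_contra! h
        rw [hT, Nat.div_eq_of_lt h] at hT1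
        omega
      have hTn : T ≤ n := hT ▸ Nat.div_le_self n L
      have hbs := hS.batchScale_pos
      have hcard : ∀ t < T, 72000 * batchScale k n R M r₀ (meanMeasure P X) ≤ (B t).card := by
        intro t ht
        rw [hB.card_eq t ht]
        linarith
      have hkn := hS.le_sample_size hL₀ hLn
      refine hS.integral_sq_norm_iterates_sub_le hG hξ hT1 hTn hkn hinit (fun t ht => ?_)
        (fun t => Filter.Eventually.of_forall (hK t)) (fun t ht c hc => ?_) (fun t ht c hc => ?_)
      · refine indepFun_iterates hG cInit hS.iid.measurable hS.iid.indep
          (fun s hs => hB.disjoint s (hs.trans ht) t ht hs.ne) fun s hs => ?_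
        exact (measurable_batchMean_iSup_comap (B s)).prodMk (measurable_batchMean_iSup_comap (B s))
      · exact hS.plainStep_contraction hY hindY (hcard t ht) hkn hc t
      · refine le_trans ?_ (hS.measure_initRadius_lt_le (hcard t ht) (hcard t ht) hc t)
        refine ENNReal.toReal_mono (measure_ne_top _ _) (measure_mono_ae ?_)
        filter_upwards [hall] with ω hω hlt
        have hb := batchMean_mem_boundedMeasures hω (B t)
        have e : plainStep R M t (c, ξ t ω) = centroidUpdate t
            (batchMean (fun i => Measure.dirac (Ys i ω)) (B t))
            (batchMean (fun i => Measure.dirac (Ys i ω)) (B t)) c := by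
          simp only [plainStep, hξd]
          rw [truncate_of_mem hb]
        have hlt' : initRadius k R r₀ (meanMeasure P X) < ‖plainStep R M t (c, ξ t ω) - c₀‖ := hlt
        rw [e] at hlt'
        exact hlt')
  have hae : (fun ω => distortion (meanMeasure P X) (cT T ω) - optDistortion k R (meanMeasure P X))
      =ᵐ[P] fun ω => distortion (meanMeasure P X)
        (macQueenUnsplit (fun t => batchMean (fun i => Measure.dirac (Ys i ω)) (B t)) cInit T)
        - optDistortion k R (meanMeasure P X) := by
    filter_upwards [hall] with ω hω
    rw [macQueenUnsplit_eq_iterates (M := M) fun t => batchMean_mem_boundedMeasures hω _]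
  exact ⟨hmain.1.congr hae, integral_congr_ae hae ▸ hmain.2⟩

end QuantizationSetting

theorem exists_quantizationSetting [IsProbabilityMeasure P] (hk : 2 ≤ k) (hn : 2 ≤ n) (hR : 0 < R)
    (hM : 0 < M) (hiid : IsIIDSample P X Xs) (hX : ∀ᵐ ω ∂P, X ω ∈ boundedMeasures d R M)
    (hsupp : SupportedByMoreThan k (meanMeasure P X))
    (hmar : MarginCondition k R r₀ (meanMeasure P X)) {cInit : Codebook d k}
    (hinit : cInit ∈ neighborhood (optimalCodebooks k R (meanMeasure P X))
      (initRadius k R r₀ (meanMeasure P X))) :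
    ∃ c₀ : Codebook d k, QuantizationSetting P X Xs R M r₀ c₀ ∧
      ‖cInit - c₀‖ ≤ initRadius k R r₀ (meanMeasure P X) := by
  have hmem := meanMeasure_mem_boundedMeasures hiid.measurable_pop hX
  have := isFiniteMeasure_of_mem_boundedMeasures hmem
  obtain ⟨c₀, hc₀, hdist⟩ := Set.mem_iUnion₂.1 hinit
  obtain ⟨hp, hB⟩ := minMass_pos_and_minSeparation_pos hk hR
    (ae_norm_le_of_mem_boundedMeasures hmem) hsupp ⟨c₀, hc₀⟩
  exact ⟨c₀, ⟨hk, hn, hR, hM, hiid, hX, hc₀, hB, hp, hmar⟩, mem_closedBall_iff_norm.1 hdist⟩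

theorem IsIIDSample.dirac {Y : Ω → Pt d} {Ys : Fin n → Ω → Pt d} (h : IsIIDSample P Y Ys) :
    IsIIDSample P (fun ω => Measure.dirac (Y ω)) fun i ω => Measure.dirac (Ys i ω) where
  measurable_pop := Measure.measurable_dirac.comp h.measurable_pop
  measurable i := Measure.measurable_dirac.comp (h.measurable i)
  indep := h.indep.comp (fun _ => Measure.dirac) fun _ => Measure.measurable_dirac
  ident i := (h.ident i).comp Measure.measurable_dirac

end

end MeanMeasure

end

open MeanMeasure in
/-- The constants `c₀`, `c₁`, `C` are chosen before all other data, the dimension included. -/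
theorem theorem3p3 :
    ∃ c₀ : ℝ, 0 < c₀ ∧ ∀ c₁ : ℝ, c₀ ≤ c₁ → ∃ C : ℝ, 0 < C ∧
      -- random measures, split batches
      (∀ (d k n L T : ℕ) (R M r₀ : ℝ) (Ω : Type u) [MeasurableSpace Ω]
        (P : Measure Ω) [IsProbabilityMeasure P]
        (X : Ω → Measure (Pt d)) (Xs : Fin n → Ω → Measure (Pt d))
        (B B₁ B₂ : ℕ → Finset (Fin n)) (cInit : Codebook d k),
        2 ≤ k → 2 ≤ n → 0 < R → 0 < M →
        IsIIDSample P X Xs →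
        (∀ᵐ ω ∂P, X ω ∈ boundedMeasures d R M) →
        SupportedByMoreThan k (meanMeasure P X) →
        MarginCondition k R r₀ (meanMeasure P X) →
        c₀ * batchScale k n R M r₀ (meanMeasure P X) ≤ L →
        L ≤ c₁ * batchScale k n R M r₀ (meanMeasure P X) →
        T = n / L →
        IsMiniBatches T L B → IsHalving T B B₁ B₂ →
        cInit ∈ neighborhood (optimalCodebooks k R (meanMeasure P X))
          (initRadius k R r₀ (meanMeasure P X)) →
        Integrable (fun ω => distortion (meanMeasure P X)
            (macQueen R (fun t => batchMean (fun i => Xs i ω) (B₁ t))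
              (fun t => batchMean (fun i => Xs i ω) (B₂ t)) cInit T)
            - optDistortion k R (meanMeasure P X)) P ∧
        ∫ ω, (distortion (meanMeasure P X)
            (macQueen R (fun t => batchMean (fun i => Xs i ω) (B₁ t))
              (fun t => batchMean (fun i => Xs i ω) (B₂ t)) cInit T)
            - optDistortion k R (meanMeasure P X)) ∂P ≤
          (meanMeasure P X).real Set.univ *
            (C * k ^ 2 * M ^ 3 * R ^ 2 * (Real.log n /
              (n * kappa k R r₀ (meanMeasure P X) ^ 2 * minMass k R (meanMeasure P X) ^ 3)))) ∧
      -- sample points, batches not split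
      (∀ (d k n L T : ℕ) (R M r₀ : ℝ) (Ω : Type u) [MeasurableSpace Ω]
        (P : Measure Ω) [IsProbabilityMeasure P]
        (Y : Ω → Pt d) (Ys : Fin n → Ω → Pt d) (X : Ω → Measure (Pt d))
        (B : ℕ → Finset (Fin n)) (cInit : Codebook d k),
        2 ≤ k → 2 ≤ n → 0 < R → 0 < M →
        IsIIDSample P Y Ys →
        (∀ ω, X ω = Measure.dirac (Y ω)) →
        (∀ᵐ ω ∂P, X ω ∈ boundedMeasures d R M) →
        SupportedByMoreThan k (meanMeasure P X) →
        MarginCondition k R r₀ (meanMeasure P X) →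
        c₀ * batchScale k n R M r₀ (meanMeasure P X) ≤ L →
        L ≤ c₁ * batchScale k n R M r₀ (meanMeasure P X) →
        T = n / L →
        IsMiniBatches T L B →
        cInit ∈ neighborhood (optimalCodebooks k R (meanMeasure P X))
          (initRadius k R r₀ (meanMeasure P X)) →
        Integrable (fun ω => distortion (meanMeasure P X)
            (macQueenUnsplit (fun t => batchMean (fun i => Measure.dirac (Ys i ω)) (B t)) cInit T)
            - optDistortion k R (meanMeasure P X)) P ∧
        ∫ ω, (distortion (meanMeasure P X)
            (macQueenUnsplit (fun t => batchMean (fun i => Measure.dirac (Ys i ω)) (B t)) cInit T)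
            - optDistortion k R (meanMeasure P X)) ∂P ≤
          (meanMeasure P X).real Set.univ *
            (C * k ^ 2 * M ^ 3 * R ^ 2 * (Real.log n /
              (n * kappa k R r₀ (meanMeasure P X) ^ 2 * minMass k R (meanMeasure P X) ^ 3)))) := by
  refine ⟨144000, by norm_num, fun c₁ hc₁ => ⟨52 * c₁, by linarith, ?_, ?_⟩⟩
  · intro d k n L T R M r₀ Ω _ P _ X Xs B B₁ B₂ cInit hk hn hR hM hiid hX hsupp hmar hL₀ hL₁ hT hB
      hH hinit
    obtain ⟨c₀, hS, hc⟩ := exists_quantizationSetting hk hn hR hM hiid hX hsupp hmar hinit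
    exact hS.macQueen_risk_bound (by linarith) hL₀ hL₁ hT hB hH hc
  · intro d k n L T R M r₀ Ω _ P _ Y Ys X B cInit hk hn hR hM hiid hXY hX hsupp hmar hL₀ hL₁ hT hB
      hinit
    -- The points Y_i, and not only their Dirac masses, are needed independent, since the
    -- leave-one-out identity applies to them.
    obtain rfl : X = fun ω => Measure.dirac (Y ω) := funext hXY
    obtain ⟨c₀, hS, hc⟩ := exists_quantizationSetting hk hn hR hM hiid.dirac hX hsupp hmar hinit
    exact hS.macQueenUnsplit_risk_bound hiid.measurable hiid.indep (by linarith) hL₀ hL₁ hT hB hc
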